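/- Let $G=(V,E)$ be a connected, locally finite, non-oriented graph without loops or multiple edges and with at least two vertices, let $(a_e)_{e\in E}$ be positive weights, and let $i_0\in V$. All processes below start at $i_0$. Definitions. For positive weights $W=(W_e)_{e\in E}$, the vertex-reinforced jump process (VRJP) with weights $W$ is the jump process $(Y_t)_{t\ge 0}$ on $V$ which, conditionally on its past at time $t$, jumps from its position $i$ to a neighbour $j$ at rate $W_{\{i,j\}}L_j(t)$, where $L_j(t)=1+\int_0^t \mathbf 1_{\{Y_s=j\}}\,ds$. Its time modification is $X^W_t=Y_{A^{-1}(t)}$, where $A(s)=\int_0^s \frac{du}{L_{Y_u}(u)}$, and its skeleton is the sequence of its successive positions. The edge-reinforced random walk (ERRW) $(X_n)_{n\ge 0}$ with weights $(a_e)$ satisfies $\mathbb P(X_{n+1}=j\mid X_0,\dots,X_n)=\mathbf 1_{\{j\sim X_n\}}Z_n(\{X_n,j\})/\sum_{k\sim X_n}Z_n(\{X_n,k\})$, where $Z_n(e)$ is $a_e$ plus the number of crossings of $e$ up to time $n$. The continuous-time ERRW $(\tilde X_t)_{t\ge 0}$ with weights $(a_e)$ is built from independent exponential variables $(\tau^e_k)_{e\in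 E,k\ge 0}$ of parameter $1$: put $V^e_k=\sum_{l=0}^{k-1}\frac{\tau^e_l}{a_e+l}$ for $k\ge 1$, let the clock of $e=\{i,j\}$ at time $t$ show the total time that $\tilde X$ has spent at $i$ and at $j$ up to time $t$, and let $\tilde X$ cross an edge $e$ adjacent to its position exactly when the clock of $e$ reaches one of the values $V^e_k$, $k\ge 1$. If the jump times of one of these continuous-time processes accumulate at a finite time, the process is sent to a cemetery state from that time on; in the time change $A$, the cemetery is treated like a vertex. Theorem. (i) For every continuous-time ERRW $(\tilde X_t)_{t\ge 0}$ with weights $(a_e)$ there are, on the same probability space, independent random variables $W_e\sim\mathrm{Gamma}(a_e,1)$, $e\in E$, such that, conditionally on $W=(W_e)_{e\in E}$, the process $(\tilde X_t)_{t\ge 0}$ has the law of the time modification $(X^W_t)_{t\ge 0}$ of the VRJP with weights $W$. (ii) The ERRW $(X_n)_{n\ge 0}$ with weights $(a_e)$ is equal in law to the skeleton of a VRJP in random conductances $W_e$, $e\in E$, that are independent and $\mathrm{Gamma}(a_e,1)$-distributed. -/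

import Mathlib

open MeasureTheory ProbabilityTheory

open scoped NNReal

noncomputable section

/-- The state space of the continuous-time processes is `Option V`: the value `none` is the cemetery
state, in which a process sits from its explosion time on. It is discrete, like `V`. -/
instance optionMeasurableSpace {V : Type*} : MeasurableSpace (Option V) := ⊤

/-! ### Edge weights and the discrete edge-reinforced random walk -/

open Classical in
/-- The weight of the edge between `i` and `j`; it is `0` if `i` and `j` are not neighbours. -/
def pairWeight {V : Type*} (G : SimpleGraph V) (w : G.edgeSet → ℝ) (i j : V) : ℝ :=
  if h : G.Adj i j then w ⟨s(i, j), (SimpleGraph.mem_edgeSet G).2 h⟩ else 0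

open Classical in
/-- The weight `Z_n(e)` of the edge `e` at time `n` along the trajectory `x`: the initial weight plus
the number of crossings of `e` up to time `n`. -/
def reinforcedWeight {V : Type*} (G : SimpleGraph V) (a : G.edgeSet → ℝ) (x : ℕ → V) (n : ℕ)
    (e : G.edgeSet) : ℝ :=
  a e + ∑ k ∈ Finset.range n, if s(x k, x (k + 1)) = (e : Sym2 V) then 1 else 0

/-- The σ-algebra of `X 0, …, X n`. -/
abbrev chainPast {Ω V : Type*} [MeasurableSpace V] (X : ℕ → Ω → V) (n : ℕ) : MeasurableSpace Ω :=
  MeasurableSpace.comap (fun ω (k : Fin (n + 1)) => X k ω) inferInstance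

/-- `X` is an edge-reinforced random walk with initial weights `a` and starting point `i₀`. -/
structure IsERRW {V : Type*} [MeasurableSpace V] (G : SimpleGraph V) [G.LocallyFinite]
    (a : G.edgeSet → ℝ) (i₀ : V) {Ω : Type*} [MeasurableSpace Ω] (P : Measure Ω)
    (X : ℕ → Ω → V) : Prop where
  measurable : ∀ n, Measurable (X n)
  start : ∀ᵐ ω ∂P, X 0 ω = i₀
  step : ∀ (n : ℕ) (j : V),
    P⟦{ω | X (n + 1) ω = j} | chainPast X n⟧ =ᵐ[P] fun ω =>
      pairWeight G (reinforcedWeight G a (fun k => X k ω) n) (X n ω) j /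
        ∑ k ∈ G.neighborFinset (X n ω),
          pairWeight G (reinforcedWeight G a (fun k => X k ω) n) (X n ω) k

/-! ### Jump paths and their local times -/

/-- The time of the `n`-th jump of a path with successive holding times `S 0, S 1, …`. -/
def jumpTime (S : ℕ → ℝ) (n : ℕ) : ℝ := ∑ k ∈ Finset.range n, S k

open Classical in
/-- The right-continuous path that visits `ξ 0, ξ 1, …` and stays at `ξ n` for the time `S n`. If the
jumps accumulate, the path is in the cemetery state from the explosion time on. -/
def jumpPath {V : Type*} (ξ : ℕ → V) (S : ℕ → ℝ) (t : ℝ) : Option V :=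
  if h : ∃ n, jumpTime S n ≤ t ∧ t < jumpTime S (n + 1) then some (ξ (Nat.find h)) else none

open Classical in
/-- The time spent by the path `y` in the state `x` up to time `t`. -/
def localTime {α : Type*} (y : ℝ → α) (x : α) (t : ℝ) : ℝ :=
  ∫ u in (0 : ℝ)..t, if y u = x then 1 else 0

/-! ### The vertex-reinforced jump process -/

/-- The σ-algebra of the first `n + 1` positions and the first `n` holding times, that is, the
information available at the time of the `n`-th jump. -/
abbrev jumpPast {Ω V : Type*} [MeasurableSpace V] (ξ : ℕ → Ω → V) (S : ℕ → Ω → ℝ) (n : ℕ) :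
    MeasurableSpace Ω :=
  MeasurableSpace.comap
    (fun ω => ((fun k : Fin (n + 1) => ξ k ω), (fun k : Fin n => S k ω))) inferInstance

/-- The rate `W_{ij} L_j`, with `L_j` equal to 1 plus the local time of `j`, at which the
vertex-reinforced jump process jumps to `j` from its current position `i = ξ n`, at the time of its
`n`-th jump. As the local times of the neighbours of `i` do not change while the process sits at `i`,
this is also the rate at every time until the next jump. -/
def vrjpRate {V : Type*} (G : SimpleGraph V) (w : G.edgeSet → ℝ) (ξ : ℕ → V) (S : ℕ → ℝ)
    (n : ℕ) (j : V) : ℝ :=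
  pairWeight G w (ξ n) j * (1 + localTime (jumpPath ξ S) (some j) (jumpTime S n))

/-- The sum of the rates to all neighbours of the current position. -/
def vrjpTotalRate {V : Type*} (G : SimpleGraph V) [G.LocallyFinite] (w : G.edgeSet → ℝ)
    (ξ : ℕ → V) (S : ℕ → ℝ) (n : ℕ) : ℝ :=
  ∑ j ∈ G.neighborFinset (ξ n), vrjpRate G w ξ S n j

/-- The process with successive positions `ξ` and successive holding times `S` is a vertex-reinforced
jump process with weights `w` started at `i₀`: conditionally on the past at the `n`-th jump time, it
jumps to `j` at the rate `vrjpRate G w ξ S n j`, which does not change before the next jump. Hence the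
holding time exceeds `s` and the next position is `j` with conditional probability
`(rate of j / total rate) * exp (- total rate * s)`. -/
structure IsVRJP {V : Type*} [MeasurableSpace V] (G : SimpleGraph V) [G.LocallyFinite]
    (w : G.edgeSet → ℝ) (i₀ : V) {Ω : Type*} [MeasurableSpace Ω] (P : Measure Ω)
    (ξ : ℕ → Ω → V) (S : ℕ → Ω → ℝ) : Prop where
  measurable_position : ∀ n, Measurable (ξ n)
  measurable_holding : ∀ n, Measurable (S n)
  start : ∀ᵐ ω ∂P, ξ 0 ω = i₀
  jump : ∀ (n : ℕ) (j : V) (s : ℝ), 0 ≤ s →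
    P⟦{ω | s < S n ω ∧ ξ (n + 1) ω = j} | jumpPast ξ S n⟧ =ᵐ[P] fun ω =>
      vrjpRate G w (fun k => ξ k ω) (fun k => S k ω) n j /
          vrjpTotalRate G w (fun k => ξ k ω) (fun k => S k ω) n *
        Real.exp (-(vrjpTotalRate G w (fun k => ξ k ω) (fun k => S k ω) n * s))

/-- `κ` is a measurable version of the law of the vertex-reinforced jump process started at `i₀`, as a
function of its weights: for all positive weights `w`, under the probability measure `κ w`, the
sequence of pairs (position, holding time) is that of a vertex-reinforced jump process with
weights `w`. -/
def IsVRJPKernel {V : Type*} [MeasurableSpace V] (G : SimpleGraph V) [G.LocallyFinite] (i₀ : V)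
    (κ : Kernel (G.edgeSet → ℝ) (ℕ → V × ℝ)) : Prop :=
  IsMarkovKernel κ ∧ ∀ w : G.edgeSet → ℝ, (∀ e, 0 < w e) →
    IsVRJP G w i₀ (κ w) (fun n z => (z n).1) (fun n z => (z n).2)

/-! ### The time change -/

/-- The additive functional `A(s) = ∫_0^s du / L_{y_u}(u)`, where `L_x(u)` is 1 plus the local time
at `x`. For paths that explode, the cemetery is treated like any other state, so that `A` is an
increasing bijection of the half-line also in this case. -/
def additiveFunctional {α : Type*} (y : ℝ → α) (s : ℝ) : ℝ :=
  ∫ u in (0 : ℝ)..s, 1 / (1 + localTime y (y u) u)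

/-- The time-changed path `t ↦ y (A⁻¹ t)`. -/
def timeChange {α : Type*} (y : ℝ → α) (t : ℝ) : α :=
  y (sInf {s : ℝ | 0 ≤ s ∧ t ≤ additiveFunctional y s})

/-- The time modification of the path with positions and holding times `z`. -/
def timeChangedPath {V : Type*} (z : ℕ → V × ℝ) (t : ℝ≥0) : Option V :=
  timeChange (jumpPath (fun n => (z n).1) (fun n => (z n).2)) t

/-! ### The continuous-time edge-reinforced random walk -/

/-- The `k`-th alarm time `V_k` of an edge with initial weight `b` and exponential variables `τ`. -/
def alarmTime (b : ℝ) (τ : ℕ → ℝ) (k : ℕ) : ℝ := ∑ l ∈ Finset.range k, 1 / (b + l) * τ l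

/-- The clock of the edge `{i, j}`: it runs while the path is at `i` or at `j`. -/
def edgeClock {V : Type*} (y : ℝ → Option V) (i j : V) (t : ℝ) : ℝ :=
  localTime y (some i) t + localTime y (some j) t

/-- The path with positions `ξ` and holding times `S` obeys the alarms `τ`: while it stays at a vertex,
no clock of an adjacent edge rings, and at the time of each jump the clock of the crossed edge does. -/
def FollowsAlarms {V : Type*} (G : SimpleGraph V) (a : G.edgeSet → ℝ) (τ : G.edgeSet → ℕ → ℝ)
    (ξ : ℕ → V) (S : ℕ → ℝ) : Prop :=
  ∀ n : ℕ, 0 < S n ∧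
    (∃ h : G.Adj (ξ n) (ξ (n + 1)), ∃ k : ℕ, 0 < k ∧
      edgeClock (jumpPath ξ S) (ξ n) (ξ (n + 1)) (jumpTime S (n + 1)) =
        alarmTime (a ⟨s(ξ n, ξ (n + 1)), (SimpleGraph.mem_edgeSet G).2 h⟩)
          (τ ⟨s(ξ n, ξ (n + 1)), (SimpleGraph.mem_edgeSet G).2 h⟩) k) ∧
    ∀ (j : V) (h : G.Adj (ξ n) j) (k : ℕ), 0 < k →
      ∀ t ∈ Set.Ioo (jumpTime S n) (jumpTime S (n + 1)),
        edgeClock (jumpPath ξ S) (ξ n) j t ≠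
          alarmTime (a ⟨s(ξ n, j), (SimpleGraph.mem_edgeSet G).2 h⟩)
            (τ ⟨s(ξ n, j), (SimpleGraph.mem_edgeSet G).2 h⟩) k

/-- The process with successive positions `ξ` and successive holding times `S` is the continuous-time
edge-reinforced random walk with weights `a`, started at `i₀` and driven by the independent standard
exponential variables `τ`. -/
structure IsContinuousTimeERRW {V : Type*} [MeasurableSpace V] (G : SimpleGraph V)
    (a : G.edgeSet → ℝ) (i₀ : V) {Ω : Type*} [MeasurableSpace Ω] (P : Measure Ω)
    (τ : G.edgeSet → ℕ → Ω → ℝ) (ξ : ℕ → Ω → V) (S : ℕ → Ω → ℝ) : Prop where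
  measurable_alarm : ∀ e k, Measurable (τ e k)
  indep_alarm : iIndepFun (fun (p : G.edgeSet × ℕ) => τ p.1 p.2) P
  law_alarm : ∀ e k, HasLaw (τ e k) (expMeasure 1) P
  measurable_position : ∀ n, Measurable (ξ n)
  measurable_holding : ∀ n, Measurable (S n)
  start : ∀ᵐ ω ∂P, ξ 0 ω = i₀
  dynamics : ∀ᵐ ω ∂P, FollowsAlarms G a (fun e k => τ e k ω) (fun n => ξ n ω) (fun n => S n ω)

/-! ### Gamma conductances -/

/-- The joint law of independent Gamma variables with shapes `a e` and rate `1`. -/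
def gammaConductances {E : Type*} (a : E → ℝ) : Measure (E → ℝ) :=
  Measure.infinitePi (fun e => gammaMeasure (a e) 1)

end

/-!
Attach to every edge `e` a conductance `W e` with law `Gamma (a e, 1)` and, independently, a Poisson
process of rate one observed after time `W e`. By Kendall's theorem on Yule processes, the
logarithms of its points divided by `W e` have independent spacings, exponential with rates `a e`,
`a e + 1`, …: they are the alarm times `V_k` of the edge. Conversely `W e` and the Poisson process
can be recovered from the alarms.

Given `W`, let the edge `{i, j}` cross when the product `W e * L_i * L_j` reaches the next point of
its Poisson process. While the walk sits at `i`, this product grows at rate `W e * L_j`, so the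
memoryless property of exponential variables makes this walk a vertex-reinforced jump process.
After the time change the product becomes `W e * exp (T_i + T_j)`, with `T_i` and `T_j` the times
spent at the ends, so that `e` crosses when `T_i + T_j` reaches an alarm time: the time-changed
process obeys the alarms and therefore is the continuous-time edge-reinforced random walk.

The discrete statement follows, since the memoryless property also shows that the walk driven by
the alarms has the edge-reinforced random walk as its skeleton: an edge crossed `k` times runs
towards its next alarm at rate `a e + k`.
-/

noncomputable section

open scoped ENNReal

/-! ### Gamma and exponential laws -/

lemma lintegral_gammaMeasure {a r : ℝ} {f : ℝ → ℝ≥0∞} (hf : Measurable f) :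
    ∫⁻ x, f x ∂gammaMeasure a r = ∫⁻ x in Set.Ioi 0,
      ENNReal.ofReal (r ^ a / Real.Gamma a * x ^ (a - 1) * Real.exp (-(r * x))) * f x := by
  have hm : Measurable (gammaPDF a r) := (measurable_gammaPDFReal a r).ennreal_ofReal
  rw [gammaMeasure, lintegral_withDensity_eq_lintegral_mul _ hm hf,
    restrict_Ioi_eq_restrict_Ici, ← lintegral_indicator measurableSet_Ici]
  refine lintegral_congr fun x => ?_
  rcases lt_or_ge x 0 with hx | hx
  · simp [gammaPDF_of_neg hx, hx]
  · simp [gammaPDF_of_nonneg hx, hx]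

lemma ae_pos_gammaMeasure {a r : ℝ} : ∀ᵐ x ∂gammaMeasure a r, 0 < x := by
  rw [ae_iff, ← lintegral_indicator_one (by measurability),
    lintegral_gammaMeasure (measurable_one.indicator (by measurability))]
  exact setLIntegral_eq_zero measurableSet_Ioi fun x hx => by simp [Set.mem_Ioi.1 hx]

lemma lintegral_expMeasure {r : ℝ} {f : ℝ → ℝ≥0∞} (hf : Measurable f) :
    ∫⁻ x, f x ∂expMeasure r =
      ∫⁻ x in Set.Ioi 0, ENNReal.ofReal (r * Real.exp (-(r * x))) * f x := by
  simp [expMeasure, lintegral_gammaMeasure hf]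

lemma ae_pos_expMeasure {r : ℝ} : ∀ᵐ x ∂expMeasure r, 0 < x := ae_pos_gammaMeasure

lemma restrict_Ioi_map_sub_expMeasure {r t : ℝ} (ht : 0 ≤ t) :
    ((expMeasure r).restrict (Set.Ioi t)).map (fun x => x - t) =
      ENNReal.ofReal (Real.exp (-(r * t))) • expMeasure r := by
  refine Measure.ext_of_lintegral _ fun f hf => ?_
  have hft : Measurable fun x => f (x - t) := hf.comp (measurable_id.sub_const t)
  rw [lintegral_map hf (by fun_prop), ← lintegral_indicator measurableSet_Ioi,
    lintegral_expMeasure (hft.indicator measurableSet_Ioi), lintegral_smul_measure, smul_eq_mul,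
    lintegral_expMeasure hf, ← lintegral_const_mul' _ _ ENNReal.ofReal_ne_top,
    ← lintegral_indicator measurableSet_Ioi, ← lintegral_indicator measurableSet_Ioi,
    ← lintegral_add_right_eq_self _ t]
  refine lintegral_congr fun x => ?_
  by_cases hx : 0 < x
  · have hexp : r * Real.exp (-(r * (x + t))) =
        Real.exp (-(r * t)) * (r * Real.exp (-(r * x))) := by
      rw [mul_add, neg_add, Real.exp_add]
      ring
    simp [hx, add_pos_of_pos_of_nonneg hx ht, hexp, ENNReal.ofReal_mul (Real.exp_nonneg _),
      mul_assoc]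
  · simp [hx]

lemma expMeasure_Ioi {r t : ℝ} (hr : 0 < r) (ht : 0 ≤ t) :
    expMeasure r (Set.Ioi t) = ENNReal.ofReal (Real.exp (-(r * t))) := by
  have := isProbabilityMeasure_expMeasure hr
  have h := congr($(restrict_Ioi_map_sub_expMeasure (r := r) ht) Set.univ)
  rw [Measure.map_apply (by fun_prop) .univ] at h
  simpa using h

lemma cond_Ioi_map_sub_expMeasure {r t : ℝ} (hr : 0 < r) (ht : 0 ≤ t) :
    ((expMeasure r)[|Set.Ioi t]).map (fun x => x - t) = expMeasure r := by
  rw [ProbabilityTheory.cond, Measure.map_smul, restrict_Ioi_map_sub_expMeasure ht, smul_smul,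
    expMeasure_Ioi hr ht,
    ENNReal.inv_mul_cancel (by simp [Real.exp_pos]) ENNReal.ofReal_ne_top, one_smul]

lemma lintegral_expMeasure_one_comp_div {r : ℝ} (hr : 0 < r) {f : ℝ → ℝ≥0∞} (hf : Measurable f) :
    ∫⁻ x, f (x / r) ∂expMeasure 1 = ∫⁻ x, f x ∂expMeasure r := by
  have himage : (fun x => r * x) '' Set.Ioi 0 = Set.Ioi 0 := by
    simp [Set.image_const_mul_Ioi_zero hr]
  rw [lintegral_expMeasure (by fun_prop), lintegral_expMeasure hf, ← himage,
    lintegral_image_eq_lintegral_abs_deriv_mul measurableSet_Ioi (f' := fun _ => r)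
      (fun x _ => by simpa using ((hasDerivAt_id x).const_mul r).hasDerivWithinAt)
      (mul_right_injective₀ hr.ne').injOn, himage]
  refine setLIntegral_congr_fun measurableSet_Ioi fun x _ => ?_
  simp only [mul_div_cancel_left₀ x hr.ne', abs_of_pos hr, one_mul, ENNReal.ofReal_mul hr.le,
    mul_assoc]

/-! ### Infinite products of probability measures -/

section InfiniteProduct

variable {ι : Type*} {X : ι → Type*} [∀ i, MeasurableSpace (X i)]

lemma cond_pi_infinitePi (μ : ∀ i, Measure (X i)) [∀ i, IsProbabilityMeasure (μ i)] (F : Finset ι)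
    {S : ∀ i, Set (X i)} (hS : ∀ i, MeasurableSet (S i)) (hF : ∀ i ∉ F, S i = Set.univ)
    (h0 : ∀ i, μ i (S i) ≠ 0) :
    (Measure.infinitePi μ)[|(F : Set ι).pi S] = Measure.infinitePi fun i => (μ i)[|S i] := by
  classical
  have hprob (i : ι) : IsProbabilityMeasure ((μ i)[|S i]) := cond_isProbabilityMeasure (h0 i)
  have hmeas : MeasurableSet ((F : Set ι).pi S) := .pi F.countable_toSet fun i _ => hS i
  refine Measure.eq_infinitePi _ fun s t ht => ?_
  have hbox : (F : Set ι).pi S ∩ (s : Set ι).pi t =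
      ((F ∪ s : Finset ι) : Set ι).pi fun i => S i ∩ {x | i ∈ s → x ∈ t i} := by
    ext x
    simp only [Set.mem_inter_iff, Set.mem_pi, Finset.coe_union, Set.mem_union, Finset.mem_coe,
      Set.mem_ofPred_eq]
    grind
  have hfactor (i : ι) : μ i (S i ∩ {x | i ∈ s → x ∈ t i}) =
      μ i (S i) * if i ∈ s then (μ i)[t i|S i] else 1 := by
    by_cases hi : i ∈ s
    · simp [hi, mul_comm (μ i (S i)), cond_mul_eq_inter (hS i)]
    · simp [hi]
  have hprod : ∏ i ∈ F ∪ s, μ i (S i) = ∏ i ∈ F, μ i (S i) :=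
    (Finset.prod_subset Finset.subset_union_left fun i _ hi => by simp [hF i hi]).symm
  have hmeas' (i : ι) : MeasurableSet (S i ∩ {x | i ∈ s → x ∈ t i}) := by
    by_cases hi : i ∈ s <;> simp [hi, hS i, (hS i).inter (ht i)]
  rw [cond_apply hmeas, hbox, Measure.infinitePi_pi _ fun i _ => hS i,
    Measure.infinitePi_pi _ fun i _ => hmeas' i, Finset.prod_congr rfl fun i _ => hfactor i,
    Finset.prod_mul_distrib, hprod, Finset.prod_ite_mem, Finset.union_inter_cancel_right,
    ← mul_assoc, ENNReal.inv_mul_cancel, one_mul]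
  · exact Finset.prod_ne_zero_iff.2 fun i _ => h0 i
  · exact ENNReal.prod_ne_top fun i _ => measure_ne_top _ _

lemma measurable_optionElim {α Y : Type*} [MeasurableSpace Y] :
    Measurable fun (p : Y × (α → Y)) (k : Option α) => k.elim p.1 p.2 :=
  measurable_pi_lambda _ fun k => by cases k <;> simp only [Option.elim] <;> fun_prop

lemma map_optionElim_prod_infinitePi {α Y : Type*} [MeasurableSpace Y] (μ : Option α → Measure Y)
    [∀ k, IsProbabilityMeasure (μ k)] :
    ((μ none).prod (Measure.infinitePi fun i => μ (some i))).map
      (fun p k => k.elim p.1 p.2) = Measure.infinitePi μ := by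
  classical
  refine Measure.eq_infinitePi _ fun s A hA => ?_
  have hbox : (fun (p : Y × (α → Y)) (k : Option α) => k.elim p.1 p.2) ⁻¹'
      (s : Set (Option α)).pi A =
        {x | none ∈ s → x ∈ A none} ×ˢ (s.eraseNone : Set α).pi fun i => A (some i) := by
    ext p
    simp [Set.mem_pi, Option.forall]
  rw [Measure.map_apply measurable_optionElim (.pi s.countable_toSet fun i _ => hA i), hbox,
    Measure.prod_prod, Measure.infinitePi_pi _ fun i _ => hA _]
  by_cases hs : none ∈ s
  · rw [← Finset.mul_prod_erase s _ hs, ← Finset.map_some_eraseNone, Finset.prod_map]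
    simp [hs]
  · conv_rhs => rw [← Finset.erase_eq_of_notMem hs, ← Finset.map_some_eraseNone, Finset.prod_map]
    simp [hs]

end InfiniteProduct

/-! ### Independent standard exponential variables -/

instance isProbabilityMeasure_expMeasure_one : IsProbabilityMeasure (expMeasure 1) :=
  isProbabilityMeasure_expMeasure one_pos

/-- The law of a family of independent standard exponential variables. -/
def expField (ι : Type*) : Measure (ι → ℝ) := Measure.infinitePi fun _ => expMeasure 1

section ExpField

variable {ι κ : Type*}

instance isProbabilityMeasure_expField : IsProbabilityMeasure (expField ι) :=
  inferInstanceAs (IsProbabilityMeasure (Measure.infinitePi fun _ => expMeasure 1))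

lemma ae_expField_pos [Countable ι] : ∀ᵐ σ ∂expField ι, ∀ i, 0 < σ i :=
  ae_all_iff.2 fun i =>
    (measurePreserving_eval_infinitePi _ i).quasiMeasurePreserving.ae ae_pos_expMeasure

lemma lintegral_expField_shift (F : Finset ι) {t : ι → ℝ} (h0 : ∀ i, 0 ≤ t i)
    (hF : ∀ i ∉ F, t i = 0) {f : (ι → ℝ) → ℝ≥0∞} (hf : Measurable f) :
    ∫⁻ σ in {σ | ∀ i ∈ F, t i < σ i}, f (fun i => σ i - t i) ∂expField ι =
      ENNReal.ofReal (Real.exp (-∑ i ∈ F, t i)) * ∫⁻ σ, f σ ∂expField ι := by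
  classical
  let S (i : ι) : Set ℝ := if i ∈ F then Set.Ioi (t i) else Set.univ
  have hS (i : ι) : MeasurableSet (S i) := by
    simp only [S]
    split_ifs <;> measurability
  have hpos (i : ι) : expMeasure 1 (S i) ≠ 0 := by
    by_cases hi : i ∈ F <;> simp [S, hi, expMeasure_Ioi one_pos (h0 i), Real.exp_pos]
  have hset : {σ : ι → ℝ | ∀ i ∈ F, t i < σ i} = (F : Set ι).pi S := by
    ext σ
    exact forall₂_congr fun i hi => by simp [S, Finset.mem_coe.1 hi]
  have hmeasure : expField ι ((F : Set ι).pi S) =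
      ENNReal.ofReal (Real.exp (-∑ i ∈ F, t i)) := by
    rw [expField, Measure.infinitePi_pi _ fun i _ => hS i, ← Finset.sum_neg_distrib, Real.exp_sum,
      ENNReal.ofReal_prod_of_nonneg fun _ _ => Real.exp_nonneg _]
    exact Finset.prod_congr rfl fun i hi => by simp [S, hi, expMeasure_Ioi one_pos (h0 i)]
  have hmap (i : ι) : ((expMeasure 1)[|S i]).map (fun x => x - t i) = expMeasure 1 := by
    by_cases hi : i ∈ F
    · simpa [S, hi] using cond_Ioi_map_sub_expMeasure one_pos (h0 i)
    · simp [S, hi, hF i hi]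
  have hprob (i : ι) : IsProbabilityMeasure ((expMeasure 1)[|S i]) :=
    cond_isProbabilityMeasure (hpos i)
  have hcond : ((expField ι)[|(F : Set ι).pi S]).map (fun σ i => σ i - t i) = expField ι := by
    rw [expField, cond_pi_infinitePi _ F hS (fun i hi => by simp [S, hi]) hpos,
      Measure.infinitePi_map_pi (f := fun i x => x - t i) _ fun i => by fun_prop]
    exact congrArg _ (funext hmap)
  conv_rhs => rw [← hcond, lintegral_map hf (by fun_prop), ProbabilityTheory.cond,
    lintegral_smul_measure, smul_eq_mul, ← mul_assoc, hmeasure, ENNReal.mul_inv_cancel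
      (by simp [Real.exp_pos]) ENNReal.ofReal_ne_top, one_mul, ← hset]

lemma map_optionElim_expField {g : κ → Option ι} (hg : Function.Injective g) :
    ((expMeasure 1).prod (expField ι)).map
      (fun (p : ℝ × (ι → ℝ)) (k : κ) => (g k).elim p.1 p.2) = expField κ := by
  unfold expField
  rw [← Measure.map_infinitePi_infinitePi_of_inj (P := fun _ : Option ι => expMeasure 1) hg,
    ← map_optionElim_prod_infinitePi fun _ : Option ι => expMeasure 1,
    Measure.map_map (by fun_prop) measurable_optionElim]
  rfl

end ExpField

/-! ### The exponential race -/

section Race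

variable {E : Type*} {F : Finset E} {c : E → ℝ} {e : E} {σ : E × ℕ → ℝ}

/-- The runner `e ∈ F` wins the race: with speeds `c`, it is the first to run the distance
`σ (e, 0)`, and there is no tie. -/
def Wins (F : Finset E) (c : E → ℝ) (σ : E × ℕ → ℝ) (e : E) : Prop :=
  e ∈ F ∧ ∀ e' ∈ F, e' ≠ e → σ (e, 0) / c e < σ (e', 0) / c e'

open Classical in
/-- The distances left after the win of `e`: the winner starts to run its next distance. -/
def remaining (c : E → ℝ) (σ : E × ℕ → ℝ) (e : E) : E × ℕ → ℝ := fun p =>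
  if p.1 = e then σ (e, p.2 + 1)
  else if p.2 = 0 then σ p - c p.1 * (σ (e, 0) / c e) else σ p

lemma measurableSet_wins : MeasurableSet {σ | Wins F c σ e} := by
  have hset : {σ : E × ℕ → ℝ | Wins F c σ e} = {_σ : E × ℕ → ℝ | e ∈ F} ∩
      ⋂ e' ∈ F, {σ | e' ≠ e → σ (e, 0) / c e < σ (e', 0) / c e'} := by
    ext σ
    simp [Wins]
  rw [hset]
  refine (MeasurableSet.const _).inter (Finset.measurableSet_biInter F fun e' _ => ?_)
  exact (MeasurableSet.const _).imp (measurableSet_lt (by fun_prop) (by fun_prop))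

lemma measurable_remaining : Measurable fun σ : E × ℕ → ℝ => remaining c σ e := by
  refine measurable_pi_lambda _ fun p => ?_
  unfold remaining
  split_ifs <;> fun_prop

lemma lintegral_Ioi_const_mul_exp {b R s : ℝ} (hb : 0 ≤ b) (hR : 0 < R) :
    ∫⁻ x in Set.Ioi s, ENNReal.ofReal (b * Real.exp (-R * x)) =
      ENNReal.ofReal (b / R * Real.exp (-R * s)) := by
  rw [← ofReal_integral_eq_lintegral_ofReal]
  · rw [integral_const_mul, integral_exp_mul_Ioi (neg_lt_zero.2 hR)]
    congr 1
    field_simp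
  · exact (integrableOn_exp_mul_Ioi (neg_lt_zero.2 hR) s).const_mul b
  · exact Filter.Eventually.of_forall fun x => by positivity

open Classical in
/-- The position of a distance once the first distance of the runner `e` has been set apart
(`none`) and the later distances of `e` have been renumbered. -/
def splitCoordinate (e : E) (p : E × ℕ) : Option (E × ℕ) :=
  if p.1 = e then (if p.2 = 0 then none else some (e, p.2 - 1)) else some p

lemma splitCoordinate_injective : Function.Injective (splitCoordinate e) := by
  rintro ⟨x, m⟩ ⟨y, n⟩ h
  simp only [splitCoordinate] at h
  grind

/-- The distances `σ`, with a new first distance `y` for the runner `e`. -/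
def prependDistance (e : E) (y : ℝ) (σ : E × ℕ → ℝ) : E × ℕ → ℝ :=
  fun k => (splitCoordinate e k).elim y σ

open Classical in
/-- The distances which the opponents of `e` cover in their first run during the time `s`. -/
def headStart (c : E → ℝ) (e : E) (s : ℝ) : E × ℕ → ℝ :=
  fun k => if k.1 ≠ e ∧ k.2 = 0 then c k.1 * s else 0

lemma map_prependDistance_expField :
    ((expMeasure 1).prod (expField (E × ℕ))).map (fun p => prependDistance e p.1 p.2) =
      expField (E × ℕ) :=
  map_optionElim_expField splitCoordinate_injective

lemma measurable_prependDistance :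
    Measurable fun p : ℝ × (E × ℕ → ℝ) => prependDistance e p.1 p.2 :=
  measurable_pi_lambda _ fun k => (measurable_pi_apply (splitCoordinate e k)).comp
    measurable_optionElim

lemma lintegral_expField_eq_prependDistance {f : (E × ℕ → ℝ) → ℝ≥0∞} (hf : Measurable f) (e : E) :
    ∫⁻ σ, f σ ∂expField (E × ℕ) =
      ∫⁻ y, ∫⁻ σ, f (prependDistance e y σ) ∂expField (E × ℕ) ∂expMeasure 1 := by
  have hcomp : Measurable fun p : ℝ × (E × ℕ → ℝ) => f (prependDistance e p.1 p.2) :=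
    hf.comp measurable_prependDistance
  conv_lhs => rw [← map_prependDistance_expField (e := e)]
  rw [lintegral_map hf measurable_prependDistance, lintegral_prod _ hcomp.aemeasurable]

lemma prependDistance_self (y : ℝ) : prependDistance e y σ (e, 0) = y := by
  simp [prependDistance, splitCoordinate]

lemma prependDistance_of_ne {k : E × ℕ} (hk : k.1 ≠ e) (y : ℝ) :
    prependDistance e y σ k = σ k := by
  simp [prependDistance, splitCoordinate, hk]

lemma remaining_prependDistance (y : ℝ) :
    remaining c (prependDistance e y σ) e = fun k => σ k - headStart c e (y / c e) k := by
  funext ⟨x, m⟩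
  by_cases hx : x = e
  · simp [remaining, headStart, hx, prependDistance, splitCoordinate]
  · by_cases hm : m = 0 <;>
      simp [remaining, headStart, hx, hm, prependDistance, splitCoordinate]

open Classical in
lemma wins_prependDistance_iff (hc : ∀ i ∈ F, 0 < c i) (he : e ∈ F) (y : ℝ) :
    Wins F c (prependDistance e y σ) e ↔
      ∀ k ∈ (F.erase e).image (·, 0), headStart c e (y / c e) k < σ k := by
  simp only [Wins, he, true_and, Finset.forall_mem_image, Finset.mem_erase, and_imp,
    prependDistance_self]
  refine ⟨fun h i hie hi => ?_, fun h i hi hie => ?_⟩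
  · have := h i hi hie
    rw [prependDistance_of_ne hie, lt_div_iff₀' (hc i hi)] at this
    simpa [headStart, hie] using this
  · rw [prependDistance_of_ne hie, lt_div_iff₀' (hc i hi)]
    simpa [headStart, hie] using h hie hi

lemma lintegral_wins_prependDistance (hc : ∀ i ∈ F, 0 < c i) (hc0 : ∀ i ∉ F, c i = 0) (he : e ∈ F)
    {y : ℝ} (hy : 0 < y) {f : (E × ℕ → ℝ) → ℝ≥0∞} (hf : Measurable f) :
    ∫⁻ σ in {σ | Wins F c (prependDistance e y σ) e},
        f (remaining c (prependDistance e y σ) e) ∂expField (E × ℕ) =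
      ENNReal.ofReal (Real.exp (-((∑ i ∈ F, c i) - c e) * (y / c e))) *
        ∫⁻ σ, f σ ∂expField (E × ℕ) := by
  classical
  have hnonneg (i : E) : 0 ≤ c i := by
    by_cases hi : i ∈ F
    · exact (hc i hi).le
    · exact (hc0 i hi).ge
  have hstart (k : E × ℕ) : 0 ≤ headStart c e (y / c e) k := by
    have := hnonneg k.1
    have := hc e he
    unfold headStart
    split_ifs <;> positivity
  have hstart0 (k : E × ℕ) (hk : k ∉ (F.erase e).image (·, 0)) :
      headStart c e (y / c e) k = 0 := by
    rcases k with ⟨i, m⟩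
    simp only [Finset.mem_image, Finset.mem_erase, Prod.mk.injEq] at hk
    unfold headStart
    split_ifs with h
    · rw [hc0 i fun hi => hk ⟨i, ⟨h.1, hi⟩, rfl, h.2.symm⟩, zero_mul]
    · rfl
  have hsum : ∑ k ∈ (F.erase e).image (·, 0), headStart c e (y / c e) k =
      ((∑ i ∈ F, c i) - c e) * (y / c e) := by
    rw [Finset.sum_image (by simp), ← Finset.add_sum_erase F c he, add_sub_cancel_left,
      Finset.sum_mul]
    exact Finset.sum_congr rfl fun i hi => by simp [headStart, Finset.ne_of_mem_erase hi]
  simp only [wins_prependDistance_iff hc he, remaining_prependDistance]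
  rw [lintegral_expField_shift _ hstart hstart0 hf, hsum, neg_mul]

lemma lintegral_wins (hc : ∀ i ∈ F, 0 < c i) (hc0 : ∀ i ∉ F, c i = 0) (he : e ∈ F)
    {f : ℝ → (E × ℕ → ℝ) → ℝ≥0∞} (hf : Measurable (Function.uncurry f)) :
    ∫⁻ σ in {σ | Wins F c σ e}, f (σ (e, 0) / c e) (remaining c σ e) ∂expField (E × ℕ) =
      ∫⁻ s in Set.Ioi 0, ENNReal.ofReal (c e * Real.exp (-(∑ i ∈ F, c i) * s)) *
        ∫⁻ σ, f s σ ∂expField (E × ℕ) := by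
  have hmeas : Measurable fun σ : E × ℕ → ℝ => f (σ (e, 0) / c e) (remaining c σ e) :=
    hf.comp (.prodMk (by fun_prop) measurable_remaining)
  have hint : Measurable fun s => ENNReal.ofReal (Real.exp (-((∑ i ∈ F, c i) - c e) * s)) *
      ∫⁻ σ, f s σ ∂expField (E × ℕ) := .mul (by fun_prop) hf.lintegral_prod_right
  have hslice (y : ℝ) (hy : 0 < y) :
      ∫⁻ σ, {σ | Wins F c σ e}.indicator (fun σ => f (σ (e, 0) / c e) (remaining c σ e))
        (prependDistance e y σ) ∂expField (E × ℕ) =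
      ENNReal.ofReal (Real.exp (-((∑ i ∈ F, c i) - c e) * (y / c e))) *
        ∫⁻ σ, f (y / c e) σ ∂expField (E × ℕ) := by
    have hwins : MeasurableSet {σ | Wins F c (prependDistance e y σ) e} :=
      measurableSet_wins.preimage (measurable_prependDistance.comp measurable_prodMk_left)
    rw [← lintegral_wins_prependDistance hc hc0 he hy (f := f (y / c e))
      (hf.comp measurable_prodMk_left), ← lintegral_indicator hwins]
    simp only [Set.indicator, Set.mem_ofPred_eq, prependDistance_self]
  rw [← lintegral_indicator measurableSet_wins,
    lintegral_expField_eq_prependDistance (hmeas.indicator measurableSet_wins) e,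
    lintegral_congr_ae (ae_pos_expMeasure.mono hslice),
    lintegral_expMeasure_one_comp_div (hc e he) hint, lintegral_expMeasure hint]
  refine setLIntegral_congr_fun measurableSet_Ioi fun s _ => ?_
  rw [← mul_assoc, ← ENNReal.ofReal_mul (by have := hc e he; positivity), mul_assoc,
    ← Real.exp_add]
  congr 4
  ring

end Race

lemma measurable_apply_of_countable {α β ι : Type*} [MeasurableSpace α] [MeasurableSpace β]
    [Countable ι] {e : α → ι} (he : ∀ i, MeasurableSet {x | e x = i}) {f : ι → α → β}
    (hf : ∀ i, Measurable (f i)) : Measurable fun x => f (e x) x := by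
  intro s hs
  have hpre : (fun x => f (e x) x) ⁻¹' s = ⋃ i, {x | e x = i} ∩ f i ⁻¹' s := by
    ext x
    simp
  rw [hpre]
  exact MeasurableSet.iUnion fun i => (he i).inter (hf i hs)

/-! ### Sequences of exponential races -/

/-- The rules of a sequence of exponential races in which runners and speeds of the `n`-th race
depend on a history `h : H`, which is updated with the winner and the duration of the race. -/
structure RaceScheme (E H : Type*) [MeasurableSpace H] where
  runners : ℕ → H → Finset E
  speed : ℕ → H → E → ℝ
  next : ℕ → H → E → ℝ → H
  runners_nonempty : ∀ n h, (runners n h).Nonempty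
  speed_pos : ∀ n h, ∀ e ∈ runners n h, 0 < speed n h e
  speed_eq_zero : ∀ n h, ∀ e ∉ runners n h, speed n h e = 0
  measurable_speed : ∀ n e, Measurable fun h => speed n h e
  measurable_next : ∀ n e, Measurable fun p : H × ℝ => next n p.1 e p.2

namespace RaceScheme

variable {E H : Type*} [MeasurableSpace H] (R : RaceScheme E H)

lemma mem_runners_iff (n : ℕ) (h : H) (e : E) : e ∈ R.runners n h ↔ R.speed n h e ≠ 0 :=
  ⟨fun he => (R.speed_pos n h e he).ne', not_imp_comm.1 (R.speed_eq_zero n h e)⟩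

lemma speed_nonneg (n : ℕ) (h : H) (e : E) : 0 ≤ R.speed n h e := by
  by_cases he : e ∈ R.runners n h
  · exact (R.speed_pos n h e he).le
  · exact (R.speed_eq_zero n h e he).ge

/-- The sum of the speeds of all runners, which is the rate of the duration of the race. -/
def totalSpeed (n : ℕ) (h : H) : ℝ := ∑ e ∈ R.runners n h, R.speed n h e

lemma totalSpeed_pos (n : ℕ) (h : H) : 0 < R.totalSpeed n h :=
  Finset.sum_pos (R.speed_pos n h) (R.runners_nonempty n h)

/-- The runner `e` wins the `n`-th race. -/
def WinsAt (n : ℕ) (p : H × (E × ℕ → ℝ)) (e : E) : Prop :=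
  Wins (R.runners n p.1) (R.speed n p.1) p.2 e

/-- The duration of the `n`-th race if `e` is its winner. -/
def duration (n : ℕ) (p : H × (E × ℕ → ℝ)) (e : E) : ℝ := p.2 (e, 0) / R.speed n p.1 e

open Classical in
/-- The winner of the `n`-th race, arbitrary if the race is a tie. -/
def winner [Nonempty E] (n : ℕ) (p : H × (E × ℕ → ℝ)) : E :=
  if h : ∃ e, R.WinsAt n p e then h.choose else Classical.arbitrary E

/-- The history and the distances left after the `n`-th race if `e` is its winner. -/
def stepOf (n : ℕ) (e : E) (p : H × (E × ℕ → ℝ)) : H × (E × ℕ → ℝ) :=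
  (R.next n p.1 e (R.duration n p e), remaining (R.speed n p.1) p.2 e)

/-- The history and the distances left after the `n`-th race. -/
def step [Nonempty E] (n : ℕ) (p : H × (E × ℕ → ℝ)) : H × (E × ℕ → ℝ) :=
  R.stepOf n (R.winner n p) p

/-- The history and the distances left after the first `n` races. -/
def run [Nonempty E] (p : H × (E × ℕ → ℝ)) : ℕ → H × (E × ℕ → ℝ)
  | 0 => p
  | n + 1 => R.step n (run p n)

variable {R} {n : ℕ} {p : H × (E × ℕ → ℝ)} {e e' : E}

lemma WinsAt.unique (h : R.WinsAt n p e) (h' : R.WinsAt n p e') : e = e' := by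
  by_contra hne
  exact lt_asymm (h.2 e' h'.1 (Ne.symm hne)) (h'.2 e h.1 hne)

lemma WinsAt.winner_eq [Nonempty E] (h : R.WinsAt n p e) : R.winner n p = e := by
  have hex : ∃ e, R.WinsAt n p e := ⟨e, h⟩
  rw [winner, dif_pos hex]
  exact hex.choose_spec.unique h

lemma pairwise_disjoint_winsAt (R : RaceScheme E H) (n : ℕ) :
    Pairwise (Function.onFun Disjoint fun e => {p | R.WinsAt n p e}) :=
  fun _ _ hne => Set.disjoint_left.2 fun _ hp hp' => hne (WinsAt.unique hp hp')

variable (R n e)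

section Measurability

lemma measurable_duration : Measurable fun p => R.duration n p e :=
  ((measurable_pi_apply (e, 0)).comp measurable_snd).div
    ((R.measurable_speed n e).comp measurable_fst)

lemma measurableSet_mem_runners : MeasurableSet {h | e ∈ R.runners n h} := by
  simp only [R.mem_runners_iff]
  exact (R.measurable_speed n e) (measurableSet_singleton 0).compl

lemma measurable_stepOf : Measurable (R.stepOf n e) := by
  have hcoord (q : E × ℕ) : Measurable fun p : H × (E × ℕ → ℝ) => p.2 q :=
    (measurable_pi_apply q).comp measurable_snd
  refine Measurable.prodMk ?_ (measurable_pi_lambda _ fun q => ?_)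
  · exact (R.measurable_next n e).comp (measurable_fst.prodMk (R.measurable_duration n e))
  · unfold remaining
    split_ifs
    · exact hcoord _
    · exact (hcoord _).sub (((R.measurable_speed n _).comp measurable_fst).mul
        (R.measurable_duration n e))
    · exact hcoord _

variable [Countable E]

lemma measurable_totalSpeed : Measurable (R.totalSpeed n) := by
  have htsum : R.totalSpeed n = fun h => (∑' e, ENNReal.ofReal (R.speed n h e)).toReal := by
    funext h
    rw [tsum_eq_sum fun e he => by rw [R.speed_eq_zero n h e he, ENNReal.ofReal_zero],
      ← ENNReal.ofReal_sum_of_nonneg fun e _ => R.speed_nonneg n h e, ← totalSpeed,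
      ENNReal.toReal_ofReal (R.totalSpeed_pos n h).le]
  rw [htsum]
  exact (Measurable.tsum fun e => (R.measurable_speed n e).ennreal_ofReal).ennreal_toReal

lemma measurableSet_winsAt : MeasurableSet {p | R.WinsAt n p e} := by
  have hrunner (e' : E) : MeasurableSet {p : H × (E × ℕ → ℝ) | e' ∈ R.runners n p.1} :=
    measurable_fst (R.measurableSet_mem_runners n e')
  simp only [WinsAt, Wins, Set.ofPred_and, Set.ofPred_forall]
  refine (hrunner e).inter (MeasurableSet.iInter fun e' => (hrunner e').imp ?_)
  exact (MeasurableSet.const _).imp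
    (measurableSet_lt (R.measurable_duration n e) (R.measurable_duration n e'))

lemma measurableSet_exists_winsAt : MeasurableSet {p | ∃ e, R.WinsAt n p e} := by
  rw [Set.ofPred_exists]
  exact MeasurableSet.iUnion fun e => R.measurableSet_winsAt n e

variable [Nonempty E]

lemma measurableSet_winner_eq : MeasurableSet {p | R.winner n p = e} := by
  have hset : {p | R.winner n p = e} = {p | R.WinsAt n p e} ∪
      ({p | ∃ e', R.WinsAt n p e'}ᶜ ∩ {_p | Classical.arbitrary E = e}) := by
    ext p
    by_cases h : ∃ e', R.WinsAt n p e'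
    · obtain ⟨e', he'⟩ := h
      simp only [Set.mem_ofPred_eq, Set.mem_union, Set.mem_inter_iff, Set.mem_compl_iff,
        show ∃ e', R.WinsAt n p e' from ⟨e', he'⟩, not_true_eq_false, false_and, or_false,
        he'.winner_eq]
      exact ⟨fun hee' => hee' ▸ he', he'.unique⟩
    · have hne : ¬ R.WinsAt n p e := fun he => h ⟨e, he⟩
      simp [winner, h, hne]
  rw [hset]
  exact (R.measurableSet_winsAt n e).union
    ((R.measurableSet_exists_winsAt n).compl.inter (MeasurableSet.const _))

lemma measurable_step : Measurable (R.step n) :=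
  measurable_apply_of_countable (e := R.winner n) (f := R.stepOf n)
    (fun e => R.measurableSet_winner_eq n e) (R.measurable_stepOf n)

lemma measurable_run : Measurable fun p => R.run p n := by
  induction n with
  | zero => exact measurable_id
  | succ n ih => exact (R.measurable_step n).comp ih

end Measurability

section Law

lemma expField_winsAt (h : H) (he : e ∈ R.runners n h) :
    expField (E × ℕ) {σ | R.WinsAt n (h, σ) e} =
      ENNReal.ofReal (R.speed n h e / R.totalSpeed n h) := by
  have hwins := lintegral_wins (R.speed_pos n h) (R.speed_eq_zero n h) he (f := fun _ _ => 1)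
    measurable_const
  have hduration := lintegral_Ioi_const_mul_exp (s := 0) (R.speed_nonneg n h e)
    (R.totalSpeed_pos n h)
  rw [setLIntegral_one] at hwins
  simp only [lintegral_one, measure_univ, mul_one] at hwins
  rw [mul_zero, Real.exp_zero, mul_one] at hduration
  exact hwins.trans hduration

lemma ae_expField_exists_winsAt (h : H) : ∀ᵐ σ ∂expField (E × ℕ), ∃ e, R.WinsAt n (h, σ) e := by
  have hset : {σ | ∃ e, R.WinsAt n (h, σ) e} =
      ⋃ e ∈ R.runners n h, {σ | R.WinsAt n (h, σ) e} := by
    ext σ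
    simp only [Set.mem_ofPred_eq, Set.mem_iUnion, exists_prop]
    exact exists_congr fun e => ⟨fun hw => ⟨hw.1, hw⟩, fun hw => hw.2⟩
  have hmeas : ∀ e ∈ R.runners n h, MeasurableSet {σ | R.WinsAt n (h, σ) e} :=
    fun e _ => measurableSet_wins (F := R.runners n h) (c := R.speed n h)
  have hdisj : Set.PairwiseDisjoint (R.runners n h : Set E) fun e => {σ | R.WinsAt n (h, σ) e} :=
    fun _ _ _ _ hne => (R.pairwise_disjoint_winsAt n hne).preimage (Prod.mk h)
  have hone : expField (E × ℕ) {σ | ∃ e, R.WinsAt n (h, σ) e} = 1 := by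
    rw [hset, measure_biUnion_finset hdisj hmeas,
      Finset.sum_congr rfl fun e he => R.expField_winsAt n e h he, ← ENNReal.ofReal_sum_of_nonneg
        fun e _ => div_nonneg (R.speed_nonneg n h e) (R.totalSpeed_pos n h).le,
      ← Finset.sum_div, ← totalSpeed, div_self (R.totalSpeed_pos n h).ne', ENNReal.ofReal_one]
  refine (mem_ae_iff_prob_eq_one ?_).2 hone
  rw [hset]
  exact Finset.measurableSet_biUnion _ hmeas

variable [Countable E] (ν : Measure H)

lemma lintegral_winsAt {g : H → ℝ → (E × ℕ → ℝ) → ℝ≥0∞}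
    (hg : Measurable fun q : H × ℝ × (E × ℕ → ℝ) => g q.1 q.2.1 q.2.2) :
    ∫⁻ p in {p | R.WinsAt n p e}, g p.1 (R.duration n p e) (remaining (R.speed n p.1) p.2 e)
        ∂ν.prod (expField (E × ℕ)) =
      ∫⁻ h, (∫⁻ s in Set.Ioi (0 : ℝ),
        ENNReal.ofReal (R.speed n h e * Real.exp (-R.totalSpeed n h * s)) *
          ∫⁻ σ, g h s σ ∂expField (E × ℕ)) ∂ν := by
  have hmeas : Measurable fun p : H × (E × ℕ → ℝ) =>
      g p.1 (R.duration n p e) (remaining (R.speed n p.1) p.2 e) :=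
    hg.comp (measurable_fst.prodMk ((R.measurable_duration n e).prodMk
      (measurable_snd.comp (R.measurable_stepOf n e))))
  rw [← lintegral_indicator (R.measurableSet_winsAt n e), lintegral_prod _
    (hmeas.indicator (R.measurableSet_winsAt n e)).aemeasurable]
  refine lintegral_congr fun h => ?_
  by_cases he : e ∈ R.runners n h
  · rw [totalSpeed, ← lintegral_wins (R.speed_pos n h) (R.speed_eq_zero n h) he (f := g h)
      (hg.comp (measurable_const.prodMk measurable_id)), ← lintegral_indicator measurableSet_wins]
    rfl
  · have hloses (σ : E × ℕ → ℝ) : ¬ R.WinsAt n (h, σ) e := fun hw => he hw.1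
    simp [hloses, R.speed_eq_zero n h e he]

lemma ae_exists_winsAt : ∀ᵐ p ∂ν.prod (expField (E × ℕ)), ∃ e, R.WinsAt n p e :=
  (Measure.ae_prod_iff_ae_ae (R.measurableSet_exists_winsAt n)).2
    (Filter.Eventually.of_forall (R.ae_expField_exists_winsAt n))

variable [Nonempty E]

lemma lintegral_step {g : H × (E × ℕ → ℝ) → ℝ≥0∞} (hg : Measurable g) :
    ∫⁻ p, g (R.step n p) ∂ν.prod (expField (E × ℕ)) =
      ∑' e, ∫⁻ h, (∫⁻ s in Set.Ioi (0 : ℝ),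
        ENNReal.ofReal (R.speed n h e * Real.exp (-R.totalSpeed n h * s)) *
          ∫⁻ σ, g (R.next n h e s, σ) ∂expField (E × ℕ)) ∂ν := by
  have hcover : ∀ᵐ p ∂ν.prod (expField (E × ℕ)), p ∈ ⋃ e, {p | R.WinsAt n p e} := by
    filter_upwards [R.ae_exists_winsAt n ν] with p hp
    simpa using hp
  have hnext (e : E) : Measurable fun q : H × ℝ × (E × ℕ → ℝ) => g (R.next n q.1 e q.2.1, q.2.2) :=
    hg.comp (.prodMk ((R.measurable_next n e).comp
      (measurable_fst.prodMk (measurable_fst.comp measurable_snd)))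
      (measurable_snd.comp measurable_snd))
  rw [← Measure.restrict_eq_self_of_ae_mem hcover,
    lintegral_iUnion (fun e => R.measurableSet_winsAt n e) (R.pairwise_disjoint_winsAt n)]
  refine tsum_congr fun e => ?_
  rw [← R.lintegral_winsAt n e ν (g := fun h s σ => g (R.next n h e s, σ)) (hnext e)]
  refine setLIntegral_congr_fun (R.measurableSet_winsAt n e) fun p hp => ?_
  simp only [step, WinsAt.winner_eq hp, stepOf]

lemma map_step :
    (ν.prod (expField (E × ℕ))).map (R.step n) =
      ((ν.prod (expField (E × ℕ))).map fun p => (R.step n p).1).prod (expField (E × ℕ)) := by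
  refine Measure.ext_of_lintegral _ fun g hg => ?_
  have hint : Measurable fun h => ∫⁻ σ, g (h, σ) ∂expField (E × ℕ) := hg.lintegral_prod_right'
  rw [lintegral_map hg (R.measurable_step n), lintegral_prod _ hg.aemeasurable,
    lintegral_map hint (R.measurable_step n).fst, R.lintegral_step n ν hg,
    R.lintegral_step n ν (g := fun q => ∫⁻ σ, g (q.1, σ) ∂expField (E × ℕ))
      (hint.comp measurable_fst)]
  simp

lemma map_run :
    (ν.prod (expField (E × ℕ))).map (fun p => R.run p n) =
      ((ν.prod (expField (E × ℕ))).map fun p => (R.run p n).1).prod (expField (E × ℕ)) := by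
  induction n with
  | zero =>
    change Measure.map id _ = (Measure.map Prod.fst _).prod _
    rw [Measure.map_id, Measure.map_fst_prod, measure_univ, one_smul]
  | succ n ih =>
    change Measure.map (R.step n ∘ fun p => R.run p n) _ =
      (Measure.map ((fun p => (R.step n p).1) ∘ fun p => R.run p n) _).prod _
    rw [← Measure.map_map (R.measurable_step n) (R.measurable_run n),
      ← Measure.map_map (R.measurable_step n).fst (R.measurable_run n), ih, R.map_step]

lemma ae_run_winsAt_and_pos : ∀ᵐ p ∂ν.prod (expField (E × ℕ)), ∀ n,
    (∃ e, R.WinsAt n (R.run p n) e) ∧ ∀ k, 0 < (R.run p n).2 k := by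
  refine ae_all_iff.2 fun n => ?_
  refine ae_of_ae_map (f := fun p => R.run p n)
    (p := fun q => (∃ e, R.WinsAt n q e) ∧ ∀ k, 0 < q.2 k) (R.measurable_run n).aemeasurable ?_
  rw [R.map_run n ν]
  exact (R.ae_exists_winsAt n _).and (Measure.quasiMeasurePreserving_snd.ae ae_expField_pos)

lemma measure_run_winsAt {s : ℝ} (hs : 0 ≤ s) {A : Set H} (hA : MeasurableSet A) :
    ν.prod (expField (E × ℕ)) {p | (R.run p n).1 ∈ A ∧ R.WinsAt n (R.run p n) e ∧
        s < R.duration n (R.run p n) e} =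
      ∫⁻ h in A, ENNReal.ofReal (R.speed n h e / R.totalSpeed n h *
        Real.exp (-R.totalSpeed n h * s))
          ∂(ν.prod (expField (E × ℕ))).map fun p => (R.run p n).1 := by
  have hlong : MeasurableSet {q : H × (E × ℕ → ℝ) | q.1 ∈ A ∧ s < R.duration n q e} :=
    (measurable_fst hA).inter (measurableSet_lt measurable_const (R.measurable_duration n e))
  have hpreimage : {p | (R.run p n).1 ∈ A ∧ R.WinsAt n (R.run p n) e ∧
      s < R.duration n (R.run p n) e} = (fun p => R.run p n) ⁻¹'
        ({q | q.1 ∈ A ∧ s < R.duration n q e} ∩ {q | R.WinsAt n q e}) := by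
    ext p
    simp only [Set.mem_ofPred_eq, Set.mem_preimage, Set.mem_inter_iff]
    tauto
  rw [hpreimage, ← Measure.map_apply (R.measurable_run n)
    (hlong.inter (R.measurableSet_winsAt n e)), R.map_run n ν,
    ← Measure.restrict_apply hlong, ← lintegral_indicator_one hlong, ← lintegral_indicator hA]
  refine Eq.trans (lintegral_congr fun q => ?_) ((R.lintegral_winsAt n e _
    (g := fun h x _ => A.indicator 1 h * (Set.Ioi s).indicator 1 x)
    (((measurable_one.indicator hA).comp measurable_fst).mul
      ((measurable_one.indicator measurableSet_Ioi).comp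
        (measurable_fst.comp measurable_snd)))).trans (lintegral_congr fun h => ?_))
  · by_cases hq : q.1 ∈ A <;> by_cases hqs : s < R.duration n q e <;> simp [hq, hqs]
  · by_cases hh : h ∈ A
    · simp only [hh, Set.indicator_of_mem, Pi.one_apply, one_mul, lintegral_const, measure_univ,
        mul_one]
      rw [← lintegral_Ioi_const_mul_exp (R.speed_nonneg n h e) (R.totalSpeed_pos n h),
        ← lintegral_indicator measurableSet_Ioi, ← lintegral_indicator measurableSet_Ioi]
      refine lintegral_congr fun x => ?_
      by_cases hx : s < x
      · simp [hx, hs.trans_lt hx]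
      · simp [hx]
    · simp [hh]

lemma expField_run_winsAt (h : H) {s : ℝ} (hs : 0 ≤ s) {A : Set H} (hA : MeasurableSet A) :
    expField (E × ℕ) {σ | (R.run (h, σ) n).1 ∈ A ∧ R.WinsAt n (R.run (h, σ) n) e ∧
        s < R.duration n (R.run (h, σ) n) e} =
      ∫⁻ h' in A, ENNReal.ofReal (R.speed n h' e / R.totalSpeed n h' *
        Real.exp (-R.totalSpeed n h' * s)) ∂(expField (E × ℕ)).map fun σ => (R.run (h, σ) n).1 := by
  have hrun := R.measurable_run n
  have hevent : MeasurableSet {p | (R.run p n).1 ∈ A ∧ R.WinsAt n (R.run p n) e ∧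
      s < R.duration n (R.run p n) e} :=
    (hrun.fst hA).inter ((hrun (R.measurableSet_winsAt n e)).inter
      (measurableSet_lt measurable_const ((R.measurable_duration n e).comp hrun)))
  have hdirac := R.measure_run_winsAt n e (Measure.dirac h) hs hA
  rwa [Measure.dirac_prod, Measure.map_map hrun.fst measurable_prodMk_left,
    Measure.map_apply measurable_prodMk_left hevent] at hdirac

end Law

end RaceScheme

/-! ### Kendall's theorem -/

lemma lintegral_add_left_expMeasure_one (w : ℝ) {f : ℝ → ℝ≥0∞} (hf : Measurable f) :
    ∫⁻ s, f (w + s) ∂expMeasure 1 =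
      ∫⁻ v in Set.Ioi w, ENNReal.ofReal (Real.exp (w - v)) * f v := by
  rw [lintegral_expMeasure (by fun_prop), ← lintegral_indicator measurableSet_Ioi,
    ← lintegral_indicator measurableSet_Ioi,
    ← lintegral_add_left_eq_self ((Set.Ioi w).indicator _) w]
  exact lintegral_congr fun s => by by_cases hs : 0 < s <;> simp [hs]

lemma lintegral_Ioi_lintegral_Ioi_swap (c : ℝ) {K : ℝ → ℝ → ℝ≥0∞}
    (hK : Measurable (Function.uncurry K)) :
    ∫⁻ w in Set.Ioi c, ∫⁻ v in Set.Ioi w, K w v =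
      ∫⁻ v in Set.Ioi c, ∫⁻ w in Set.Ioo c v, K w v := by
  have hT : MeasurableSet {p : ℝ × ℝ | c < p.1 ∧ p.1 < p.2} := by measurability
  have hleft : ∀ w, (Set.Ioi c).indicator (fun w => ∫⁻ v in Set.Ioi w, K w v) w =
      ∫⁻ v, {p : ℝ × ℝ | c < p.1 ∧ p.1 < p.2}.indicator (Function.uncurry K) (w, v) := fun w => by
    by_cases hw : c < w
    · simp [hw, ← lintegral_indicator measurableSet_Ioi, Set.indicator_apply]
    · simp [hw]
  have hright : ∀ v, ∫⁻ w, {p : ℝ × ℝ | c < p.1 ∧ p.1 < p.2}.indicator (Function.uncurry K) (w, v) =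
      (Set.Ioi c).indicator (fun v => ∫⁻ w in Set.Ioo c v, K w v) v := fun v => by
    by_cases hv : c < v
    · simp [hv, ← lintegral_indicator measurableSet_Ioo, Set.indicator_apply]
    · have h : ∀ w, ¬ (c < w ∧ w < v) := fun w hw => hv (hw.1.trans hw.2)
      simp [hv, h]
  rw [← lintegral_indicator measurableSet_Ioi, ← lintegral_indicator measurableSet_Ioi,
    lintegral_congr hleft,
    lintegral_lintegral_swap (f := fun w v =>
      {p : ℝ × ℝ | c < p.1 ∧ p.1 < p.2}.indicator (Function.uncurry K) (w, v))
      (hK.indicator hT).aemeasurable,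
    lintegral_congr hright]

lemma image_mul_exp_neg_div_Ioi {a v : ℝ} (ha : 0 < a) (hv : 0 < v) :
    (fun u => v * Real.exp (-u / a)) '' Set.Ioi 0 = Set.Ioo 0 v := by
  ext w
  constructor
  · rintro ⟨u, hu, rfl⟩
    refine ⟨by positivity, mul_lt_of_lt_one_right hv ?_⟩
    exact Real.exp_lt_one_iff.2 (div_neg_of_neg_of_pos (neg_lt_zero.2 hu) ha)
  · rintro ⟨h0, hwv⟩
    refine ⟨a * Real.log (v / w), mul_pos ha (Real.log_pos ((one_lt_div h0).2 hwv)), ?_⟩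
    have hlog : -(a * Real.log (v / w)) / a = Real.log (w / v) := by
      rw [← inv_div v w, Real.log_inv]
      field_simp
    simp only [hlog, Real.exp_log (div_pos h0 hv)]
    field_simp

lemma lintegral_Ioo_rpow_mul_log_div {a v : ℝ} (ha : 0 < a) (hv : 0 < v) {h : ℝ → ℝ≥0∞}
    (hh : Measurable h) :
    ∫⁻ w in Set.Ioo 0 v, ENNReal.ofReal (w ^ (a - 1)) * h (a * Real.log (v / w)) =
      ENNReal.ofReal (v ^ a / a) * ∫⁻ u, h u ∂expMeasure 1 := by
  have hder : ∀ u ∈ Set.Ioi (0 : ℝ), HasDerivWithinAt (fun u => v * Real.exp (-u / a))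
      (v * (Real.exp (-u / a) * (-1 / a))) (Set.Ioi 0) u := fun u _ =>
    ((((hasDerivAt_id u).neg.div_const a).exp).const_mul v).hasDerivWithinAt
  have hinj : Set.InjOn (fun u => v * Real.exp (-u / a)) (Set.Ioi 0) := fun x _ y _ hxy => by
    have := Real.exp_injective (mul_left_cancel₀ hv.ne' hxy)
    field_simp at this
    linarith
  rw [lintegral_expMeasure hh, ← lintegral_const_mul _ (by fun_prop),
    ← image_mul_exp_neg_div_Ioi ha hv,
    lintegral_image_eq_lintegral_abs_deriv_mul measurableSet_Ioi hder hinj]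
  refine setLIntegral_congr_fun measurableSet_Ioi fun u _ => ?_
  have hlog : a * Real.log (v / (v * Real.exp (-u / a))) = u := by
    rw [div_mul_cancel_left₀ hv.ne', Real.log_inv, Real.log_exp]
    field_simp
  have hexp : Real.exp (-u) = Real.exp (-u / a) * Real.exp (-u / a * (a - 1)) := by
    rw [← Real.exp_add]
    congr 1
    field_simp
    ring
  have habs : |v * (Real.exp (-u / a) * (-1 / a))| = v * Real.exp (-u / a) / a := by
    rw [← abs_of_pos (show 0 < v * Real.exp (-u / a) / a by positivity), ← abs_neg]
    congr 1
    ring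
  simp only [hlog, habs, one_mul]
  rw [← mul_assoc, ← mul_assoc, ← ENNReal.ofReal_mul (by positivity),
    ← ENNReal.ofReal_mul (by positivity)]
  congr 2
  rw [Real.mul_rpow hv.le (Real.exp_nonneg _), ← Real.exp_mul, Real.rpow_sub_one hv.ne', hexp]
  field_simp

lemma lintegral_Ioo_rpow_mul_exp_mul_log_div {a v : ℝ} (ha : 0 < a) (hv : 0 < v) {h : ℝ → ℝ≥0∞}
    (hh : Measurable h) :
    ∫⁻ w in Set.Ioo 0 v, ENNReal.ofReal (w ^ (a - 1) * Real.exp (-v) / Real.Gamma a) *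
        h (a * Real.log (v / w)) =
      ENNReal.ofReal (v ^ a * Real.exp (-v) / Real.Gamma (a + 1)) * ∫⁻ u, h u ∂expMeasure 1 := by
  have hfactor : ∀ w : ℝ, ENNReal.ofReal (w ^ (a - 1) * Real.exp (-v) / Real.Gamma a) *
      h (a * Real.log (v / w)) = ENNReal.ofReal (Real.exp (-v) / Real.Gamma a) *
        (ENNReal.ofReal (w ^ (a - 1)) * h (a * Real.log (v / w))) := fun w => by
    rw [mul_div_assoc, ENNReal.ofReal_mul' (by positivity)]
    ring
  rw [lintegral_congr hfactor, lintegral_const_mul' _ _ ENNReal.ofReal_ne_top,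
    lintegral_Ioo_rpow_mul_log_div ha hv hh, ← mul_assoc, ← ENNReal.ofReal_mul (by positivity),
    Real.Gamma_add_one ha.ne']
  congr 2
  field_simp

lemma lintegral_gammaMeasure_lintegral_expMeasure {a : ℝ} (ha : 0 < a) {f : ℝ → ℝ → ℝ≥0∞}
    (hf : Measurable (Function.uncurry f)) :
    ∫⁻ w, ∫⁻ s, f (a * Real.log ((w + s) / w)) (w + s) ∂expMeasure 1 ∂gammaMeasure a 1 =
      ∫⁻ v, ∫⁻ u, f u v ∂expMeasure 1 ∂gammaMeasure (a + 1) 1 := by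
  have hfw : ∀ w, Measurable fun v => f (a * Real.log (v / w)) v := fun w =>
    hf.comp (f := fun v : ℝ => (a * Real.log (v / w), v)) (by fun_prop)
  have hinner : Measurable fun w =>
      ∫⁻ s, f (a * Real.log ((w + s) / w)) (w + s) ∂expMeasure 1 :=
    (hf.comp (f := fun p : ℝ × ℝ => (a * Real.log ((p.1 + p.2) / p.1), p.1 + p.2))
      (by fun_prop)).lintegral_prod_right'
  have hK : Measurable (Function.uncurry fun w v => ENNReal.ofReal
      (w ^ (a - 1) * Real.exp (-v) / Real.Gamma a) * f (a * Real.log (v / w)) v) :=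
    .mul (by fun_prop)
      (hf.comp (f := fun p : ℝ × ℝ => (a * Real.log (p.2 / p.1), p.2)) (by fun_prop))
  have hmarginal : Measurable fun v => ∫⁻ u, f u v ∂expMeasure 1 := hf.lintegral_prod_left'
  calc _ = ∫⁻ w in Set.Ioi 0, ∫⁻ v in Set.Ioi w, ENNReal.ofReal
          (w ^ (a - 1) * Real.exp (-v) / Real.Gamma a) * f (a * Real.log (v / w)) v := by
        rw [lintegral_gammaMeasure hinner]
        refine setLIntegral_congr_fun measurableSet_Ioi fun w (hw : 0 < w) => ?_
        rw [lintegral_add_left_expMeasure_one w (hfw w), ← lintegral_const_mul' _ _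
          ENNReal.ofReal_ne_top]
        refine lintegral_congr fun v => ?_
        rw [← mul_assoc, ← ENNReal.ofReal_mul (by positivity), mul_assoc, ← Real.exp_add]
        congr 2
        ring_nf
        simp
    _ = ∫⁻ v in Set.Ioi 0, ∫⁻ w in Set.Ioo 0 v, ENNReal.ofReal
          (w ^ (a - 1) * Real.exp (-v) / Real.Gamma a) * f (a * Real.log (v / w)) v :=
        lintegral_Ioi_lintegral_Ioi_swap 0 hK
    _ = _ := by
        rw [lintegral_gammaMeasure hmarginal]
        refine setLIntegral_congr_fun measurableSet_Ioi fun v (hv : 0 < v) => ?_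
        have hfv : Measurable fun u => f u v := hf.comp measurable_prodMk_right
        rw [lintegral_Ioo_rpow_mul_exp_mul_log_div ha hv hfv, add_sub_cancel_right, Real.one_rpow,
          one_mul, one_div_mul_eq_div, div_mul_eq_mul_div]

lemma map_log_ratio_gammaMeasure_prod_expMeasure {a : ℝ} (ha : 0 < a) :
    ((gammaMeasure a 1).prod (expMeasure 1)).map
      (fun p => (a * Real.log ((p.1 + p.2) / p.1), p.1 + p.2)) =
      (expMeasure 1).prod (gammaMeasure (a + 1) 1) := by
  have := isProbabilityMeasure_gammaMeasure ha one_pos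
  have := isProbabilityMeasure_gammaMeasure (a := a + 1) (by linarith) one_pos
  have hm : Measurable fun p : ℝ × ℝ => (a * Real.log ((p.1 + p.2) / p.1), p.1 + p.2) := by
    fun_prop
  refine Measure.ext_of_lintegral _ fun f hf => ?_
  have hfm : Measurable fun p : ℝ × ℝ =>
      f (a * Real.log ((p.1 + p.2) / p.1), p.1 + p.2) := hf.comp hm
  rw [lintegral_map hf hm, lintegral_prod _ hfm.aemeasurable,
    lintegral_prod_symm _ hf.aemeasurable]
  exact lintegral_gammaMeasure_lintegral_expMeasure ha (f := fun u v => f (u, v)) hf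

/-- The normalized increments `(a + k) log (Wₖ₊₁ / Wₖ)` of the process
`Wₖ = w + σ 0 + ⋯ + σ (k - 1)`. If `W` lists the arrival times of a Poisson process after time `w`,
these are the increments which the pure birth process obtained by a logarithmic time change has at
its successive jumps, multiplied by the jump rates `a + k`. -/
def logIncrement (a w : ℝ) (σ : ℕ → ℝ) (k : ℕ) : ℝ :=
  (a + k) * Real.log ((w + ∑ l ∈ Finset.range (k + 1), σ l) / (w + ∑ l ∈ Finset.range k, σ l))

lemma measurable_logIncrement (a : ℝ) :
    Measurable fun p : ℝ × (ℕ → ℝ) => logIncrement a p.1 p.2 := by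
  unfold logIncrement
  fun_prop

/-- The sequence `y, σ 0, σ 1, …`. -/
def consSeq (y : ℝ) (σ : ℕ → ℝ) : ℕ → ℝ
  | 0 => y
  | k + 1 => σ k

lemma measurable_consSeq : Measurable fun p : ℝ × (ℕ → ℝ) => consSeq p.1 p.2 :=
  measurable_pi_lambda _ fun k => by cases k <;> simp only [consSeq] <;> fun_prop

lemma map_consSeq_expField :
    ((expMeasure 1).prod (expField ℕ)).map (fun p => consSeq p.1 p.2) = expField ℕ := by
  let g : ℕ → Option ℕ := fun k => k.casesOn none some
  have hg : g.Injective := fun i j h => by cases i <;> cases j <;> simp_all [g]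
  have hcons : (fun p : ℝ × (ℕ → ℝ) => consSeq p.1 p.2) = fun p k => (g k).elim p.1 p.2 := by
    funext p k
    cases k <;> rfl
  rw [hcons, map_optionElim_expField hg]

lemma logIncrement_consSeq (a w y : ℝ) (σ : ℕ → ℝ) :
    logIncrement a w (consSeq y σ) =
      consSeq (a * Real.log ((w + y) / w)) (logIncrement (a + 1) (w + y) σ) := by
  have hsum : ∀ n, w + ∑ l ∈ Finset.range (n + 1), consSeq y σ l =
      w + y + ∑ l ∈ Finset.range n, σ l := fun n => by
    rw [Finset.sum_range_succ', add_comm (∑ l ∈ _, _), ← add_assoc]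
    rfl
  funext k
  cases k with
  | zero => simp [logIncrement, consSeq]
  | succ k =>
    rw [logIncrement, hsum, hsum, consSeq, logIncrement]
    push_cast
    ring_nf

lemma map_logIncrement_eq_map_consSeq {a : ℝ} (ha : 0 < a) :
    ((gammaMeasure a 1).prod (expField ℕ)).map (fun p => logIncrement a p.1 p.2) =
      ((expMeasure 1).prod (((gammaMeasure (a + 1) 1).prod (expField ℕ)).map
        fun p => logIncrement (a + 1) p.1 p.2)).map fun p => consSeq p.1 p.2 := by
  have := isProbabilityMeasure_gammaMeasure ha one_pos
  have := isProbabilityMeasure_gammaMeasure (a := a + 1) (by linarith) one_pos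
  let T : ℝ × ℝ → ℝ × ℝ := fun p => (a * Real.log ((p.1 + p.2) / p.1), p.1 + p.2)
  let L : ℝ → ℝ × (ℕ → ℝ) → ℕ → ℝ := fun b p => logIncrement b p.1 p.2
  let C : ℝ × (ℕ → ℝ) → ℕ → ℝ := fun p => consSeq p.1 p.2
  have hT : Measurable T := by fun_prop
  have hL : ∀ b, Measurable (L b) := measurable_logIncrement
  have hC : Measurable C := measurable_consSeq
  have hassoc : Measurable (MeasurableEquiv.prodAssoc : (ℝ × ℝ) × (ℕ → ℝ) ≃ᵐ ℝ × ℝ × (ℕ → ℝ)) :=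
    MeasurableEquiv.measurable _
  have hfactor : L a ∘ Prod.map id C ∘ MeasurableEquiv.prodAssoc =
      C ∘ Prod.map id (L (a + 1)) ∘ MeasurableEquiv.prodAssoc ∘ Prod.map T id :=
    funext fun p => logIncrement_consSeq a p.1.1 p.1.2 p.2
  calc ((gammaMeasure a 1).prod (expField ℕ)).map (L a)
    _ = (((gammaMeasure a 1).prod (expMeasure 1)).prod (expField ℕ)).map
          (L a ∘ Prod.map id C ∘ MeasurableEquiv.prodAssoc) := by
        rw [← Measure.map_map (hL a) (by fun_prop), ← Measure.map_map (by fun_prop) hassoc,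
          (measurePreserving_prodAssoc _ _ _).map_eq,
          ← Measure.map_prod_map _ _ measurable_id hC, Measure.map_id, map_consSeq_expField]
    _ = (((expMeasure 1).prod (gammaMeasure (a + 1) 1)).prod (expField ℕ)).map
          (C ∘ Prod.map id (L (a + 1)) ∘ MeasurableEquiv.prodAssoc) := by
        rw [hfactor, ← map_log_ratio_gammaMeasure_prod_expMeasure ha]
        conv_rhs => rw [← Measure.map_id (μ := expField ℕ)]
        rw [Measure.map_prod_map _ _ hT measurable_id, Measure.map_map (by fun_prop) (by fun_prop)]
        rfl
    _ = _ := by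
        rw [← Measure.map_map hC (by fun_prop), ← Measure.map_map (by fun_prop) hassoc,
          (measurePreserving_prodAssoc _ _ _).map_eq,
          ← Measure.map_prod_map _ _ measurable_id (hL (a + 1)), Measure.map_id]

lemma map_logIncrement_forall_mem (n : ℕ) {a : ℝ} (ha : 0 < a) {t : ℕ → Set ℝ}
    (ht : ∀ k, MeasurableSet (t k)) :
    ((gammaMeasure a 1).prod (expField ℕ)).map (fun p => logIncrement a p.1 p.2)
      {x | ∀ k < n, x k ∈ t k} = ∏ k ∈ Finset.range n, expMeasure 1 (t k) := by
  induction n generalizing a t with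
  | zero =>
    have := isProbabilityMeasure_gammaMeasure ha one_pos
    have := Measure.isProbabilityMeasure_map (μ := (gammaMeasure a 1).prod (expField ℕ))
      (measurable_logIncrement a).aemeasurable
    simp
  | succ n ih =>
    have hbox : MeasurableSet {x : ℕ → ℝ | ∀ k < n + 1, x k ∈ t k} := by
      simp only [Set.ofPred_forall]
      exact .iInter fun k => .iInter fun _ => measurable_pi_apply k (ht k)
    have hpre : (fun p : ℝ × (ℕ → ℝ) => consSeq p.1 p.2) ⁻¹' {x | ∀ k < n + 1, x k ∈ t k} =
        t 0 ×ˢ {x | ∀ k < n, x k ∈ t (k + 1)} := by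
      ext p
      simp only [Set.mem_preimage, Set.mem_ofPred_eq, Nat.forall_lt_succ_left', consSeq,
        Set.mem_prod]
    have := isProbabilityMeasure_gammaMeasure (a := a + 1) (by linarith) one_pos
    rw [map_logIncrement_eq_map_consSeq ha, Measure.map_apply measurable_consSeq hbox, hpre,
      Measure.prod_prod, ih (by linarith) fun k => ht (k + 1), Finset.prod_range_succ', mul_comm]

lemma map_logIncrement {a : ℝ} (ha : 0 < a) :
    ((gammaMeasure a 1).prod (expField ℕ)).map (fun p => logIncrement a p.1 p.2) = expField ℕ := by
  classical
  refine Measure.eq_infinitePi _ fun s t ht => ?_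
  obtain ⟨n, hn⟩ := s.exists_nat_subset_range
  have hbox : (s : Set ℕ).pi t = {x | ∀ k < n, x k ∈ if k ∈ s then t k else Set.univ} := by
    ext x
    refine ⟨fun h k _ => ?_, fun h k hk => ?_⟩
    · split_ifs with hk
      exacts [h k hk, trivial]
    · simpa [Finset.mem_coe.1 hk] using h k (Finset.mem_range.1 (hn hk))
  rw [hbox, map_logIncrement_forall_mem n ha fun k => by split_ifs; exacts [ht k, .univ],
    ← Finset.prod_subset hn fun k _ hk => by rw [if_neg hk, measure_univ]]
  exact Finset.prod_congr rfl fun k hk => by rw [if_pos hk]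

lemma map_prodMk_prod_infinitePi {ι : Type*} {X Y : ι → Type*} [∀ i, MeasurableSpace (X i)]
    [∀ i, MeasurableSpace (Y i)] (μ : ∀ i, Measure (X i)) (ν : ∀ i, Measure (Y i))
    [∀ i, IsProbabilityMeasure (μ i)] [∀ i, IsProbabilityMeasure (ν i)] :
    ((Measure.infinitePi μ).prod (Measure.infinitePi ν)).map (fun p i => (p.1 i, p.2 i)) =
      Measure.infinitePi fun i => (μ i).prod (ν i) := by
  refine Measure.eq_infinitePi _ fun s t ht => ?_
  have hm : Measurable fun (p : (∀ i, X i) × (∀ i, Y i)) i => (p.1 i, p.2 i) := by fun_prop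
  have hbox : MeasurableSet ((s : Set ι).pi t) := .pi s.countable_toSet fun i _ => ht i
  have hsection : ∀ x, Measure.infinitePi ν (Prod.mk x ⁻¹'
      ((fun (p : (∀ i, X i) × (∀ i, Y i)) i => (p.1 i, p.2 i)) ⁻¹' (s : Set ι).pi t)) =
      ∏ i ∈ s, ν i (Prod.mk (x i) ⁻¹' t i) := fun x => by
    rw [← Measure.infinitePi_pi ν fun i _ => measurable_prodMk_left (ht i)]
    rfl
  have hmt : ∀ i, Measurable fun x => ν i (Prod.mk x ⁻¹' t i) := fun i =>
    measurable_measure_prodMk_left (ht i)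
  rw [Measure.map_apply hm hbox, Measure.prod_apply (hm hbox), lintegral_congr hsection,
    lintegral_prod_eq_prod_lintegral_of_indepFun s
      (fun i (x : ∀ i, X i) => ν i (Prod.mk (x i) ⁻¹' t i)) (iIndepFun_infinitePi hmt)
      fun i => (hmt i).comp (measurable_pi_apply i)]
  refine Finset.prod_congr rfl fun i _ => ?_
  rw [Measure.prod_apply (ht i), ← Measure.infinitePi_map_eval μ i,
    lintegral_map (hmt i) (measurable_pi_apply i)]

lemma lintegral_ofReal_expMeasure_one : ∫⁻ x, ENNReal.ofReal x ∂expMeasure 1 = 1 := by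
  have := isProbabilityMeasure_gammaMeasure (a := 2) two_pos one_pos
  rw [lintegral_expMeasure (by fun_prop), ← measure_univ (μ := gammaMeasure 2 1), ← lintegral_one,
    lintegral_gammaMeasure measurable_const]
  refine setLIntegral_congr_fun measurableSet_Ioi fun x _ => ?_
  have h21 : (2 : ℝ) - 1 = 1 := by norm_num
  simp only [h21, Real.Gamma_two, Real.rpow_one, Real.one_rpow, div_one, one_mul, mul_one]
  rw [← ENNReal.ofReal_mul (Real.exp_nonneg _), mul_comm]

lemma integrable_id_expMeasure_one : Integrable (fun x : ℝ => x) (expMeasure 1) := by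
  refine ⟨by fun_prop, ?_⟩
  rw [hasFiniteIntegral_iff_ofReal (ae_pos_expMeasure.mono fun x hx => hx.le),
    lintegral_ofReal_expMeasure_one]
  exact ENNReal.one_lt_top

lemma integral_id_expMeasure_one : ∫ x, x ∂expMeasure 1 = 1 := by
  rw [integral_eq_lintegral_of_nonneg_ae (ae_pos_expMeasure.mono fun x hx => hx.le)
    (by fun_prop), lintegral_ofReal_expMeasure_one, ENNReal.toReal_one]

lemma ae_tendsto_mean_expField {ι : Type*} {g : ℕ → ι} (hg : g.Injective) :
    ∀ᵐ σ ∂expField ι, Filter.Tendsto (fun n : ℕ => (∑ l ∈ Finset.range n, σ (g l)) / (n : ℝ))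
      Filter.atTop (nhds 1) := by
  have hlaw : ∀ i, MeasurePreserving (fun σ : ι → ℝ => σ i) (expField ι) (expMeasure 1) :=
    measurePreserving_eval_infinitePi _
  have hmean : ∫ σ, σ (g 0) ∂expField ι = 1 := by
    rw [← integral_id_expMeasure_one, ← (hlaw (g 0)).map_eq,
      integral_map (hlaw (g 0)).aemeasurable (by fun_prop)]
  have hind : iIndepFun (fun (i : ι) (σ : ι → ℝ) => σ i) (expField ι) :=
    iIndepFun_infinitePi (X := fun _ x => x) fun _ => measurable_id
  rw [← hmean]
  refine strong_law_ae_real (fun l (σ : ι → ℝ) => σ (g l))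
    ((hlaw (g 0)).integrable_comp_of_integrable integrable_id_expMeasure_one)
    (fun i j hij => hind.indepFun (hg.ne hij)) fun l => ?_
  exact ⟨(hlaw _).aemeasurable, (hlaw _).aemeasurable, by rw [(hlaw _).map_eq, (hlaw _).map_eq]⟩

lemma exp_alarmTime_logIncrement {a w : ℝ} (ha : 0 < a) (hw : 0 < w) {σ : ℕ → ℝ}
    (hσ : ∀ l, 0 < σ l) (k : ℕ) :
    Real.exp (alarmTime a (logIncrement a w σ) k) = (w + ∑ l ∈ Finset.range k, σ l) / w := by
  have hpos : ∀ k, 0 < w + ∑ l ∈ Finset.range k, σ l := fun k =>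
    add_pos_of_pos_of_nonneg hw (Finset.sum_nonneg fun l _ => (hσ l).le)
  induction k with
  | zero => simp [alarmTime, hw.ne']
  | succ k ih =>
    have hk := hpos k
    have hsucc : alarmTime a (logIncrement a w σ) (k + 1) = alarmTime a (logIncrement a w σ) k +
        Real.log ((w + ∑ l ∈ Finset.range (k + 1), σ l) / (w + ∑ l ∈ Finset.range k, σ l)) := by
      rw [alarmTime, Finset.sum_range_succ, alarmTime, logIncrement]
      field_simp
    rw [hsucc, Real.exp_add, ih, Real.exp_log (div_pos (hpos _) hk)]
    field_simp

/-- The limit of `n exp (-Vₙ)`, where the `Vₙ` are the alarm times of an edge with initial weight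
`b`: the random conductance of that edge. The limit is encoded as a `limsup`. -/
def limitWeight (b : ℝ) (τ : ℕ → ℝ) : ℝ :=
  Filter.limsup (fun n : ℕ => n * Real.exp (-alarmTime b τ n)) Filter.atTop

lemma measurable_alarmTime (b : ℝ) (n : ℕ) : Measurable fun τ : ℕ → ℝ => alarmTime b τ n := by
  unfold alarmTime
  fun_prop

lemma measurable_limitWeight (b : ℝ) : Measurable (limitWeight b) :=
  .limsup fun n => (Real.measurable_exp.comp (measurable_alarmTime b n).neg).const_mul _

lemma limitWeight_logIncrement {a w : ℝ} (ha : 0 < a) (hw : 0 < w) {σ : ℕ → ℝ}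
    (hσ : ∀ l, 0 < σ l) (hlim : Filter.Tendsto (fun n : ℕ => (∑ l ∈ Finset.range n, σ l) / (n : ℝ))
      Filter.atTop (nhds 1)) :
    limitWeight a (logIncrement a w σ) = w := by
  have h : Filter.Tendsto (fun n : ℕ => w / (w / n + (∑ l ∈ Finset.range n, σ l) / n))
      Filter.atTop (nhds (w / (0 + 1))) :=
    tendsto_const_nhds.div ((tendsto_const_div_atTop_nhds_zero_nat _).add hlim) (by norm_num)
  rw [zero_add, div_one] at h
  refine Filter.Tendsto.limsup_eq (h.congr' ?_)
  filter_upwards [Filter.eventually_gt_atTop 0] with n hn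
  have : (0 : ℝ) < n := Nat.cast_pos.2 hn
  have hsum : 0 ≤ ∑ l ∈ Finset.range n, σ l := Finset.sum_nonneg fun l _ => (hσ l).le
  rw [Real.exp_neg, exp_alarmTime_logIncrement ha hw hσ, inv_div]
  field_simp

section Edgewise

variable {E : Type*} {a : E → ℝ}

/-- `logIncrement` applied edge by edge, to conductances and waiting times indexed by a set `E` of
edges. -/
def logIncrements (a : E → ℝ) (p : (E → ℝ) × (E × ℕ → ℝ)) (k : E × ℕ) : ℝ :=
  logIncrement (a k.1) (p.1 k.1) (fun l => p.2 (k.1, l)) k.2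

/-- The inverse of `logIncrements`: the conductances, together with the successive waiting times for
the alarms in the time scale in which the alarms form Poisson processes. -/
def poissonClocks (a : E → ℝ) (τ : E × ℕ → ℝ) : (E → ℝ) × (E × ℕ → ℝ) :=
  (fun e => limitWeight (a e) fun l => τ (e, l),
   fun k => limitWeight (a k.1) (fun l => τ (k.1, l)) *
    (Real.exp (alarmTime (a k.1) (fun l => τ (k.1, l)) (k.2 + 1)) -
      Real.exp (alarmTime (a k.1) (fun l => τ (k.1, l)) k.2)))

lemma measurable_logIncrements (a : E → ℝ) : Measurable (logIncrements a) := by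
  refine measurable_pi_lambda _ fun k => ?_
  have hk : Measurable fun p : (E → ℝ) × (E × ℕ → ℝ) => (p.1 k.1, fun l => p.2 (k.1, l)) := by
    fun_prop
  exact (measurable_pi_apply k.2).comp ((measurable_logIncrement (a k.1)).comp hk)

lemma measurable_poissonClocks (a : E → ℝ) : Measurable (poissonClocks a) := by
  have hrow : ∀ e : E, Measurable fun (τ : E × ℕ → ℝ) (l : ℕ) => τ (e, l) := by fun_prop
  have hweight : ∀ e : E, Measurable fun τ : E × ℕ → ℝ => limitWeight (a e) fun l => τ (e, l) :=
    fun e => (measurable_limitWeight (a e)).comp (hrow e)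
  have halarm : ∀ (e : E) n,
      Measurable fun τ : E × ℕ → ℝ => Real.exp (alarmTime (a e) (fun l => τ (e, l)) n) :=
    fun e n => Real.measurable_exp.comp ((measurable_alarmTime (a e) n).comp (hrow e))
  exact (measurable_pi_lambda _ hweight).prodMk
    (measurable_pi_lambda _ fun k => (hweight k.1).mul ((halarm k.1 _).sub (halarm k.1 _)))

lemma isProbabilityMeasure_gammaConductances (ha : ∀ e, 0 < a e) :
    IsProbabilityMeasure (gammaConductances a) := by
  have := fun e => isProbabilityMeasure_gammaMeasure (ha e) one_pos
  unfold gammaConductances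
  infer_instance

lemma map_logIncrements (ha : ∀ e, 0 < a e) :
    ((gammaConductances a).prod (expField (E × ℕ))).map (logIncrements a) = expField (E × ℕ) := by
  have := fun e => isProbabilityMeasure_gammaMeasure (ha e) one_pos
  have := isProbabilityMeasure_gammaConductances ha
  let curry := MeasurableEquiv.curry E ℕ ℝ
  let L : (E → ℝ × (ℕ → ℝ)) → E → ℕ → ℝ := fun x e => logIncrement (a e) (x e).1 (x e).2
  have hL : Measurable L := measurable_pi_lambda _ fun e =>
    (measurable_logIncrement (a e)).comp (measurable_pi_apply e)
  have hcurry : (Measure.infinitePi fun _ : E => expField ℕ).map curry.symm = expField (E × ℕ) :=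
    Measure.infinitePi_map_curry_symm fun _ _ => expMeasure 1
  have hfactor : logIncrements a ∘ Prod.map id curry.symm =
      curry.symm ∘ L ∘ fun (p : (E → ℝ) × (E → ℕ → ℝ)) e => (p.1 e, p.2 e) := rfl
  have hmarginal : Measure.map L
      (Measure.infinitePi fun e => (gammaMeasure (a e) 1).prod (expField ℕ)) =
        Measure.infinitePi fun _ : E => expField ℕ := by
    rw [Measure.infinitePi_map_pi _ fun e => measurable_logIncrement (a e)]
    exact congrArg _ (funext fun e => map_logIncrement (ha e))
  conv_lhs => rw [← hcurry, ← Measure.map_id (μ := gammaConductances a)]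
  rw [Measure.map_prod_map _ _ measurable_id curry.symm.measurable,
    Measure.map_map (measurable_logIncrements a) (by fun_prop), hfactor,
    ← Measure.map_map curry.symm.measurable (by fun_prop), ← Measure.map_map hL (by fun_prop),
    gammaConductances, map_prodMk_prod_infinitePi, hmarginal, hcurry]

lemma poissonClocks_logIncrements (ha : ∀ e, 0 < a e) {p : (E → ℝ) × (E × ℕ → ℝ)}
    (hw : ∀ e, 0 < p.1 e) (hσ : ∀ k, 0 < p.2 k)
    (hlim : ∀ e, Filter.Tendsto (fun n : ℕ => (∑ l ∈ Finset.range n, p.2 (e, l)) / (n : ℝ))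
      Filter.atTop (nhds 1)) :
    poissonClocks a (logIncrements a p) = p := by
  have hrow : ∀ e, (fun l => logIncrements a p (e, l)) =
      logIncrement (a e) (p.1 e) fun l => p.2 (e, l) := fun e => rfl
  have halarm : ∀ e k, Real.exp (alarmTime (a e) (fun l => logIncrements a p (e, l)) k) =
      (p.1 e + ∑ l ∈ Finset.range k, p.2 (e, l)) / p.1 e := fun e k => by
    rw [hrow, exp_alarmTime_logIncrement (ha e) (hw e) fun l => hσ (e, l)]
  have hweight : ∀ e, limitWeight (a e) (fun l => logIncrements a p (e, l)) = p.1 e := fun e => by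
    rw [hrow, limitWeight_logIncrement (ha e) (hw e) (fun l => hσ (e, l)) (hlim e)]
  refine Prod.ext (funext hweight) (funext fun k => ?_)
  have hk := (hw k.1).ne'
  simp only [poissonClocks, halarm, hweight, Finset.sum_range_succ]
  field_simp
  ring

variable [Countable E]

lemma ae_gammaConductances_pos (ha : ∀ e, 0 < a e) :
    ∀ᵐ w ∂gammaConductances a, ∀ e, 0 < w e := by
  have := fun e => isProbabilityMeasure_gammaMeasure (ha e) one_pos
  exact ae_all_iff.2 fun e =>
    (measurePreserving_eval_infinitePi _ e).quasiMeasurePreserving.ae ae_pos_gammaMeasure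

lemma ae_poissonClocks_logIncrements (ha : ∀ e, 0 < a e) :
    ∀ᵐ p ∂(gammaConductances a).prod (expField (E × ℕ)), (∀ e, 0 < p.1 e) ∧ (∀ k, 0 < p.2 k) ∧
      poissonClocks a (logIncrements a p) = p := by
  have := isProbabilityMeasure_gammaConductances ha
  have hmean : ∀ᵐ σ ∂expField (E × ℕ), ∀ e,
      Filter.Tendsto (fun n : ℕ => (∑ l ∈ Finset.range n, σ (e, l)) / (n : ℝ))
        Filter.atTop (nhds 1) :=
    ae_all_iff.2 fun e => ae_tendsto_mean_expField (Prod.mk_right_injective e)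
  filter_upwards [Measure.quasiMeasurePreserving_fst.ae (ae_gammaConductances_pos ha),
    Measure.quasiMeasurePreserving_snd.ae ae_expField_pos,
    Measure.quasiMeasurePreserving_snd.ae hmean] with p hw hσ hlim
  exact ⟨hw, hσ, poissonClocks_logIncrements ha hw hσ hlim⟩

lemma map_poissonClocks (ha : ∀ e, 0 < a e) :
    (expField (E × ℕ)).map (poissonClocks a) = (gammaConductances a).prod (expField (E × ℕ)) := by
  have hinv : poissonClocks a ∘ logIncrements a =ᵐ[(gammaConductances a).prod (expField (E × ℕ))]
      id := (ae_poissonClocks_logIncrements ha).mono fun p hp => hp.2.2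
  rw [← map_logIncrements ha, Measure.map_map (measurable_poissonClocks a)
    (measurable_logIncrements a), map_logIncrements ha, Measure.map_congr hinv, Measure.map_id]

lemma ae_logIncrements_poissonClocks (ha : ∀ e, 0 < a e) :
    ∀ᵐ τ ∂expField (E × ℕ), logIncrements a (poissonClocks a τ) = τ := by
  have hm : MeasurableSet {τ : E × ℕ → ℝ | logIncrements a (poissonClocks a τ) = τ} :=
    measurableSet_eq_fun ((measurable_logIncrements a).comp (measurable_poissonClocks a))
      measurable_id
  rw [← map_logIncrements ha, ae_map_iff (measurable_logIncrements a).aemeasurable hm]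
  filter_upwards [ae_poissonClocks_logIncrements ha] with p hp
  rw [hp.2.2]

end Edgewise

/-! ### Local times and the time change -/

section JointMeasurability

variable {Z α : Type*} [MeasurableSpace Z]

lemma measurable_intervalIntegral_right {f : Z × ℝ → ℝ} (hf : Measurable f) :
    Measurable fun p : Z × ℝ => ∫ u in (0 : ℝ)..p.2, f (p.1, u) := by
  have hset : ∀ B : Set ((Z × ℝ) × ℝ), MeasurableSet B →
      Measurable fun p : Z × ℝ => ∫ u in Prod.mk p ⁻¹' B, f (p.1, u) := by
    intro B hB
    have hind : Measurable (B.indicator fun q => f (q.1.1, q.2)) :=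
      Measurable.indicator (by fun_prop) hB
    convert (hind.stronglyMeasurable.integral_prod_right' (ν := volume)).measurable using 2 with p
    rw [← integral_indicator (measurable_prodMk_left hB)]
    rfl
  have hpos : MeasurableSet {q : (Z × ℝ) × ℝ | 0 < q.2 ∧ q.2 ≤ q.1.2} :=
    (measurableSet_lt measurable_const measurable_snd).inter
      (measurableSet_le measurable_snd (by fun_prop))
  have hneg : MeasurableSet {q : (Z × ℝ) × ℝ | q.1.2 < q.2 ∧ q.2 ≤ 0} :=
    (measurableSet_lt (by fun_prop) measurable_snd).inter
      (measurableSet_le measurable_snd measurable_const)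
  exact (hset _ hpos).sub (hset _ hneg)

/-- The integrand `1 / L_{y_u}(u)` of the additive functional of the path `y`. -/
def inverseLocalTime (y : ℝ → α) (u : ℝ) : ℝ := 1 / (1 + localTime y (y u) u)

lemma localTime_eq_integral_indicator (y : ℝ → α) (x : α) (t : ℝ) :
    localTime y x t = ∫ u in (0 : ℝ)..t, (y ⁻¹' {x}).indicator 1 u := by
  classical
  rfl

variable [MeasurableSpace α] [MeasurableSingletonClass α] {Y : Z → ℝ → α}

lemma measurable_localTime (hY : Measurable fun p : Z × ℝ => Y p.1 p.2) (x : α) :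
    Measurable fun p : Z × ℝ => localTime (Y p.1) x p.2 := by
  simp only [localTime_eq_integral_indicator]
  exact measurable_intervalIntegral_right
    (measurable_one.indicator (hY (measurableSet_singleton x)))

variable [Countable α]

lemma measurable_inverseLocalTime (hY : Measurable fun p : Z × ℝ => Y p.1 p.2) :
    Measurable fun p : Z × ℝ => inverseLocalTime (Y p.1) p.2 :=
  measurable_apply_of_countable (e := fun p : Z × ℝ => Y p.1 p.2)
    (f := fun x p => 1 / (1 + localTime (Y p.1) x p.2))
    (fun x => hY (measurableSet_singleton x))
    fun x => ((measurable_localTime hY x).const_add 1).const_div 1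

lemma measurable_additiveFunctional (hY : Measurable fun p : Z × ℝ => Y p.1 p.2) :
    Measurable fun p : Z × ℝ => additiveFunctional (Y p.1) p.2 :=
  measurable_intervalIntegral_right (measurable_inverseLocalTime hY)

end JointMeasurability

section AdditiveFunctional

variable {α : Type*}

@[simp]
lemma additiveFunctional_zero (y : ℝ → α) : additiveFunctional y 0 = 0 :=
  intervalIntegral.integral_same

variable [MeasurableSpace α] [MeasurableSingletonClass α] {y : ℝ → α}

lemma localTime_mem_Icc (hy : Measurable y) (x : α) {t : ℝ} (ht : 0 ≤ t) :
    localTime y x t ∈ Set.Icc 0 t := by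
  have hx : MeasurableSet (y ⁻¹' {x}) := hy (measurableSet_singleton x)
  rw [localTime_eq_integral_indicator, intervalIntegral.integral_of_le ht,
    integral_indicator_one hx, measureReal_restrict_apply hx]
  refine ⟨measureReal_nonneg, ?_⟩
  calc volume.real (y ⁻¹' {x} ∩ Set.Ioc 0 t) ≤ volume.real (Set.Ioc 0 t) :=
        measureReal_mono Set.inter_subset_right measure_Ioc_lt_top.ne
    _ = t := by simp [ht]

lemma inverseLocalTime_mem_Icc (hy : Measurable y) {u : ℝ} (hu : 0 ≤ u) :
    inverseLocalTime y u ∈ Set.Icc (1 / (1 + u)) 1 := by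
  obtain ⟨hnonneg, hle⟩ := localTime_mem_Icc hy (y u) hu
  refine ⟨one_div_le_one_div_of_le (by linarith) (by linarith), ?_⟩
  rw [inverseLocalTime, div_le_one (by linarith)]
  linarith

variable [Countable α]

lemma intervalIntegrable_inverseLocalTime (hy : Measurable y) {s t : ℝ} (hs : 0 ≤ s)
    (hst : s ≤ t) : IntervalIntegrable (inverseLocalTime y) volume s t := by
  have hmeas : Measurable (inverseLocalTime y) :=
    (measurable_inverseLocalTime (Z := Unit) (Y := fun _ => y) (hy.comp measurable_snd)).comp
      (measurable_prodMk_left (x := ()))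
  refine (intervalIntegrable_const (c := (1 : ℝ))).mono_fun' hmeas.aestronglyMeasurable ?_
  filter_upwards [ae_restrict_mem measurableSet_uIoc] with u hu
  rw [Set.uIoc_of_le hst] at hu
  have hu0 : 0 ≤ u := hs.trans hu.1.le
  have hbounds := inverseLocalTime_mem_Icc hy hu0
  rw [Real.norm_of_nonneg ((by positivity : 0 ≤ 1 / (1 + u)).trans hbounds.1)]
  exact hbounds.2

lemma additiveFunctional_sub (hy : Measurable y) {s t : ℝ} (hs : 0 ≤ s) (hst : s ≤ t) :
    additiveFunctional y t - additiveFunctional y s = ∫ u in s..t, inverseLocalTime y u :=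
  intervalIntegral.integral_interval_sub_left
    (intervalIntegrable_inverseLocalTime hy le_rfl (hs.trans hst))
    (intervalIntegrable_inverseLocalTime hy le_rfl hs)

lemma additiveFunctional_sub_mem_Icc (hy : Measurable y) {s t : ℝ} (hs : 0 ≤ s) (hst : s ≤ t) :
    additiveFunctional y t - additiveFunctional y s ∈ Set.Icc ((t - s) / (1 + t)) (t - s) := by
  have hint := intervalIntegrable_inverseLocalTime hy hs hst
  have hlower : ∀ u ∈ Set.Icc s t, 1 / (1 + t) ≤ inverseLocalTime y u := fun u hu =>
    (one_div_le_one_div_of_le (by linarith [hu.1]) (by linarith [hu.2])).trans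
      (inverseLocalTime_mem_Icc hy (hs.trans hu.1)).1
  have hupper : ∀ u ∈ Set.Icc s t, inverseLocalTime y u ≤ 1 := fun u hu =>
    (inverseLocalTime_mem_Icc hy (hs.trans hu.1)).2
  rw [additiveFunctional_sub hy hs hst]
  constructor
  · simpa [div_eq_mul_inv] using
      intervalIntegral.integral_mono_on hst intervalIntegrable_const hint hlower
  · simpa using intervalIntegral.integral_mono_on hst hint intervalIntegrable_const hupper

lemma strictMonoOn_additiveFunctional (hy : Measurable y) :
    StrictMonoOn (additiveFunctional y) (Set.Ici 0) := by
  intro s hs t _ hst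
  have hs : 0 ≤ s := hs
  have hsub := (additiveFunctional_sub_mem_Icc hy hs hst.le).1
  have hpos : 0 < (t - s) / (1 + t) := div_pos (by linarith) (by linarith)
  linarith

lemma continuousOn_additiveFunctional (hy : Measurable y) :
    ContinuousOn (additiveFunctional y) (Set.Ici 0) := by
  have hlip : LipschitzOnWith 1 (additiveFunctional y) (Set.Ici 0) := by
    refine LipschitzOnWith.of_le_add fun s hs t ht => ?_
    rcases le_total s t with hst | hts
    · exact ((strictMonoOn_additiveFunctional hy).monotoneOn hs ht hst).trans
        (le_add_of_nonneg_right dist_nonneg)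
    · have hsub := (additiveFunctional_sub_mem_Icc hy ht hts).2
      rw [Real.dist_eq, abs_of_nonneg (by linarith)]
      linarith
  exact hlip.continuousOn

-- From `s` to `2 s + 1` the functional grows by at least `1 / 2`.
lemma exists_le_additiveFunctional (hy : Measurable y) (t : ℝ) :
    ∃ s, 0 ≤ s ∧ t ≤ additiveFunctional y s := by
  have hhalf : ∀ k : ℕ, ∃ s, 0 ≤ s ∧ (k : ℝ) / 2 ≤ additiveFunctional y s := by
    intro k
    induction k with
    | zero => exact ⟨0, le_rfl, by simp⟩
    | succ k ih =>
      obtain ⟨s, hs, hk⟩ := ih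
      have hsub := (additiveFunctional_sub_mem_Icc hy hs (by linarith : s ≤ 2 * s + 1)).1
      have hratio : (2 * s + 1 - s) / (1 + (2 * s + 1)) = 1 / 2 := by
        field_simp
        ring
      refine ⟨2 * s + 1, by linarith, ?_⟩
      push_cast
      linarith
  obtain ⟨k, hk⟩ := exists_nat_ge (2 * t)
  obtain ⟨s, hs, hks⟩ := hhalf k
  exact ⟨s, hs, by linarith⟩

/-- The generalized inverse `A⁻¹` of the additive functional `A` of the path `y`. -/
def inverseFunctional {α : Type*} (y : ℝ → α) (t : ℝ) : ℝ :=
  sInf {s : ℝ | 0 ≤ s ∧ t ≤ additiveFunctional y s}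

omit [MeasurableSpace α] [MeasurableSingletonClass α] [Countable α] in
lemma inverseFunctional_nonneg (y : ℝ → α) (t : ℝ) : 0 ≤ inverseFunctional y t :=
  Real.sInf_nonneg fun _ hx => hx.1

lemma additiveFunctional_inverseFunctional (hy : Measurable y) {t : ℝ} (ht : 0 ≤ t) :
    additiveFunctional y (inverseFunctional y t) = t := by
  obtain ⟨s, hs, hts⟩ := exists_le_additiveFunctional hy t
  obtain ⟨r, ⟨hr, -⟩, rfl⟩ : t ∈ additiveFunctional y '' Set.Icc 0 s :=
    intermediate_value_Icc hs ((continuousOn_additiveFunctional hy).mono Set.Icc_subset_Ici_self)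
      ⟨by simpa using ht, hts⟩
  have hset : {s | 0 ≤ s ∧ additiveFunctional y r ≤ additiveFunctional y s} = Set.Ici r := by
    ext s
    refine ⟨fun h => ((strictMonoOn_additiveFunctional hy).le_iff_le hr h.1).1 h.2, fun h => ?_⟩
    have hs : 0 ≤ s := hr.trans h
    exact ⟨hs, ((strictMonoOn_additiveFunctional hy).le_iff_le hr hs).2 h⟩
  rw [inverseFunctional, hset, csInf_Ici]

lemma le_inverseFunctional_iff (hy : Measurable y) {s t : ℝ} (hs : 0 ≤ s) (ht : 0 ≤ t) :
    s ≤ inverseFunctional y t ↔ additiveFunctional y s ≤ t := by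
  conv_rhs => rw [← additiveFunctional_inverseFunctional hy ht]
  exact ((strictMonoOn_additiveFunctional hy).le_iff_le hs (inverseFunctional_nonneg y t)).symm

lemma measurable_inverseFunctional {Z : Type*} [MeasurableSpace Z] {Y : Z → ℝ → α}
    (hY : Measurable fun p : Z × ℝ => Y p.1 p.2) {t : ℝ} (ht : 0 ≤ t) :
    Measurable fun z => inverseFunctional (Y z) t := by
  refine measurable_of_Ici fun s => ?_
  rcases le_or_gt 0 s with hs | hs
  · have hpre : (fun z => inverseFunctional (Y z) t) ⁻¹' Set.Ici s =
        {z | additiveFunctional (Y z) s ≤ t} :=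
      Set.ext fun z => le_inverseFunctional_iff (hY.comp measurable_prodMk_left) hs ht
    have hmeas : Measurable fun z => additiveFunctional (Y z) s :=
      (measurable_additiveFunctional hY).comp measurable_prodMk_right
    rw [hpre]
    exact measurableSet_le hmeas measurable_const
  · convert MeasurableSet.univ
    exact Set.eq_univ_of_forall fun z => hs.le.trans (inverseFunctional_nonneg (Y z) t)

end AdditiveFunctional

section PathOf

variable {V : Type*} [MeasurableSpace V]

/-- The path with the sequence `z` of positions and holding times. -/
def pathOf (z : ℕ → V × ℝ) : ℝ → Option V :=
  jumpPath (fun n => (z n).1) (fun n => (z n).2)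

lemma measurable_jumpTime (n : ℕ) :
    Measurable fun z : ℕ → V × ℝ => jumpTime (fun n => (z n).2) n := by
  unfold jumpTime
  fun_prop

variable [DiscreteMeasurableSpace V]

lemma measurable_pathOf : Measurable fun p : (ℕ → V × ℝ) × ℝ => pathOf p.1 p.2 := by
  classical
  let visit (n : ℕ) (p : (ℕ → V × ℝ) × ℝ) : Prop :=
    jumpTime (fun n => (p.1 n).2) n ≤ p.2 ∧ p.2 < jumpTime (fun n => (p.1 n).2) (n + 1)
  have hvisit : ∀ n, MeasurableSet {p | visit n p} := fun n =>
    (measurableSet_le ((measurable_jumpTime n).comp measurable_fst) measurable_snd).inter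
      (measurableSet_lt measurable_snd ((measurable_jumpTime (n + 1)).comp measurable_fst))
  have hposition : ∀ n, Measurable fun p : {p | ∃ n, visit n p} => some (p.1.1 n).1 := fun n =>
    Measurable.of_discrete.comp
      ((measurable_pi_apply n).comp (measurable_fst.comp measurable_subtype_coe)).fst
  have hfound : Measurable fun p : {p | ∃ n, visit n p} => some (p.1.1 (Nat.find p.2)).1 :=
    Measurable.find hposition (fun n => measurable_subtype_coe (hvisit n)) fun p => p.2
  have hset : MeasurableSet {p | ∃ n, visit n p} := by
    rw [Set.ofPred_exists]
    exact MeasurableSet.iUnion hvisit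
  exact hfound.dite measurable_const hset

variable [Countable V]

lemma measurable_timeChangedPath :
    Measurable (timeChangedPath : (ℕ → V × ℝ) → (ℝ≥0 → Option V)) :=
  measurable_pi_lambda _ fun t => measurable_pathOf.comp
    (measurable_id.prodMk (measurable_inverseFunctional measurable_pathOf t.2))

end PathOf

/-! ### Occupation times of jump paths -/

section Occupation

variable {V : Type*} {ξ : ℕ → V} {S : ℕ → ℝ} {n : ℕ}

lemma jumpTime_succ (S : ℕ → ℝ) (n : ℕ) : jumpTime S (n + 1) = jumpTime S n + S n :=
  Finset.sum_range_succ _ _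

lemma jumpTime_le_jumpTime {m : ℕ} (hS : ∀ k < n, 0 < S k) (hmn : m ≤ n) :
    jumpTime S m ≤ jumpTime S n :=
  Finset.sum_le_sum_of_subset_of_nonneg (Finset.range_mono hmn) fun k hk _ =>
    (hS k (Finset.mem_range.1 hk)).le

lemma jumpTime_nonneg (hS : ∀ k < n, 0 < S k) : 0 ≤ jumpTime S n :=
  jumpTime_le_jumpTime hS (Nat.zero_le n)

lemma jumpPath_eq_some (hS : ∀ k < n, 0 < S k) {t : ℝ} (hn : jumpTime S n ≤ t)
    (ht : t < jumpTime S (n + 1)) : jumpPath ξ S t = some (ξ n) := by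
  classical
  have hex : ∃ n, jumpTime S n ≤ t ∧ t < jumpTime S (n + 1) := ⟨n, hn, ht⟩
  rw [jumpPath, dif_pos hex, (Nat.find_eq_iff hex).2 ⟨⟨hn, ht⟩, fun m hm htm => ?_⟩]
  exact absurd ((jumpTime_le_jumpTime hS hm).trans hn) (not_le.2 htm.2)

lemma measurable_jumpPath [MeasurableSpace V] [DiscreteMeasurableSpace V] (ξ : ℕ → V)
    (S : ℕ → ℝ) : Measurable (jumpPath ξ S) :=
  measurable_pathOf.comp (measurable_prodMk_left (x := fun n => (ξ n, S n)))

open Classical in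
/-- The local time at `x` of the walk with positions `ξ` and holding times `S` at its `n`-th jump,
see `localTime_jumpPath_jumpTime`. -/
def occupation (ξ : ℕ → V) (S : ℕ → ℝ) (x : V) (n : ℕ) : ℝ :=
  ∑ k ∈ Finset.range n, if ξ k = x then S k else 0

@[simp]
lemma occupation_zero (ξ : ℕ → V) (S : ℕ → ℝ) (x : V) : occupation ξ S x 0 = 0 :=
  Finset.sum_range_zero _

lemma occupation_succ (ξ : ℕ → V) (S : ℕ → ℝ) (x : V) (n : ℕ) [Decidable (ξ n = x)] :
    occupation ξ S x (n + 1) = occupation ξ S x n + if ξ n = x then S n else 0 := by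
  rw [occupation, Finset.sum_range_succ]
  congr

lemma occupation_succ_self (ξ : ℕ → V) (S : ℕ → ℝ) (n : ℕ) :
    occupation ξ S (ξ n) (n + 1) = occupation ξ S (ξ n) n + S n := by
  classical
  rw [occupation_succ, if_pos rfl]

lemma occupation_succ_of_ne {x : V} (h : ξ n ≠ x) :
    occupation ξ S x (n + 1) = occupation ξ S x n := by
  classical
  rw [occupation_succ, if_neg h, add_zero]

lemma occupation_nonneg {x : V} (hS : ∀ k < n, 0 < S k) : 0 ≤ occupation ξ S x n := by
  refine Finset.sum_nonneg fun k hk => ?_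
  split_ifs
  · exact (hS k (Finset.mem_range.1 hk)).le
  · exact le_rfl

lemma one_add_occupation_pos {x : V} (hS : ∀ k < n, 0 < S k) : 0 < 1 + occupation ξ S x n :=
  add_pos_of_pos_of_nonneg one_pos (occupation_nonneg hS)

lemma localTime_add_of_forall_eq {α : Type*} [MeasurableSpace α] [MeasurableSingletonClass α]
    {y : ℝ → α} (hy : Measurable y) {x x' : α} [Decidable (x' = x)] {s u : ℝ} (hu : 0 ≤ u)
    (hconst : ∀ t ∈ Set.Ioo s (s + u), y t = x') :
    localTime y x (s + u) = localTime y x s + if x' = x then u else 0 := by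
  have hint : ∀ a b : ℝ, IntervalIntegrable ((y ⁻¹' {x}).indicator (1 : ℝ → ℝ)) volume a b :=
    fun a b => (intervalIntegrable_const (c := (1 : ℝ))).mono_fun
      (measurable_one.indicator (hy (measurableSet_singleton x))).aestronglyMeasurable
      (Filter.Eventually.of_forall fun t => norm_indicator_le_norm_self _ t)
  have hpiece : (Set.Ioo s (s + u)).EqOn ((y ⁻¹' {x}).indicator (1 : ℝ → ℝ))
      fun _ => if x' = x then 1 else 0 := fun t ht => by
    simp [Set.indicator, hconst t ht]
  rw [localTime_eq_integral_indicator, localTime_eq_integral_indicator,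
    ← intervalIntegral.integral_add_adjacent_intervals (hint 0 s) (hint s (s + u)),
    intervalIntegral.integral_congr_Ioo_of_le (by linarith) hpiece,
    intervalIntegral.integral_const]
  simp

lemma localTime_jumpPath_add (hS : ∀ k < n, 0 < S k) (x : V) [Decidable (ξ n = x)] {u : ℝ}
    (hu : 0 ≤ u) (huS : u ≤ S n) :
    localTime (jumpPath ξ S) (some x) (jumpTime S n + u) =
      localTime (jumpPath ξ S) (some x) (jumpTime S n) + if ξ n = x then u else 0 := by
  classical
  let : MeasurableSpace V := ⊤
  have hvisit : ∀ t ∈ Set.Ioo (jumpTime S n) (jumpTime S n + u),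
      jumpPath ξ S t = some (ξ n) := fun t ht =>
    jumpPath_eq_some hS ht.1.le (by linarith [ht.2, jumpTime_succ S n])
  simpa using localTime_add_of_forall_eq (measurable_jumpPath ξ S) (x := some x) hu hvisit

lemma localTime_jumpPath_jumpTime (hS : ∀ k < n, 0 < S k) (x : V) :
    localTime (jumpPath ξ S) (some x) (jumpTime S n) = occupation ξ S x n := by
  classical
  induction n with
  | zero => simp [jumpTime, localTime]
  | succ n ih =>
    rw [jumpTime_succ, localTime_jumpPath_add (fun k hk => hS k (by omega)) x
      (hS n n.lt_succ_self).le le_rfl, ih fun k hk => hS k (by omega), occupation_succ]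

/-- The holding times of the time change of the walk with positions `ξ` and holding times `Y`, see
`timeChange_jumpPath`. -/
def logHolding (ξ : ℕ → V) (Y : ℕ → ℝ) (n : ℕ) : ℝ :=
  Real.log ((1 + occupation ξ Y (ξ n) n + Y n) / (1 + occupation ξ Y (ξ n) n))

variable {Y : ℕ → ℝ}

lemma logHolding_pos (hY : ∀ n, 0 < Y n) (n : ℕ) : 0 < logHolding ξ Y n := by
  have hL : 0 < 1 + occupation ξ Y (ξ n) n := one_add_occupation_pos fun k _ => hY k
  exact Real.log_pos ((one_lt_div hL).2 (by linarith [hY n]))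

lemma exp_occupation_logHolding (hY : ∀ n, 0 < Y n) (x : V) (n : ℕ) :
    Real.exp (occupation ξ (logHolding ξ Y) x n) = 1 + occupation ξ Y x n := by
  induction n with
  | zero => simp
  | succ n ih =>
    by_cases hx : ξ n = x
    · subst hx
      have hL : 0 < 1 + occupation ξ Y (ξ n) n := one_add_occupation_pos fun k _ => hY k
      rw [occupation_succ_self, occupation_succ_self, Real.exp_add, ih, logHolding,
        Real.exp_log (div_pos (by linarith [hY n]) hL), mul_div_cancel₀ _ hL.ne', add_assoc]
    · rw [occupation_succ_of_ne hx, occupation_succ_of_ne hx, ih]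

lemma jumpPath_congr {S' : ℕ → ℝ} {s t : ℝ} (h : ∀ n, jumpTime S n ≤ s ↔ jumpTime S' n ≤ t) :
    jumpPath ξ S s = jumpPath ξ S' t := by
  have hvisit : ∀ n, (jumpTime S n ≤ s ∧ s < jumpTime S (n + 1)) ↔
      (jumpTime S' n ≤ t ∧ t < jumpTime S' (n + 1)) := fun n => by
    rw [h n, ← not_le, h (n + 1), not_le]
  by_cases hs : ∃ n, jumpTime S n ≤ s ∧ s < jumpTime S (n + 1)
  · have ht := (exists_congr hvisit).1 hs
    rw [jumpPath, jumpPath, dif_pos hs, dif_pos ht, Nat.find_congr' (hp := hs) (hvisit _)]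
  · rw [jumpPath, jumpPath, dif_neg hs, dif_neg fun ht => hs ((exists_congr hvisit).2 ht)]

variable [Countable V] [MeasurableSpace V] [DiscreteMeasurableSpace V]

lemma additiveFunctional_jumpTime_succ (hY : ∀ n, 0 < Y n) (n : ℕ) :
    additiveFunctional (jumpPath ξ Y) (jumpTime Y (n + 1)) =
      additiveFunctional (jumpPath ξ Y) (jumpTime Y n) + logHolding ξ Y n := by
  classical
  have hpos : ∀ k < n, 0 < Y k := fun k _ => hY k
  set L := 1 + occupation ξ Y (ξ n) n with hLdef
  have hL : 0 < L := one_add_occupation_pos hpos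
  have hsucc := jumpTime_succ Y n
  have hle : jumpTime Y n ≤ jumpTime Y (n + 1) := by linarith [hY n]
  have hintegrand : (Set.Ioo (jumpTime Y n) (jumpTime Y (n + 1))).EqOn
      (inverseLocalTime (jumpPath ξ Y)) fun u => 1 / (u + (L - jumpTime Y n)) := by
    intro u hu
    have hlocal := localTime_jumpPath_add (ξ := ξ) hpos (ξ n) (u := u - jumpTime Y n)
      (by linarith [hu.1]) (by linarith [hu.2])
    rw [add_sub_cancel, if_pos rfl, localTime_jumpPath_jumpTime hpos] at hlocal
    rw [inverseLocalTime, jumpPath_eq_some hpos hu.1.le hu.2, hlocal]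
    ring
  rw [← sub_eq_iff_eq_add',
    additiveFunctional_sub (measurable_jumpPath ξ Y) (jumpTime_nonneg hpos) hle,
    intervalIntegral.integral_congr_Ioo_of_le hle hintegrand,
    intervalIntegral.integral_comp_add_right (f := fun v => 1 / v),
    integral_one_div_of_pos (by linarith) (by linarith [hY n]), hsucc, logHolding, ← hLdef]
  congr 2 <;> ring

lemma additiveFunctional_jumpTime (hY : ∀ n, 0 < Y n) (n : ℕ) :
    additiveFunctional (jumpPath ξ Y) (jumpTime Y n) = jumpTime (logHolding ξ Y) n := by
  induction n with
  | zero => simp [jumpTime]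
  | succ n ih => rw [additiveFunctional_jumpTime_succ hY, ih, jumpTime_succ]

lemma timeChange_jumpPath (hY : ∀ n, 0 < Y n) {t : ℝ} (ht : 0 ≤ t) :
    timeChange (jumpPath ξ Y) t = jumpPath ξ (logHolding ξ Y) t := by
  change jumpPath ξ Y (inverseFunctional (jumpPath ξ Y) t) = _
  refine jumpPath_congr fun n => ?_
  rw [le_inverseFunctional_iff (measurable_jumpPath ξ Y) (jumpTime_nonneg fun k _ => hY k) ht,
    additiveFunctional_jumpTime hY]

end Occupation

/-! ### Walks that follow alarms -/

section AlarmRace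

variable {V : Type*} {ξ ξ' : ℕ → V} {S S' : ℕ → ℝ} {n : ℕ}

open Classical in
/-- The clock of the edge `e` at the time of the `n`-th jump, see `edgeClock_jumpPath`. -/
def edgeOccupation (ξ : ℕ → V) (S : ℕ → ℝ) (e : Sym2 V) (n : ℕ) : ℝ :=
  ∑ k ∈ Finset.range n, if ξ k ∈ e then S k else 0

@[simp]
lemma edgeOccupation_zero (ξ : ℕ → V) (S : ℕ → ℝ) (e : Sym2 V) : edgeOccupation ξ S e 0 = 0 :=
  Finset.sum_range_zero _

lemma edgeOccupation_succ_of_mem {e : Sym2 V} (h : ξ n ∈ e) :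
    edgeOccupation ξ S e (n + 1) = edgeOccupation ξ S e n + S n := by
  rw [edgeOccupation, Finset.sum_range_succ, if_pos h, edgeOccupation]

lemma edgeOccupation_succ_of_notMem {e : Sym2 V} (h : ξ n ∉ e) :
    edgeOccupation ξ S e (n + 1) = edgeOccupation ξ S e n := by
  rw [edgeOccupation, Finset.sum_range_succ, if_neg h, edgeOccupation, add_zero]

lemma edgeOccupation_mk {x y : V} (hxy : x ≠ y) (n : ℕ) :
    edgeOccupation ξ S s(x, y) n = occupation ξ S x n + occupation ξ S y n := by
  classical
  rw [edgeOccupation, occupation, occupation, ← Finset.sum_add_distrib]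
  refine Finset.sum_congr rfl fun k _ => ?_
  by_cases hx : ξ k = x
  · simp [hx, hxy]
  · simp [hx]

lemma edgeOccupation_congr (hξ : ∀ k ≤ n, ξ k = ξ' k) (hS : ∀ k < n, S k = S' k) (e : Sym2 V) :
    edgeOccupation ξ S e n = edgeOccupation ξ' S' e n :=
  Finset.sum_congr rfl fun k hk => by
    have hk := Finset.mem_range.1 hk
    rw [hξ k hk.le, hS k hk]

lemma edgeClock_jumpPath (hS : ∀ k < n, 0 < S k) {j : V} (hj : ξ n ≠ j) {u : ℝ} (hu : 0 ≤ u)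
    (huS : u ≤ S n) :
    edgeClock (jumpPath ξ S) (ξ n) j (jumpTime S n + u) = edgeOccupation ξ S s(ξ n, j) n + u := by
  classical
  rw [edgeClock, localTime_jumpPath_add hS _ hu huS, localTime_jumpPath_add hS _ hu huS,
    if_pos rfl, if_neg hj, localTime_jumpPath_jumpTime hS, localTime_jumpPath_jumpTime hS,
    edgeOccupation_mk hj]
  ring

open Classical in
/-- The number of crossings of `e` in the first `n` jumps. -/
def crossings (ξ : ℕ → V) (e : Sym2 V) (n : ℕ) : ℕ :=
  ∑ k ∈ Finset.range n, if s(ξ k, ξ (k + 1)) = e then 1 else 0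

@[simp]
lemma crossings_zero (ξ : ℕ → V) (e : Sym2 V) : crossings ξ e 0 = 0 :=
  Finset.sum_range_zero _

lemma crossings_succ_of_eq {e : Sym2 V} (h : e = s(ξ n, ξ (n + 1))) :
    crossings ξ e (n + 1) = crossings ξ e n + 1 := by
  rw [crossings, Finset.sum_range_succ, if_pos h.symm, crossings]

lemma crossings_succ_of_ne {e : Sym2 V} (h : e ≠ s(ξ n, ξ (n + 1))) :
    crossings ξ e (n + 1) = crossings ξ e n := by
  rw [crossings, Finset.sum_range_succ, if_neg h.symm, crossings, add_zero]

lemma crossings_congr (hξ : ∀ k ≤ n, ξ k = ξ' k) (e : Sym2 V) :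
    crossings ξ e n = crossings ξ' e n :=
  Finset.sum_congr rfl fun k hk => by
    have hk := Finset.mem_range.1 hk
    rw [hξ k hk.le, hξ (k + 1) hk]

lemma eq_of_forall_step_eq {α β : Type*} {x x' : ℕ → α} {y y' : ℕ → β} (h0 : x 0 = x' 0)
    (hstep : ∀ n, (∀ k ≤ n, x k = x' k) → (∀ k < n, y k = y' k) →
      y n = y' n ∧ x (n + 1) = x' (n + 1)) : x = x' ∧ y = y' := by
  have hagree : ∀ n, (∀ k ≤ n, x k = x' k) ∧ ∀ k < n, y k = y' k := by
    intro n
    induction n with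
    | zero => simpa using h0
    | succ n ih =>
      obtain ⟨hy, hx⟩ := hstep n ih.1 ih.2
      exact ⟨fun k hk => (Nat.le_succ_iff.1 hk).elim (ih.1 k) fun h => h ▸ hx,
        Nat.forall_lt_succ_right.2 ⟨ih.2, hy⟩⟩
  exact ⟨funext fun n => (hagree n).1 n le_rfl,
    funext fun n => (hagree (n + 1)).2 n n.lt_succ_self⟩

variable {G : SimpleGraph V} {A : G.edgeSet → ℕ → ℝ}

/-- The walk with positions `ξ` and holding times `S` always crosses the adjacent edge whose next
alarm, among the alarm times `A`, is the first to ring, and there are no ties. -/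
def IsAlarmRace (A : G.edgeSet → ℕ → ℝ) (ξ : ℕ → V) (S : ℕ → ℝ) : Prop :=
  ∀ n, ∃ e : G.edgeSet, (e : Sym2 V) = s(ξ n, ξ (n + 1)) ∧ 0 < S n ∧
    edgeOccupation ξ S e n + S n = A e (crossings ξ e n + 1) ∧
    ∀ e' : G.edgeSet, ξ n ∈ (e' : Sym2 V) → e' ≠ e →
      edgeOccupation ξ S e' n + S n < A e' (crossings ξ e' n + 1)

lemma mem_of_eq_mk {e : Sym2 V} {x y : V} (h : e = s(x, y)) : x ∈ e :=
  h ▸ Sym2.mem_mk_left x y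

lemma IsAlarmRace.edgeOccupation_mem_Ico (h : IsAlarmRace A ξ S) (hA : ∀ e, StrictMono (A e))
    (hA0 : ∀ e, A e 0 = 0) (n : ℕ) (e : G.edgeSet) :
    edgeOccupation ξ S e n ∈ Set.Ico (A e (crossings ξ e n)) (A e (crossings ξ e n + 1)) := by
  induction n with
  | zero => simpa [hA0] using hA e Nat.zero_lt_one
  | succ n ih =>
    obtain ⟨e₀, he₀, hS, hwin, hlose⟩ := h n
    by_cases hee : e = e₀
    · subst hee
      rw [crossings_succ_of_eq he₀, edgeOccupation_succ_of_mem (mem_of_eq_mk he₀), hwin]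
      exact ⟨le_rfl, hA e (Nat.lt_succ_self _)⟩
    · rw [crossings_succ_of_ne fun he => hee (Subtype.ext (he.trans he₀.symm))]
      by_cases hin : ξ n ∈ (e : Sym2 V)
      · rw [edgeOccupation_succ_of_mem hin]
        exact ⟨by linarith [ih.1], hlose e hin hee⟩
      · rwa [edgeOccupation_succ_of_notMem hin]

lemma IsAlarmRace.unique (h : IsAlarmRace A ξ S) (h' : IsAlarmRace A ξ' S') (h0 : ξ 0 = ξ' 0) :
    ξ = ξ' ∧ S = S' := by
  refine eq_of_forall_step_eq h0 fun n hξ hS => ?_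
  obtain ⟨e, he, -, hwin, hlose⟩ := h n
  obtain ⟨e', he', -, hwin', hlose'⟩ := h' n
  simp only [← crossings_congr hξ, ← edgeOccupation_congr hξ hS, ← hξ n le_rfl] at he' hwin' hlose'
  have hee : e = e' := by
    by_contra hne
    linarith [hlose e' (mem_of_eq_mk he') (Ne.symm hne), hlose' e (mem_of_eq_mk he) hne]
  subst hee
  exact ⟨by linarith, Sym2.congr_right.1 (he.symm.trans he')⟩

variable {a : G.edgeSet → ℝ} {τ : G.edgeSet → ℕ → ℝ}

lemma FollowsAlarms.exists_edgeOccupation_add_eq (h : FollowsAlarms G a τ ξ S) (n : ℕ) :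
    ∃ e : G.edgeSet, (e : Sym2 V) = s(ξ n, ξ (n + 1)) ∧
      ∃ k, edgeOccupation ξ S e n + S n = alarmTime (a e) (τ e) k := by
  obtain ⟨hS, ⟨hadj, k, -, hk⟩, -⟩ := h n
  rw [jumpTime_succ, edgeClock_jumpPath (fun m _ => (h m).1) hadj.ne hS.le le_rfl] at hk
  exact ⟨⟨s(ξ n, ξ (n + 1)), hadj⟩, rfl, k, hk⟩

lemma FollowsAlarms.edgeOccupation_add_ne (h : FollowsAlarms G a τ ξ S) {e : G.edgeSet}
    (he : ξ n ∈ (e : Sym2 V)) {k : ℕ} (hk : 0 < k) {u : ℝ} (hu : 0 < u) (huS : u < S n) :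
    edgeOccupation ξ S e n + u ≠ alarmTime (a e) (τ e) k := by
  obtain ⟨e, hadj⟩ := e
  obtain ⟨j, rfl⟩ := Sym2.mem_iff_exists.1 he
  have hquiet := (h n).2.2 j hadj k hk (jumpTime S n + u)
    ⟨by linarith, by linarith [jumpTime_succ S n]⟩
  rwa [edgeClock_jumpPath (fun m _ => (h m).1) (G.ne_of_adj hadj) hu.le huS.le] at hquiet

lemma FollowsAlarms.eq_of_isAlarmRace (h : FollowsAlarms G a τ ξ S)
    (h' : IsAlarmRace (fun e => alarmTime (a e) (τ e)) ξ' S')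
    (hA : ∀ e, StrictMono (alarmTime (a e) (τ e))) (h0 : ξ 0 = ξ' 0) : ξ = ξ' ∧ S = S' := by
  refine eq_of_forall_step_eq h0 fun n hξ hS => ?_
  obtain ⟨e, he, k, hk⟩ := h.exists_edgeOccupation_add_eq n
  obtain ⟨e', he', hS', hwin', hlose'⟩ := h' n
  have hnext := h'.edgeOccupation_mem_Ico hA (fun e => by simp [alarmTime]) n e
  simp only [← crossings_congr hξ, ← edgeOccupation_congr hξ hS, ← hξ n le_rfl]
    at he' hwin' hlose' hnext
  have hlt : crossings ξ e n < k := (hA e).lt_iff_lt.1 (by linarith [hnext.1, (h n).1])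
  have hle : alarmTime (a e) (τ e) (crossings ξ e n + 1) ≤ alarmTime (a e) (τ e) k :=
    (hA e).monotone hlt
  have hS'_le : S' n ≤ S n := by
    by_cases hee : e = e'
    · subst hee
      linarith
    · linarith [hlose' e (mem_of_eq_mk he) hee]
  have hSS : S n = S' n := le_antisymm
    (not_lt.1 fun hlt' =>
      h.edgeOccupation_add_ne (mem_of_eq_mk he') (Nat.succ_pos _) hS' hlt' hwin') hS'_le
  have hee : e = e' := by
    by_contra hne
    linarith [hlose' e (mem_of_eq_mk he) hne]
  exact ⟨hSS, Sym2.congr_right.1 (he.symm.trans (hee ▸ he'))⟩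

/-- The walk with positions `ξ` and holding times `Y` crosses the edges that win the races with the
speeds `c n`: in the `n`-th race, the edge `e` is at distance `ρ n (e, 0)` from its next goal and
the `ρ n (e, m + 1)` are the distances between its further goals. -/
def IsEdgeRace (c : ℕ → G.edgeSet → ℝ) (ρ : ℕ → G.edgeSet × ℕ → ℝ) (ξ : ℕ → V) (Y : ℕ → ℝ) :
    Prop :=
  ∀ n, ∃ e : G.edgeSet, (e : Sym2 V) = s(ξ n, ξ (n + 1)) ∧ 0 < Y n ∧
    ρ n (e, 0) = c n e * Y n ∧
    (∀ e' : G.edgeSet, ξ n ∈ (e' : Sym2 V) → e' ≠ e → c n e' * Y n < ρ n (e', 0)) ∧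
    (∀ m, ρ (n + 1) (e, m) = ρ n (e, m + 1)) ∧
    ∀ e' ≠ e, ρ (n + 1) (e', 0) = ρ n (e', 0) - c n e' * Y n ∧
      ∀ m, ρ (n + 1) (e', m + 1) = ρ n (e', m + 1)

lemma exp_edgeOccupation_logHolding (hY : ∀ n, 0 < Y n) {x y : V} (hxy : x ≠ y) (n : ℕ) :
    Real.exp (edgeOccupation ξ (logHolding ξ Y) s(x, y) n) =
      (1 + occupation ξ Y x n) * (1 + occupation ξ Y y n) := by
  rw [edgeOccupation_mk hxy, Real.exp_add, exp_occupation_logHolding hY,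
    exp_occupation_logHolding hY]

namespace IsEdgeRace

variable {c : ℕ → G.edgeSet → ℝ} {ρ : ℕ → G.edgeSet × ℕ → ℝ} {Y : ℕ → ℝ}

lemma holding_pos (h : IsEdgeRace c ρ ξ Y) (n : ℕ) : 0 < Y n := by
  obtain ⟨-, -, hY, -⟩ := h n
  exact hY

lemma apply_succ (h : IsEdgeRace c ρ ξ Y) (n : ℕ) (e : G.edgeSet) (m : ℕ) :
    ρ n (e, m + 1) = ρ 0 (e, crossings ξ e n + m + 1) := by
  induction n generalizing m with
  | zero => simp
  | succ n ih =>
    obtain ⟨e₀, he₀, -, -, -, hwin, hlose⟩ := h n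
    by_cases hee : e = e₀
    · subst hee
      rw [hwin, ih, crossings_succ_of_eq he₀]
      congr 2
      ring
    · rw [(hlose e hee).2, ih,
        crossings_succ_of_ne fun he => hee (Subtype.ext (he.trans he₀.symm))]

variable {F : G.edgeSet → ℕ → ℝ → ℝ}

lemma apply_zero_eq_sub (h : IsEdgeRace c ρ ξ Y) (hF : ∀ e k, (F e k).Injective)
    (hA0 : ∀ e, A e 0 = 0) (hA : ∀ e k, F e k (A e (k + 1)) - F e k (A e k) = ρ 0 (e, k))
    (hc : ∀ n (e : G.edgeSet), ξ n ∈ (e : Sym2 V) →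
      F e (crossings ξ e n) (edgeOccupation ξ S e n + S n) =
        F e (crossings ξ e n) (edgeOccupation ξ S e n) + c n e * Y n)
    (hc0 : ∀ n (e : G.edgeSet), ξ n ∉ (e : Sym2 V) → c n e = 0) (n : ℕ) (e : G.edgeSet) :
    ρ n (e, 0) = F e (crossings ξ e n) (A e (crossings ξ e n + 1)) -
      F e (crossings ξ e n) (edgeOccupation ξ S e n) := by
  induction n with
  | zero => simpa [hA0] using (hA e 0).symm
  | succ n ih =>
    obtain ⟨e₀, he₀, -, hwin, -, hnew, hold⟩ := h n
    by_cases hee : e = e₀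
    · subst hee
      have hmem := mem_of_eq_mk he₀
      have hring : edgeOccupation ξ S e n + S n = A e (crossings ξ e n + 1) :=
        hF e (crossings ξ e n) (by linarith [hc n e hmem])
      rw [hnew, h.apply_succ, crossings_succ_of_eq he₀, edgeOccupation_succ_of_mem hmem, hring, hA,
        add_zero]
    · rw [(hold e hee).1, ih,
        crossings_succ_of_ne fun he => hee (Subtype.ext (he.trans he₀.symm))]
      by_cases hin : ξ n ∈ (e : Sym2 V)
      · rw [edgeOccupation_succ_of_mem hin, hc n e hin]
        ring
      · rw [edgeOccupation_succ_of_notMem hin, hc0 n e hin]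
        ring

-- `F e k` translates clock values of `e` after `k` crossings into distances run in the race.
lemma isAlarmRace (h : IsEdgeRace c ρ ξ Y) (hF : ∀ e k, StrictMono (F e k))
    (hA0 : ∀ e, A e 0 = 0) (hA : ∀ e k, F e k (A e (k + 1)) - F e k (A e k) = ρ 0 (e, k))
    (hS : ∀ n, 0 < S n)
    (hc : ∀ n (e : G.edgeSet), ξ n ∈ (e : Sym2 V) →
      F e (crossings ξ e n) (edgeOccupation ξ S e n + S n) =
        F e (crossings ξ e n) (edgeOccupation ξ S e n) + c n e * Y n)
    (hc0 : ∀ n (e : G.edgeSet), ξ n ∉ (e : Sym2 V) → c n e = 0) : IsAlarmRace A ξ S := by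
  intro n
  have hdist := h.apply_zero_eq_sub (fun e k => (hF e k).injective) hA0 hA hc hc0 n
  obtain ⟨e, he, -, hwin, hlose, -, -⟩ := h n
  refine ⟨e, he, hS n, ?_, fun e' hmem' hne => ?_⟩
  · exact (hF e (crossings ξ e n)).injective
      (by linarith [hdist e, hc n e (mem_of_eq_mk he)])
  · exact (hF e' (crossings ξ e' n)).lt_iff_lt.1
      (by linarith [hdist e', hc n e' hmem', hlose e' hmem' hne])

lemma isAlarmRace_of_crossings (h : IsEdgeRace c ρ ξ S) (ha : ∀ e, 0 < a e)
    (hc : ∀ n (e : G.edgeSet), ξ n ∈ (e : Sym2 V) → c n e = a e + crossings ξ e n)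
    (hc0 : ∀ n (e : G.edgeSet), ξ n ∉ (e : Sym2 V) → c n e = 0) :
    IsAlarmRace (fun e => alarmTime (a e) fun k => ρ 0 (e, k)) ξ S := by
  have hpos : ∀ (e : G.edgeSet) (k : ℕ), 0 < a e + k := fun e k =>
    add_pos_of_pos_of_nonneg (ha e) k.cast_nonneg
  refine h.isAlarmRace (F := fun e k x => (a e + k) * x)
    (fun e k => strictMono_mul_left_of_pos (hpos e k)) (fun e => by simp [alarmTime])
    (fun e k => ?_) h.holding_pos (fun n e hmem => ?_) hc0
  · have := (hpos e k).ne'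
    simp only [alarmTime, Finset.sum_range_succ]
    field_simp
    ring
  · rw [hc n e hmem, mul_add]

lemma isAlarmRace_logHolding {w : G.edgeSet → ℝ} (hw : ∀ e, 0 < w e) (h : IsEdgeRace c ρ ξ Y)
    (hc : ∀ n (e : G.edgeSet) (y : V), (e : Sym2 V) = s(ξ n, y) →
      c n e = w e * (1 + occupation ξ Y y n))
    (hc0 : ∀ n (e : G.edgeSet), ξ n ∉ (e : Sym2 V) → c n e = 0)
    (hA : ∀ e k, Real.exp (A e k) = (w e + ∑ l ∈ Finset.range k, ρ 0 (e, l)) / w e) :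
    IsAlarmRace A ξ (logHolding ξ Y) := by
  have hY := h.holding_pos
  refine h.isAlarmRace (F := fun e _ x => w e * Real.exp x)
    (fun e _ => Real.exp_strictMono.const_mul (hw e))
    (fun e => by simpa [(hw e).ne'] using hA e 0) (fun e k => ?_) (logHolding_pos hY)
    (fun n e hmem => ?_) hc0
  · have := (hw e).ne'
    rw [hA, hA, Finset.sum_range_succ]
    field_simp
    ring
  · obtain ⟨y, hy⟩ := Sym2.mem_iff_exists.1 hmem
    have hadj : G.Adj (ξ n) y := by
      rw [← SimpleGraph.mem_edgeSet, ← hy]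
      exact e.2
    rw [← edgeOccupation_succ_of_mem hmem, hc n e y hy, hy,
      exp_edgeOccupation_logHolding hY hadj.ne, exp_edgeOccupation_logHolding hY hadj.ne,
      occupation_succ_self, occupation_succ_of_ne hadj.ne]
    ring

end IsEdgeRace

end AlarmRace

/-! ### Laws of sequences of jumps -/

section JumpRecord

variable {V : Type*}

/-- Add to the record `z` of the first `n` jumps a holding time `s` and a jump to `y`. -/
def appendJump (n : ℕ) (z : ℕ → V × ℝ) (y : V) (s : ℝ) : ℕ → V × ℝ := fun k =>
  if k = n then ((z n).1, s) else if k = n + 1 then (y, 0) else z k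

/-- The record of the first `n` jumps of `z`: the first `n + 1` positions and the first `n` holding
times, followed by dummy values. -/
def jumpRecord (i₀ : V) (n : ℕ) (z : ℕ → V × ℝ) : ℕ → V × ℝ := fun k =>
  if k < n then z k else if k = n then ((z n).1, 0) else (i₀, 0)

variable (i₀ : V) {n k : ℕ} (z : ℕ → V × ℝ)

lemma jumpRecord_apply_of_lt (h : k < n) : jumpRecord i₀ n z k = z k := if_pos h

lemma jumpRecord_apply_fst (h : k ≤ n) : (jumpRecord i₀ n z k).1 = (z k).1 := by
  rcases h.lt_or_eq with h | rfl
  · rw [jumpRecord_apply_of_lt i₀ z h]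
  · simp [jumpRecord]

lemma jumpRecord_zero (h : (z 0).1 = i₀) : jumpRecord i₀ 0 z = fun _ => (i₀, 0) := by
  funext k
  by_cases hk : k = 0 <;> simp [jumpRecord, hk, h]

lemma jumpRecord_succ (n : ℕ) (z : ℕ → V × ℝ) :
    jumpRecord i₀ (n + 1) z = appendJump n (jumpRecord i₀ n z) (z (n + 1)).1 (z n).2 := by
  funext k
  simp only [jumpRecord, appendJump]
  grind

variable [MeasurableSpace V]

lemma measurable_appendJump (n : ℕ) :
    Measurable fun p : (ℕ → V × ℝ) × V × ℝ => appendJump n p.1 p.2.1 p.2.2 := by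
  refine measurable_pi_lambda _ fun k => ?_
  unfold appendJump
  split_ifs <;> fun_prop

lemma measurable_jumpRecord (n : ℕ) : Measurable (jumpRecord i₀ n) := by
  refine measurable_pi_lambda _ fun k => ?_
  unfold jumpRecord
  split_ifs <;> fun_prop

lemma measurableSet_position_eq [MeasurableSingletonClass V] (n : ℕ) (x : V) :
    MeasurableSet {z : ℕ → V × ℝ | (z n).1 = x} := by
  have h : Measurable fun z : ℕ → V × ℝ => (z n).1 := by fun_prop
  exact h (measurableSet_singleton x)

lemma measurableSet_jump [MeasurableSingletonClass V] (n : ℕ) (j : V) (s : ℝ) :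
    MeasurableSet {z : ℕ → V × ℝ | s < (z n).2 ∧ (z (n + 1)).1 = j} := by
  have h : Measurable fun z : ℕ → V × ℝ => (z n).2 := by fun_prop
  exact (measurableSet_lt measurable_const h).inter (measurableSet_position_eq (n + 1) j)

end JumpRecord

section Uniqueness

variable {α β : Type*} [MeasurableSpace α] [MeasurableSpace β]

lemma measure_ext_of_records {T : ℕ → (ℕ → α) → ℕ → α} (hT : ∀ n, Measurable (T n))
    (hTk : ∀ n z, ∀ k < n, T n z k = z k) {Q Q' : Measure (ℕ → α)} [IsFiniteMeasure Q]
    (h : ∀ n, Q.map (T n) = Q'.map (T n)) : Q = Q' := by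
  have hmarginal (I : Finset ℕ) : Q.map I.restrict = Q'.map I.restrict := by
    obtain ⟨n, hn⟩ : ∃ n, ∀ k ∈ I, k < n :=
      ⟨I.sup id + 1, fun k hk => Nat.lt_succ_of_le (Finset.le_sup (f := id) hk)⟩
    have hrestrict : (I.restrict : (ℕ → α) → _) = I.restrict ∘ T n := by
      funext z k
      exact (hTk n z k (hn k k.2)).symm
    rw [hrestrict, ← Measure.map_map (Finset.measurable_restrict I) (hT n),
      ← Measure.map_map (Finset.measurable_restrict I) (hT n), h n]
  exact IsProjectiveLimit.unique (P := fun I => Q.map I.restrict) (fun _ => rfl)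
    fun I => (hmarginal I).symm

lemma measure_ext_of_Ioi_nonneg {m m' : Measure ℝ} [IsFiniteMeasure m] (hm : ∀ᵐ x ∂m, 0 < x)
    (hm' : ∀ᵐ x ∂m', 0 < x) (h : ∀ s, 0 ≤ s → m (Set.Ioi s) = m' (Set.Ioi s)) : m = m' := by
  have hpos {M : Measure ℝ} (hM : ∀ᵐ x ∂M, 0 < x) {D : Set ℝ} (hD : Set.Ioi 0 ⊆ D) :
      M D = M (Set.Ioi 0) := by
    refine measure_congr (hM.mono fun x hx => propext ?_)
    exact ⟨fun _ => hx, fun _ => hD hx⟩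
  refine ext_of_generate_finite (Set.range Set.Ioi) ?_ isPiSystem_Ioi ?_ ?_
  · rw [← borel_eq_generateFrom_Ioi]
    exact BorelSpace.measurable_eq
  · rintro _ ⟨s, rfl⟩
    rcases le_total 0 s with hs | hs
    · exact h s hs
    · rw [hpos hm (Set.Ioi_subset_Ioi hs), hpos hm' (Set.Ioi_subset_Ioi hs), h 0 le_rfl]
  · rw [hpos hm (Set.subset_univ _), hpos hm' (Set.subset_univ _), h 0 le_rfl]

variable {Q Q' : Measure α} {f : α → β} (hf : Measurable f)
include hf

lemma map_prodMk_congr_of_countable {ι : Type*} [Countable ι] [MeasurableSpace ι]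
    [MeasurableSingletonClass ι] {y : α → ι} (hy : Measurable y)
    (h : ∀ j, (Q.restrict {x | y x = j}).map f = (Q'.restrict {x | y x = j}).map f) :
    Q.map (fun x => (f x, y x)) = Q'.map fun x => (f x, y x) := by
  refine Measure.ext fun B hB => ?_
  have hsection (j : ι) : MeasurableSet (f ⁻¹' ((fun b => (b, j)) ⁻¹' B)) :=
    hf (measurable_prodMk_right hB)
  have hunion : (fun x => (f x, y x)) ⁻¹' B =
      ⋃ j, f ⁻¹' ((fun b => (b, j)) ⁻¹' B) ∩ {x | y x = j} := by
    ext x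
    simp
  have hdisj : Pairwise (Function.onFun Disjoint fun j =>
      f ⁻¹' ((fun b => (b, j)) ⁻¹' B) ∩ {x | y x = j}) := fun i j hij =>
    Set.disjoint_left.2 fun x hi hj => hij (hi.2.symm.trans hj.2)
  have hmeas (j : ι) : MeasurableSet (f ⁻¹' ((fun b => (b, j)) ⁻¹' B) ∩ {x | y x = j}) :=
    (hsection j).inter (hy (measurableSet_singleton j))
  rw [Measure.map_apply (hf.prodMk hy) hB, Measure.map_apply (hf.prodMk hy) hB, hunion,
    measure_iUnion hdisj hmeas, measure_iUnion hdisj hmeas]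
  refine tsum_congr fun j => ?_
  rw [← Measure.restrict_apply (hsection j), ← Measure.restrict_apply (hsection j),
    ← Measure.map_apply hf (measurable_prodMk_right hB), h j,
    Measure.map_apply hf (measurable_prodMk_right hB)]

lemma map_prodMk_congr_of_Ioi [IsFiniteMeasure Q] {t : α → ℝ} (ht : Measurable t)
    (hpos : ∀ᵐ x ∂Q, 0 < t x) (hpos' : ∀ᵐ x ∂Q', 0 < t x)
    (h : ∀ s, 0 ≤ s → (Q.restrict {x | s < t x}).map f = (Q'.restrict {x | s < t x}).map f) :
    Q.map (fun x => (f x, t x)) = Q'.map fun x => (f x, t x) := by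
  have hfinite : IsFiniteMeasure (Q.map fun x => (f x, t x)) := inferInstance
  refine Measure.ext_prod fun {A D} hA hD => ?_
  have hpos_map {M : Measure α} (hM : ∀ᵐ x ∂M, 0 < t x) :
      ∀ᵐ r ∂(M.restrict (f ⁻¹' A)).map t, 0 < r :=
    (ae_map_iff ht.aemeasurable measurableSet_Ioi).2 (ae_restrict_of_ae hM)
  have hmap : (Q.restrict (f ⁻¹' A)).map t = (Q'.restrict (f ⁻¹' A)).map t := by
    refine measure_ext_of_Ioi_nonneg (hpos_map hpos) (hpos_map hpos') fun s hs => ?_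
    have happly (M : Measure α) : (M.restrict (f ⁻¹' A)).map t (Set.Ioi s) =
        (M.restrict {x | s < t x}).map f A := by
      rw [Measure.map_apply ht measurableSet_Ioi, Measure.map_apply hf hA,
        Measure.restrict_apply (ht measurableSet_Ioi), Measure.restrict_apply (hf hA),
        Set.inter_comm]
      rfl
    rw [happly, happly, h s hs]
  have happly (M : Measure α) : M.map (fun x => (f x, t x)) (A ×ˢ D) =
      (M.restrict (f ⁻¹' A)).map t D := by
    rw [Measure.map_apply (hf.prodMk ht) (hA.prod hD), Measure.map_apply ht hD,
      Measure.restrict_apply (ht hD), Set.inter_comm]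
    rfl
  rw [happly, happly, hmap]

lemma ae_exists_mem_of_map_restrict_eq [IsProbabilityMeasure Q] {ι : Type*} [Countable ι]
    {A : ι → Set α} (hA : ∀ j, MeasurableSet (A j)) (hdisj : Pairwise (Function.onFun Disjoint A))
    {q : ι → β → ℝ≥0∞} (hq : ∀ j, Measurable (q j)) (hsum : ∀ b, ∑' j, q j b = 1)
    (h : ∀ j, (Q.restrict (A j)).map f = (Q.map f).withDensity (q j)) :
    ∀ᵐ x ∂Q, ∃ j, x ∈ A j := by
  have hmass (j : ι) : Q (A j) = ∫⁻ b, q j b ∂Q.map f := by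
    have huniv := congrArg (fun M => M Set.univ) (h j)
    simpa only [Measure.map_apply hf MeasurableSet.univ, Set.preimage_univ,
      Measure.restrict_apply_univ, withDensity_apply _ MeasurableSet.univ,
      Measure.restrict_univ] using huniv
  have hprob : IsProbabilityMeasure (Q.map f) := Measure.isProbabilityMeasure_map hf.aemeasurable
  have hunion : Q (⋃ j, A j) = 1 := by
    rw [measure_iUnion hdisj hA]
    simp only [hmass]
    rw [← lintegral_tsum fun j => (hq j).aemeasurable]
    simp only [hsum, lintegral_one, measure_univ]
  have hae : ∀ᵐ x ∂Q, x ∈ ⋃ j, A j := (mem_ae_iff_prob_eq_one (MeasurableSet.iUnion hA)).2 hunion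
  exact hae.mono fun x => Set.mem_iUnion.1

end Uniqueness

section JumpLaw

variable {V : Type*} [MeasurableSpace V]

/-- Under `Q`, conditionally on the record `z` of the first `n` jumps, the `n`-th holding time
exceeds `s` and the next position is `j` with probability `p n z j s`. -/
structure HasJumpLaw (i₀ : V) (p : ℕ → (ℕ → V × ℝ) → V → ℝ → ℝ) (Q : Measure (ℕ → V × ℝ)) :
    Prop where
  start : ∀ᵐ z ∂Q, (z 0).1 = i₀
  jump : ∀ (n : ℕ) (j : V) (s : ℝ), 0 ≤ s →
    (Q.restrict {z | s < (z n).2 ∧ (z (n + 1)).1 = j}).map (jumpRecord i₀ n) =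
      (Q.map (jumpRecord i₀ n)).withDensity fun z => ENNReal.ofReal (p n z j s)

namespace HasJumpLaw

variable [MeasurableSingletonClass V] [Countable V] {i₀ : V} {p : ℕ → (ℕ → V × ℝ) → V → ℝ → ℝ}
  {Q Q' : Measure (ℕ → V × ℝ)} [IsProbabilityMeasure Q] [IsProbabilityMeasure Q']

lemma unique (h : HasJumpLaw i₀ p Q) (h' : HasJumpLaw i₀ p Q') (hpos : ∀ᵐ z ∂Q, ∀ n, 0 < (z n).2)
    (hpos' : ∀ᵐ z ∂Q', ∀ n, 0 < (z n).2) : Q = Q' := by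
  refine measure_ext_of_records (measurable_jumpRecord i₀)
    (fun n z k hk => jumpRecord_apply_of_lt i₀ z hk) fun n => ?_
  induction n with
  | zero =>
    rw [Measure.map_congr (h.start.mono (jumpRecord_zero i₀)),
      Measure.map_congr (h'.start.mono (jumpRecord_zero i₀))]
    simp
  | succ n ih =>
    have hrecord := measurable_jumpRecord i₀ n
    have hholding : Measurable fun z : ℕ → V × ℝ => (z n).2 := by fun_prop
    have hposition : Measurable fun z : ℕ → V × ℝ => (z (n + 1)).1 := by fun_prop
    have hrestrict (M : Measure (ℕ → V × ℝ)) (j : V) (s : ℝ) :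
        (M.restrict {z | (z (n + 1)).1 = j}).restrict {z | s < (z n).2} =
          M.restrict {z | s < (z n).2 ∧ (z (n + 1)).1 = j} :=
      Measure.restrict_restrict (measurableSet_lt measurable_const hholding)
    have hjoint := map_prodMk_congr_of_countable (hrecord.prodMk hholding) hposition fun j =>
      map_prodMk_congr_of_Ioi hrecord hholding
        (ae_restrict_of_ae (s := {z | (z (n + 1)).1 = j}) (hpos.mono fun z hz => hz n))
        (ae_restrict_of_ae (s := {z | (z (n + 1)).1 = j}) (hpos'.mono fun z hz => hz n))
        fun s hs => by rw [hrestrict, hrestrict, h.jump n j s hs, h'.jump n j s hs, ih]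
    have happend : Measurable fun q : ((ℕ → V × ℝ) × ℝ) × V => appendJump n q.1.1 q.2 q.1.2 :=
      (measurable_appendJump n).comp
        (f := fun q : ((ℕ → V × ℝ) × ℝ) × V => (q.1.1, q.2, q.1.2)) (by fun_prop)
    have hcomp : jumpRecord i₀ (n + 1) = (fun q : ((ℕ → V × ℝ) × ℝ) × V =>
        appendJump n q.1.1 q.2 q.1.2) ∘ fun z => ((jumpRecord i₀ n z, (z n).2), (z (n + 1)).1) :=
      funext fun z => jumpRecord_succ i₀ n z
    rw [hcomp, ← Measure.map_map happend ((hrecord.prodMk hholding).prodMk hposition), hjoint,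
      Measure.map_map happend ((hrecord.prodMk hholding).prodMk hposition)]

end HasJumpLaw

end JumpLaw

section StepLaw

variable {V : Type*}

/-- The record of the first `n + 1` positions of `x`, followed by dummy values. -/
def stepRecord (i₀ : V) (n : ℕ) (x : ℕ → V) : ℕ → V := fun k => if k ≤ n then x k else i₀

variable (i₀ : V) {n k : ℕ} (x : ℕ → V)

lemma stepRecord_apply (h : k ≤ n) : stepRecord i₀ n x k = x k := if_pos h

lemma stepRecord_zero (h : x 0 = i₀) : stepRecord i₀ 0 x = fun _ => i₀ := by
  funext k
  by_cases hk : k = 0 <;> simp [stepRecord, hk, h]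

lemma stepRecord_fst (n : ℕ) (z : ℕ → V × ℝ) :
    stepRecord i₀ n (fun k => (z k).1) = fun k => (jumpRecord i₀ n z k).1 := by
  funext k
  simp only [stepRecord, jumpRecord]
  grind

lemma stepRecord_succ (n : ℕ) (x : ℕ → V) :
    stepRecord i₀ (n + 1) x = Function.update (stepRecord i₀ n x) (n + 1) (x (n + 1)) := by
  funext k
  simp only [stepRecord, Function.update_apply]
  grind

variable [MeasurableSpace V]

lemma measurable_stepRecord (n : ℕ) : Measurable (stepRecord i₀ n) := by
  refine measurable_pi_lambda _ fun k => ?_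
  unfold stepRecord
  split_ifs <;> fun_prop

lemma measurableSet_apply_eq [MeasurableSingletonClass V] (n : ℕ) (x : V) :
    MeasurableSet {y : ℕ → V | y n = x} :=
  (measurable_pi_apply n : Measurable fun y : ℕ → V => y n) (measurableSet_singleton x)

/-- Under `Q`, conditionally on the first `n + 1` positions, recorded in `x`, the next position is
`j` with probability `p n x j`. -/
structure HasStepLaw (i₀ : V) (p : ℕ → (ℕ → V) → V → ℝ) (Q : Measure (ℕ → V)) : Prop where
  start : ∀ᵐ x ∂Q, x 0 = i₀
  step : ∀ (n : ℕ) (j : V), (Q.restrict {x | x (n + 1) = j}).map (stepRecord i₀ n) =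
    (Q.map (stepRecord i₀ n)).withDensity fun x => ENNReal.ofReal (p n x j)

lemma HasStepLaw.unique [MeasurableSingletonClass V] [Countable V] {i₀ : V}
    {p : ℕ → (ℕ → V) → V → ℝ} {Q Q' : Measure (ℕ → V)} [IsProbabilityMeasure Q]
    [IsProbabilityMeasure Q'] (h : HasStepLaw i₀ p Q) (h' : HasStepLaw i₀ p Q') : Q = Q' := by
  refine measure_ext_of_records (measurable_stepRecord i₀)
    (fun n x k hk => stepRecord_apply i₀ x hk.le) fun n => ?_
  induction n with
  | zero =>
    rw [Measure.map_congr (h.start.mono (stepRecord_zero i₀)),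
      Measure.map_congr (h'.start.mono (stepRecord_zero i₀))]
    simp
  | succ n ih =>
    have hrecord := measurable_stepRecord i₀ n
    have hposition : Measurable fun x : ℕ → V => x (n + 1) := by fun_prop
    have hjoint := map_prodMk_congr_of_countable (Q := Q) (Q' := Q') hrecord
      hposition fun j => by rw [h.step n j, h'.step n j, ih]
    have hupdate : Measurable fun q : (ℕ → V) × V => Function.update q.1 (n + 1) q.2 :=
      measurable_update'
    have hcomp : stepRecord i₀ (n + 1) = (fun q : (ℕ → V) × V => Function.update q.1 (n + 1) q.2) ∘
        fun x => (stepRecord i₀ n x, x (n + 1)) := funext fun x => stepRecord_succ i₀ n x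
    rw [hcomp, ← Measure.map_map hupdate (hrecord.prodMk hposition), hjoint,
      Measure.map_map hupdate (hrecord.prodMk hposition)]

lemma HasJumpLaw.hasStepLaw [MeasurableSingletonClass V] {i₀ : V}
    {p : ℕ → (ℕ → V × ℝ) → V → ℝ → ℝ} {p' : ℕ → (ℕ → V) → V → ℝ} {Q : Measure (ℕ → V × ℝ)}
    (h : HasJumpLaw i₀ p Q) (hpos : ∀ᵐ z ∂Q, ∀ n, 0 < (z n).2)
    (hp' : ∀ n j, Measurable fun x => p' n x j)
    (hpp' : ∀ n z j, p n z j 0 = p' n (fun k => (z k).1) j) :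
    HasStepLaw i₀ p' (Q.map fun z n => (z n).1) := by
  have hskeleton : Measurable fun (z : ℕ → V × ℝ) (n : ℕ) => (z n).1 := by fun_prop
  have hmap (M : Measure (ℕ → V × ℝ)) (n : ℕ) :
      (M.map fun z n => (z n).1).map (stepRecord i₀ n) =
        (M.map (jumpRecord i₀ n)).map fun z n => (z n).1 := by
    rw [Measure.map_map (measurable_stepRecord i₀ n) hskeleton,
      Measure.map_map hskeleton (measurable_jumpRecord i₀ n)]
    exact congrArg M.map (funext fun z => stepRecord_fst i₀ n z)
  refine ⟨(ae_map_iff hskeleton.aemeasurable (measurableSet_apply_eq 0 i₀)).2 h.start,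
    fun n j => ?_⟩
  have hjump : Q.restrict ((fun z n => (z n).1) ⁻¹' {x | x (n + 1) = j}) =
      Q.restrict {z | 0 < (z n).2 ∧ (z (n + 1)).1 = j} :=
    Measure.restrict_congr_set (hpos.mono fun z hz => propext ⟨fun hj => ⟨hz n, hj⟩, And.right⟩)
  rw [Measure.restrict_map hskeleton (measurableSet_apply_eq (n + 1) j), hmap, hmap, hjump,
    h.jump n j 0 le_rfl]
  refine Measure.ext fun B hB => ?_
  rw [Measure.map_apply hskeleton hB, withDensity_apply _ (hskeleton hB), withDensity_apply _ hB,
    setLIntegral_map hB (hp' n j).ennreal_ofReal hskeleton]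
  simp only [hpp']

end StepLaw

/-! ### Races along the edges of a graph -/

section Incidence

variable {V : Type*} {G : SimpleGraph V} {x y : V}

open Classical in
/-- The endpoint of the edge `e` other than `x`; it is `x` if `x` is not an endpoint of `e`. -/
def otherEnd (x : V) (e : Sym2 V) : V := if h : x ∈ e then Sym2.Mem.other h else x

lemma mk_otherEnd {e : Sym2 V} (h : x ∈ e) : s(x, otherEnd x e) = e := by
  rw [otherEnd, dif_pos h]
  exact Sym2.other_spec h

lemma otherEnd_mk (x y : V) : otherEnd x s(x, y) = y :=
  Sym2.congr_right.1 (mk_otherEnd (Sym2.mem_mk_left x y))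

lemma adj_otherEnd {e : G.edgeSet} (h : x ∈ (e : Sym2 V)) : G.Adj x (otherEnd x e) := by
  rw [← SimpleGraph.mem_edgeSet, mk_otherEnd h]
  exact e.2

lemma pairWeight_of_eq {c : G.edgeSet → ℝ} {e : G.edgeSet} (h : (e : Sym2 V) = s(x, y)) :
    pairWeight G c x y = c e := by
  have hadj : G.Adj x y := by
    rw [← SimpleGraph.mem_edgeSet, ← h]
    exact e.2
  rw [pairWeight, dif_pos hadj]
  exact congrArg c (Subtype.ext h.symm)

lemma pairWeight_of_not_adj {c : G.edgeSet → ℝ} (h : ¬ G.Adj x y) : pairWeight G c x y = 0 :=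
  dif_neg h

lemma pairWeight_nonneg {c : G.edgeSet → ℝ} (hc : ∀ e, 0 ≤ c e) (x y : V) :
    0 ≤ pairWeight G c x y := by
  rw [pairWeight]
  split_ifs
  exacts [hc _, le_rfl]

lemma pairWeight_congr {c c' : G.edgeSet → ℝ} (h : ∀ e : G.edgeSet, x ∈ (e : Sym2 V) → c e = c' e)
    (y : V) : pairWeight G c x y = pairWeight G c' x y := by
  unfold pairWeight
  split_ifs
  exacts [h _ (Sym2.mem_mk_left x y), rfl]

lemma measurable_pairWeight {H : Type*} [MeasurableSpace H] {c : H → G.edgeSet → ℝ}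
    (hc : ∀ e, Measurable fun h => c h e) (x y : V) :
    Measurable fun h => pairWeight G (c h) x y := by
  unfold pairWeight
  split_ifs
  exacts [hc _, measurable_const]

variable (G) [G.LocallyFinite]

open Classical in
/-- The edges adjacent to `x`, as a finite set. -/
def incidentEdges (x : V) : Finset G.edgeSet :=
  (G.neighborFinset x).attach.image fun y =>
    ⟨s(x, y.1), G.mem_edgeSet.2 ((G.mem_neighborFinset x y.1).1 y.2)⟩

variable {G}

lemma mem_incidentEdges {e : G.edgeSet} : e ∈ incidentEdges G x ↔ x ∈ (e : Sym2 V) := by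
  simp only [incidentEdges, Finset.mem_image, Finset.mem_attach, true_and, Subtype.exists]
  constructor
  · rintro ⟨y, hy, rfl⟩
    exact Sym2.mem_mk_left x y
  · exact fun h => ⟨otherEnd x e, (G.mem_neighborFinset x _).2 (adj_otherEnd h),
      Subtype.ext (mk_otherEnd h)⟩

lemma sum_incidentEdges (c : G.edgeSet → ℝ) (x : V) :
    ∑ e ∈ incidentEdges G x, c e = ∑ y ∈ G.neighborFinset x, pairWeight G c x y := by
  classical
  rw [incidentEdges, Finset.sum_image, ← Finset.sum_attach (G.neighborFinset x)]
  · exact Finset.sum_congr rfl fun y _ => (pairWeight_of_eq rfl).symm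
  · exact fun y _ y' _ h => Subtype.ext (Sym2.congr_right.1 (congrArg Subtype.val h))

end Incidence

section Walk

variable {V : Type*} [MeasurableSpace V]

/-- The histories of races along the edges of `G`: the weights of the edges and a record of the
jumps. -/
abbrev RaceHistory (G : SimpleGraph V) := (G.edgeSet → ℝ) × (ℕ → V × ℝ)

/-- A rule which prescribes the rate at which a walk crosses an edge adjacent to its position after
`n` jumps, as a function of the weights of the edges and of the record of the jumps. -/
structure ReinforcementRule (G : SimpleGraph V) where
  rate : ℕ → RaceHistory G → G.edgeSet → ℝ
  measurable_rate : ∀ n e, Measurable fun h => rate n h e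

namespace ReinforcementRule

variable {G : SimpleGraph V} [G.LocallyFinite] [DiscreteMeasurableSpace V]
  (r : ReinforcementRule G) (hdeg : ∀ x, ∃ y, G.Adj x y)

open Classical in
/-- The races between the edges adjacent to the current position, with the speeds given by the
rates of the rule `r`. Speeds of runners have to be positive, so other rates are replaced by `1`. -/
def race : RaceScheme G.edgeSet (RaceHistory G) where
  runners n h := incidentEdges G (h.2 n).1
  speed n h e := if (h.2 n).1 ∈ (e : Sym2 V) then (if 0 < r.rate n h e then r.rate n h e else 1)
    else 0
  next n h e s := (h.1, appendJump n h.2 (otherEnd (h.2 n).1 e) s)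
  runners_nonempty n h := by
    obtain ⟨y, hy⟩ := hdeg (h.2 n).1
    exact ⟨⟨s((h.2 n).1, y), G.mem_edgeSet.2 hy⟩, mem_incidentEdges.2 (Sym2.mem_mk_left _ _)⟩
  speed_pos n h e he := by
    rw [if_pos (mem_incidentEdges.1 he)]
    split_ifs with hrate
    exacts [hrate, one_pos]
  speed_eq_zero n h e he := if_neg fun hmem => he (mem_incidentEdges.2 hmem)
  measurable_speed n e := by
    have hposition : Measurable fun h : RaceHistory G => (h.2 n).1 := by fun_prop
    exact Measurable.ite (hposition (MeasurableSet.of_discrete (s := {x | x ∈ (e : Sym2 V)})))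
      (Measurable.ite (measurableSet_lt measurable_const (r.measurable_rate n e))
        (r.measurable_rate n e) measurable_const) measurable_const
  measurable_next n e := by
    have hend : Measurable fun x : V => otherEnd x (e : Sym2 V) := Measurable.of_discrete
    have hjump : Measurable fun p : RaceHistory G × ℝ =>
        (p.1.2, otherEnd (p.1.2 n).1 (e : Sym2 V), p.2) := by fun_prop
    exact (measurable_fst.comp measurable_fst).prodMk ((measurable_appendJump n).comp hjump)

section

variable {n : ℕ} {h : RaceHistory G} {e : G.edgeSet}

lemma race_speed_of_mem (he : (h.2 n).1 ∈ (e : Sym2 V)) (hpos : 0 < r.rate n h e) :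
    (r.race hdeg).speed n h e = r.rate n h e :=
  (if_pos he).trans (if_pos hpos)

lemma race_speed_of_notMem (he : (h.2 n).1 ∉ (e : Sym2 V)) : (r.race hdeg).speed n h e = 0 :=
  if_neg he

lemma mem_race_runners : e ∈ (r.race hdeg).runners n h ↔ (h.2 n).1 ∈ (e : Sym2 V) :=
  mem_incidentEdges

variable (n h)

lemma race_totalSpeed : (r.race hdeg).totalSpeed n h = ∑ y ∈ G.neighborFinset (h.2 n).1,
    pairWeight G ((r.race hdeg).speed n h) (h.2 n).1 y :=
  sum_incidentEdges _ _

end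

variable [Nonempty G.edgeSet] (i₀ : V) (p : (G.edgeSet → ℝ) × (G.edgeSet × ℕ → ℝ))

/-- The state after `n` races of the process which starts at `i₀`, for the weights and the
distances `p`. -/
def state (n : ℕ) : RaceHistory G × (G.edgeSet × ℕ → ℝ) :=
  (r.race hdeg).run ((p.1, fun _ => (i₀, 0)), p.2) n

/-- The successive positions and holding times of the process which starts at `i₀`, for the weights
and the distances `p`. -/
def walk (n : ℕ) : V × ℝ :=
  (((r.state hdeg i₀ p n).1.2 n).1, ((r.state hdeg i₀ p (n + 1)).1.2 n).2)

lemma walk_zero : (r.walk hdeg i₀ p 0).1 = i₀ := rfl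

lemma walk_of_state_succ {n : ℕ} {e : G.edgeSet}
    (h : r.state hdeg i₀ p (n + 1) = (r.race hdeg).stepOf n e (r.state hdeg i₀ p n)) :
    (r.walk hdeg i₀ p (n + 1)).1 = otherEnd (r.walk hdeg i₀ p n).1 e ∧
      (r.walk hdeg i₀ p n).2 = (r.race hdeg).duration n (r.state hdeg i₀ p n) e := by
  have hnext : (r.state hdeg i₀ p (n + 1)).1.2 = appendJump n (r.state hdeg i₀ p n).1.2
      (otherEnd ((r.state hdeg i₀ p n).1.2 n).1 e)
      ((r.race hdeg).duration n (r.state hdeg i₀ p n) e) := by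
    rw [h]
    rfl
  constructor <;> simp [walk, hnext, appendJump]

lemma state_fst (n : ℕ) :
    (r.state hdeg i₀ p n).1 = (p.1, jumpRecord i₀ n (r.walk hdeg i₀ p)) := by
  induction n with
  | zero => rw [jumpRecord_zero i₀ _ (r.walk_zero hdeg i₀ p)]; rfl
  | succ n ih =>
    have hsucc : r.state hdeg i₀ p (n + 1) = (r.race hdeg).stepOf n
      ((r.race hdeg).winner n (r.state hdeg i₀ p n)) (r.state hdeg i₀ p n) := rfl
    obtain ⟨hposition, hholding⟩ := r.walk_of_state_succ hdeg i₀ p hsucc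
    have hweights : (r.state hdeg i₀ p n).1.1 = p.1 := congrArg Prod.fst ih
    have hrecord : (r.state hdeg i₀ p n).1.2 = jumpRecord i₀ n (r.walk hdeg i₀ p) :=
      congrArg Prod.snd ih
    rw [jumpRecord_succ, hposition, hholding, ← hrecord, hsucc]
    exact Prod.ext hweights rfl

variable {i₀ p} in
lemma walk_of_winsAt {n : ℕ} {e : G.edgeSet}
    (h : (r.race hdeg).WinsAt n (r.state hdeg i₀ p n) e) :
    (e : Sym2 V) = s((r.walk hdeg i₀ p n).1, (r.walk hdeg i₀ p (n + 1)).1) ∧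
      (r.walk hdeg i₀ p n).2 = (r.race hdeg).duration n (r.state hdeg i₀ p n) e ∧
      (r.state hdeg i₀ p (n + 1)).2 = remaining ((r.race hdeg).speed n (r.state hdeg i₀ p n).1)
        (r.state hdeg i₀ p n).2 e := by
  have hsucc : r.state hdeg i₀ p (n + 1) = (r.race hdeg).stepOf n e (r.state hdeg i₀ p n) := by
    rw [← h.winner_eq]
    rfl
  obtain ⟨hposition, hholding⟩ := r.walk_of_state_succ hdeg i₀ p hsucc
  refine ⟨?_, hholding, congrArg Prod.snd hsucc⟩
  rw [hposition]
  exact (mk_otherEnd ((r.mem_race_runners hdeg).1 h.1)).symm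

variable {i₀ p} in
lemma isEdgeRace_walk (hp : ∀ n, (∃ e, (r.race hdeg).WinsAt n (r.state hdeg i₀ p n) e) ∧
      ∀ k, 0 < (r.state hdeg i₀ p n).2 k) :
    IsEdgeRace (fun n => (r.race hdeg).speed n (p.1, jumpRecord i₀ n (r.walk hdeg i₀ p)))
      (fun n => (r.state hdeg i₀ p n).2) (fun n => (r.walk hdeg i₀ p n).1)
      (fun n => (r.walk hdeg i₀ p n).2) := by
  intro n
  obtain ⟨⟨e, he⟩, hpos⟩ := hp n
  obtain ⟨hedge, hholding, hremaining⟩ := r.walk_of_winsAt hdeg he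
  have hspeed := (r.race hdeg).speed_pos n _ e he.1
  rw [RaceScheme.duration] at hholding
  simp only [← r.state_fst, hholding, hremaining]
  refine ⟨e, hedge, div_pos (hpos _) hspeed, (mul_div_cancel₀ _ hspeed.ne').symm,
    fun e' hmem hne => ?_, fun m => ?_, fun e' hne => ⟨?_, fun m => ?_⟩⟩
  · have hmem' := (r.mem_race_runners hdeg (h := (r.state hdeg i₀ p n).1)).2 hmem
    have hslower := he.2 e' hmem' hne
    rwa [lt_div_iff₀ ((r.race hdeg).speed_pos n _ e' hmem'), mul_comm] at hslower
  · simp [remaining]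
  · simp [remaining, hne]
  · simp [remaining, hne]

variable [Countable V]

lemma measurable_walk : Measurable (r.walk hdeg i₀) := by
  have hstate (n : ℕ) : Measurable fun p => (r.state hdeg i₀ p n).1.2 :=
    (((r.race hdeg).measurable_run n).comp
      (f := fun p : (G.edgeSet → ℝ) × (G.edgeSet × ℕ → ℝ) => ((p.1, fun _ => (i₀, 0)), p.2))
        (by fun_prop)).fst.snd
  exact measurable_pi_lambda _ fun n => ((measurable_pi_apply n).comp (hstate n)).fst.prodMk
    ((measurable_pi_apply n).comp (hstate (n + 1))).snd

variable (ν : Measure (G.edgeSet → ℝ)) [SFinite ν]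

lemma ae_state_winsAt_and_pos : ∀ᵐ p ∂ν.prod (expField (G.edgeSet × ℕ)), ∀ n,
    (∃ e, (r.race hdeg).WinsAt n (r.state hdeg i₀ p n) e) ∧
      ∀ k, 0 < (r.state hdeg i₀ p n).2 k := by
  have hstart : Measurable fun θ : G.edgeSet → ℝ => (θ, fun _ : ℕ => (i₀, (0 : ℝ))) := by fun_prop
  have hprod := Measure.map_prod_map ν (expField (G.edgeSet × ℕ)) hstart measurable_id
  rw [Measure.map_id] at hprod
  have hrun := (r.race hdeg).ae_run_winsAt_and_pos (ν.map fun θ => (θ, fun _ => (i₀, 0)))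
  rw [hprod] at hrun
  exact ae_of_ae_map (hstart.prodMap measurable_id).aemeasurable hrun

lemma ae_isEdgeRace_walk : ∀ᵐ p ∂ν.prod (expField (G.edgeSet × ℕ)),
    IsEdgeRace (fun n => (r.race hdeg).speed n (p.1, jumpRecord i₀ n (r.walk hdeg i₀ p)))
      (fun n => (r.state hdeg i₀ p n).2) (fun n => (r.walk hdeg i₀ p n).1)
      (fun n => (r.walk hdeg i₀ p n).2) :=
  (r.ae_state_winsAt_and_pos hdeg i₀ ν).mono fun _ hp => r.isEdgeRace_walk hdeg hp

end ReinforcementRule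

end Walk

section WalkLaw

variable {V : Type*} [MeasurableSpace V]

namespace ReinforcementRule

variable {G : SimpleGraph V} [G.LocallyFinite] [DiscreteMeasurableSpace V]
  (r : ReinforcementRule G) (hdeg : ∀ x, ∃ y, G.Adj x y)

/-- The probability, given the history `h` of the first `n` races, that the next race takes longer
than `s` and leads to `j`. -/
def jumpProb (n : ℕ) (h : RaceHistory G) (j : V) (s : ℝ) : ℝ :=
  pairWeight G ((r.race hdeg).speed n h) (h.2 n).1 j / (r.race hdeg).totalSpeed n h *
    Real.exp (-(r.race hdeg).totalSpeed n h * s)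

section

variable (n : ℕ) (h : RaceHistory G)

lemma jumpProb_nonneg (j : V) (s : ℝ) : 0 ≤ r.jumpProb hdeg n h j s := by
  have hrate := pairWeight_nonneg ((r.race hdeg).speed_nonneg n h) (h.2 n).1 j
  have htotal := (r.race hdeg).totalSpeed_pos n h
  rw [jumpProb]
  positivity

variable {n h} in
lemma jumpProb_of_position_eq {x : V} (hx : (h.2 n).1 = x) (j : V) (s : ℝ) :
    r.jumpProb hdeg n h j s = pairWeight G ((r.race hdeg).speed n h) x j /
        (∑ y ∈ G.neighborFinset x, pairWeight G ((r.race hdeg).speed n h) x y) *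
      Real.exp (-(∑ y ∈ G.neighborFinset x, pairWeight G ((r.race hdeg).speed n h) x y) * s) := by
  subst hx
  rw [jumpProb, race_totalSpeed]

lemma tsum_jumpProb : ∑' j, ENNReal.ofReal (r.jumpProb hdeg n h j 0) = 1 := by
  have hsupport : ∀ j ∉ G.neighborFinset (h.2 n).1,
      ENNReal.ofReal (r.jumpProb hdeg n h j 0) = 0 := by
    intro j hj
    rw [SimpleGraph.mem_neighborFinset] at hj
    rw [jumpProb, pairWeight_of_not_adj hj, zero_div, zero_mul, ENNReal.ofReal_zero]
  rw [tsum_eq_sum hsupport,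
    ← ENNReal.ofReal_sum_of_nonneg fun j _ => r.jumpProb_nonneg hdeg n h j 0]
  simp only [jumpProb, mul_zero, Real.exp_zero, mul_one, ← Finset.sum_div]
  rw [← race_totalSpeed, div_self ((r.race hdeg).totalSpeed_pos n h).ne', ENNReal.ofReal_one]

lemma measurable_jumpProb [Countable V] (j : V) (s : ℝ) :
    Measurable fun h => r.jumpProb hdeg n h j s := by
  have hrate : Measurable fun h : RaceHistory G =>
      pairWeight G ((r.race hdeg).speed n h) (h.2 n).1 j :=
    measurable_apply_of_countable (e := fun h : RaceHistory G => (h.2 n).1)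
      (f := fun x h => pairWeight G ((r.race hdeg).speed n h) x j)
      (fun x => measurable_snd (measurableSet_position_eq n x))
      fun x => measurable_pairWeight ((r.race hdeg).measurable_speed n) x j
  have htotal := (r.race hdeg).measurable_totalSpeed n
  exact (hrate.div htotal).mul (Real.measurable_exp.comp (htotal.neg.mul_const s))

end

variable [Countable V] [Nonempty G.edgeSet] (i₀ : V) (θ : G.edgeSet → ℝ)

lemma measurable_walk_mk : Measurable fun σ => r.walk hdeg i₀ (θ, σ) :=
  (r.measurable_walk hdeg i₀).comp measurable_prodMk_left

/-- The law of the walk driven by independent standard exponential variables, as a function of the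
weights. -/
def kernel : Kernel (G.edgeSet → ℝ) (ℕ → V × ℝ) :=
  (Kernel.id ×ₖ Kernel.const _ (expField (G.edgeSet × ℕ))).map (r.walk hdeg i₀)

instance isMarkovKernel_kernel : IsMarkovKernel (r.kernel hdeg i₀) :=
  Kernel.IsMarkovKernel.map _ (r.measurable_walk hdeg i₀)

lemma kernel_apply : r.kernel hdeg i₀ θ =
    (expField (G.edgeSet × ℕ)).map fun σ => r.walk hdeg i₀ (θ, σ) := by
  have hwalk := r.measurable_walk hdeg i₀
  rw [kernel, Kernel.map_apply _ hwalk, Kernel.prod_apply, Kernel.id_apply, Kernel.const_apply,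
    Measure.dirac_prod, Measure.map_map hwalk measurable_prodMk_left]
  rfl

lemma map_walk (ν : Measure (G.edgeSet → ℝ)) [SFinite ν] :
    (ν.prod (expField (G.edgeSet × ℕ))).map (fun p => (p.1, r.walk hdeg i₀ p)) =
      ν ⊗ₘ r.kernel hdeg i₀ := by
  have hwalk := r.measurable_walk hdeg i₀
  refine Measure.ext_of_lintegral _ fun g hg => ?_
  have hcomp : Measurable fun p => g (p.1, r.walk hdeg i₀ p) := by fun_prop
  rw [lintegral_map hg (by fun_prop), lintegral_prod _ hcomp.aemeasurable,
    Measure.lintegral_compProd hg]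
  refine lintegral_congr fun θ => ?_
  have hsection : Measurable fun z => g (θ, z) := by fun_prop
  rw [kernel_apply, lintegral_map hsection (r.measurable_walk_mk hdeg i₀ θ)]

lemma ae_kernel_holding_pos : ∀ᵐ z ∂r.kernel hdeg i₀ θ, ∀ n, 0 < (z n).2 := by
  have hpos : MeasurableSet {z : ℕ → V × ℝ | ∀ n, 0 < (z n).2} := by
    simp only [Set.ofPred_forall]
    exact MeasurableSet.iInter fun n => measurableSet_lt measurable_const (by fun_prop)
  have hrace := r.ae_isEdgeRace_walk hdeg i₀ (Measure.dirac θ)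
  rw [Measure.dirac_prod] at hrace
  rw [kernel_apply, ae_map_iff (r.measurable_walk_mk hdeg i₀ θ).aemeasurable hpos]
  filter_upwards [ae_of_ae_map measurable_prodMk_left.aemeasurable hrace] with σ hσ
  exact hσ.holding_pos

variable (n : ℕ)

lemma expField_walk_winsAt (e : G.edgeSet) {s : ℝ} (hs : 0 ≤ s) {A : Set (ℕ → V × ℝ)}
    (hA : MeasurableSet A) :
    expField (G.edgeSet × ℕ) {σ | jumpRecord i₀ n (r.walk hdeg i₀ (θ, σ)) ∈ A ∧
        (r.race hdeg).WinsAt n (r.state hdeg i₀ (θ, σ) n) e ∧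
        s < (r.race hdeg).duration n (r.state hdeg i₀ (θ, σ) n) e} =
      ∫⁻ z in A, ENNReal.ofReal ((r.race hdeg).speed n (θ, z) e /
          (r.race hdeg).totalSpeed n (θ, z) * Real.exp (-(r.race hdeg).totalSpeed n (θ, z) * s))
        ∂(r.kernel hdeg i₀ θ).map (jumpRecord i₀ n) := by
  have hrun := (r.race hdeg).expField_run_winsAt n e (θ, fun _ => (i₀, 0)) hs (measurable_snd hA)
  have hwalk := r.measurable_walk_mk hdeg i₀ θ
  have hrecord := measurable_jumpRecord i₀ n
  have hmap : ((expField (G.edgeSet × ℕ)).map fun σ =>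
      ((r.race hdeg).run ((θ, fun _ => (i₀, 0)), σ) n).1) =
        ((r.kernel hdeg i₀ θ).map (jumpRecord i₀ n)).map (Prod.mk θ) := by
    rw [kernel_apply, Measure.map_map hrecord hwalk, Measure.map_map measurable_prodMk_left
      (hrecord.comp hwalk)]
    exact congrArg (Measure.map · _) (funext fun σ => r.state_fst hdeg i₀ (θ, σ) n)
  have hspeed := (r.race hdeg).measurable_speed n e
  have htotal := (r.race hdeg).measurable_totalSpeed n
  rw [hmap, setLIntegral_map (measurable_snd hA) (by fun_prop) measurable_prodMk_left] at hrun
  rw [← Set.preimage_comp] at hrun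
  refine Eq.trans (congrArg _ (Set.ext fun σ => and_congr_left' ?_)) hrun
  change _ ↔ (r.state hdeg i₀ (θ, σ) n).1.2 ∈ A
  rw [r.state_fst]

variable {n} in
lemma ae_walk_jump_iff (j : V) (s : ℝ) : ∀ᵐ σ ∂expField (G.edgeSet × ℕ),
    (s < (r.walk hdeg i₀ (θ, σ) n).2 ∧ (r.walk hdeg i₀ (θ, σ) (n + 1)).1 = j) ↔
      ∃ e : G.edgeSet, (e : Sym2 V) = s((r.walk hdeg i₀ (θ, σ) n).1, j) ∧
        (r.race hdeg).WinsAt n (r.state hdeg i₀ (θ, σ) n) e ∧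
        s < (r.race hdeg).duration n (r.state hdeg i₀ (θ, σ) n) e := by
  have hwins := r.ae_state_winsAt_and_pos hdeg i₀ (Measure.dirac θ)
  rw [Measure.dirac_prod] at hwins
  filter_upwards [ae_of_ae_map measurable_prodMk_left.aemeasurable hwins] with σ hσ
  obtain ⟨e, he⟩ := (hσ n).1
  obtain ⟨hedge, hholding, -⟩ := r.walk_of_winsAt hdeg he
  constructor
  · rintro ⟨hs, rfl⟩
    exact ⟨e, hedge, he, hholding ▸ hs⟩
  · rintro ⟨e', hedge', he', hs⟩
    obtain rfl := he.unique he'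
    exact ⟨hholding ▸ hs, Sym2.congr_right.1 (hedge.symm.trans hedge')⟩

variable {n} in
lemma expField_walk_jump {s : ℝ} (hs : 0 ≤ s) {A : Set (ℕ → V × ℝ)} (hA : MeasurableSet A) {x : V}
    (hx : ∀ z ∈ A, (z n).1 = x) (j : V) :
    expField (G.edgeSet × ℕ) {σ | jumpRecord i₀ n (r.walk hdeg i₀ (θ, σ)) ∈ A ∧
        s < (r.walk hdeg i₀ (θ, σ) n).2 ∧ (r.walk hdeg i₀ (θ, σ) (n + 1)).1 = j} =
      ∫⁻ z in A, ENNReal.ofReal (r.jumpProb hdeg n (θ, z) j s)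
        ∂(r.kernel hdeg i₀ θ).map (jumpRecord i₀ n) := by
  have hposition {z : ℕ → V × ℝ} (hz : jumpRecord i₀ n z ∈ A) : (z n).1 = x := by
    rw [← hx _ hz, jumpRecord_apply_fst i₀ z le_rfl]
  by_cases hadj : G.Adj x j
  · let e : G.edgeSet := ⟨s(x, j), G.mem_edgeSet.2 hadj⟩
    have hprob : ∀ z ∈ A, r.jumpProb hdeg n (θ, z) j s = (r.race hdeg).speed n (θ, z) e /
        (r.race hdeg).totalSpeed n (θ, z) * Real.exp (-(r.race hdeg).totalSpeed n (θ, z) * s) :=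
      fun z hz => by rw [jumpProb, pairWeight_of_eq (e := e) (by rw [hx z hz])]
    rw [setLIntegral_congr_fun hA fun z hz => by rw [hprob z hz],
      ← r.expField_walk_winsAt hdeg i₀ θ n e hs hA]
    refine measure_congr ?_
    filter_upwards [r.ae_walk_jump_iff hdeg i₀ θ j s] with σ hσ
    refine propext (and_congr_right fun hmem => hσ.trans ?_)
    rw [hposition hmem]
    exact ⟨fun ⟨e', he', h⟩ => Subtype.ext (a1 := e') (a2 := e) he' ▸ h, fun h => ⟨e, rfl, h⟩⟩
  · have hzero : ∀ z ∈ A, ENNReal.ofReal (r.jumpProb hdeg n (θ, z) j s) = 0 := fun z hz => by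
      rw [jumpProb, pairWeight_of_not_adj (by rwa [hx z hz]), zero_div, zero_mul,
        ENNReal.ofReal_zero]
    rw [setLIntegral_congr_fun (g := 0) hA hzero, Pi.zero_def, lintegral_zero]
    refine measure_eq_zero_iff_ae_notMem.2 ?_
    filter_upwards [r.ae_walk_jump_iff hdeg i₀ θ j s] with σ hσ ⟨hmem, hjump⟩
    obtain ⟨e, he, -⟩ := hσ.1 hjump
    rw [hposition hmem] at he
    exact hadj (G.mem_edgeSet.1 (he ▸ e.2))

lemma hasJumpLaw_kernel :
    HasJumpLaw i₀ (fun n z => r.jumpProb hdeg n (θ, z)) (r.kernel hdeg i₀ θ) := by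
  have hwalk := r.measurable_walk_mk hdeg i₀ θ
  rw [kernel_apply]
  refine ⟨(ae_map_iff hwalk.aemeasurable (measurableSet_position_eq 0 i₀)).2
    (Filter.Eventually.of_forall fun σ => r.walk_zero hdeg i₀ _), fun n j s hs => ?_⟩
  have hrecord := measurable_jumpRecord i₀ n
  refine (Measure.ext_iff_of_iUnion_eq_univ (s := fun x : V => {z : ℕ → V × ℝ | (z n).1 = x})
    (Set.iUnion_eq_univ_iff.2 fun z => ⟨_, rfl⟩)).2 fun x => Measure.ext fun A hA => ?_
  have hAx := hA.inter (measurableSet_position_eq n x)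
  rw [Measure.restrict_apply hA, Measure.restrict_apply hA, withDensity_apply _ hAx,
    ← kernel_apply, ← r.expField_walk_jump hdeg i₀ θ hs hAx (fun z hz => hz.2), kernel_apply,
    Measure.map_apply hrecord hAx,
    Measure.restrict_apply (hrecord hAx),
    Measure.map_apply hwalk ((hrecord hAx).inter (measurableSet_jump n j s))]
  rfl

end ReinforcementRule

end WalkLaw

section Conditioning

variable {Ω β : Type*} [MeasurableSpace Ω] [MeasurableSpace β]

lemma condExp_comap_ae_eq_iff {P : Measure Ω} [IsFiniteMeasure P] {T : Ω → β} (hT : Measurable T)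
    {A : Set Ω} (hA : MeasurableSet A) {f : β → ℝ} (hf : Measurable f) (hf0 : ∀ b, 0 ≤ f b) :
    (P⟦A | MeasurableSpace.comap T inferInstance⟧ =ᵐ[P] fun ω => f (T ω)) ↔
      (P.restrict A).map T = (P.map T).withDensity fun b => ENNReal.ofReal (f b) := by
  have hindicator : Integrable (A.indicator fun _ => (1 : ℝ)) P := (integrable_const 1).indicator hA
  have hrestrict {B : Set β} (hB : MeasurableSet B) :
      (P.restrict A).map T B = P (T ⁻¹' B ∩ A) := by
    rw [Measure.map_apply hT hB, Measure.restrict_apply (hT hB)]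
  have hdensity {B : Set β} (hB : MeasurableSet B) :
      (P.map T).withDensity (fun b => ENNReal.ofReal (f b)) B =
        ∫⁻ ω in T ⁻¹' B, ENNReal.ofReal (f (T ω)) ∂P := by
    rw [withDensity_apply _ hB, setLIntegral_map hB hf.ennreal_ofReal hT]
  constructor
  · intro h
    refine Measure.ext fun B hB => ?_
    have hint : Integrable (fun ω => f (T ω)) P := integrable_condExp.congr h
    rw [hrestrict hB, hdensity hB, ← ofReal_integral_eq_lintegral_ofReal hint.integrableOn
      (Filter.Eventually.of_forall fun ω => hf0 _), ← integral_congr_ae (ae_restrict_of_ae h),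
      setIntegral_condExp hT.comap_le hindicator ⟨B, hB, rfl⟩, setIntegral_indicator hA]
    simp
  · intro h
    have hmass {B : Set β} (hB : MeasurableSet B) :
        ∫⁻ ω in T ⁻¹' B, ENNReal.ofReal (f (T ω)) ∂P = P (T ⁻¹' B ∩ A) := by
      rw [← hdensity hB, ← h, hrestrict hB]
    have hint : Integrable (fun ω => f (T ω)) P := by
      refine ⟨(hf.comp hT).aestronglyMeasurable, ?_⟩
      rw [hasFiniteIntegral_iff_ofReal (Filter.Eventually.of_forall fun ω => hf0 _),
        ← setLIntegral_univ, ← Set.preimage_univ (f := T), hmass MeasurableSet.univ]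
      exact measure_lt_top _ _
    refine (ae_eq_condExp_of_forall_setIntegral_eq hT.comap_le hindicator
      (fun B _ _ => hint.integrableOn) ?_
      (hf.comp (comap_measurable T)).stronglyMeasurable.aestronglyMeasurable).symm
    rintro _ ⟨B, hB, rfl⟩ -
    rw [setIntegral_indicator hA, integral_eq_lintegral_of_nonneg_ae
      (Filter.Eventually.of_forall fun ω => hf0 _) (hf.comp hT).aestronglyMeasurable, hmass hB]
    simp [Measure.real]

end Conditioning

section Past

variable {Ω V : Type*} [MeasurableSpace V] (i₀ : V) (n : ℕ)

lemma jumpPast_eq_comap (ξ : ℕ → Ω → V) (S : ℕ → Ω → ℝ) : jumpPast ξ S n =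
    MeasurableSpace.comap (fun ω => jumpRecord i₀ n fun k => (ξ k ω, S k ω)) inferInstance := by
  apply le_antisymm
  · have hφ : Measurable fun z : ℕ → V × ℝ =>
        ((fun k : Fin (n + 1) => (z k).1), fun k : Fin n => (z k).2) := by fun_prop
    refine (congrArg (MeasurableSpace.comap · inferInstance) (funext fun ω => ?_)).trans_le
      (hφ.comp (comap_measurable fun ω => jumpRecord i₀ n fun k => (ξ k ω, S k ω))).comap_le
    refine Prod.ext (funext fun k => ?_) (funext fun k => ?_)
    · exact (jumpRecord_apply_fst i₀ (fun k => (ξ k ω, S k ω)) (Nat.lt_succ_iff.1 k.2)).symm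
    · exact (congrArg Prod.snd
        (jumpRecord_apply_of_lt i₀ (fun k => (ξ k ω, S k ω)) k.2)).symm
  · have hψ : Measurable fun (p : (Fin (n + 1) → V) × (Fin n → ℝ)) (k : ℕ) =>
        if h : k < n then (p.1 ⟨k, h.trans n.lt_succ_self⟩, p.2 ⟨k, h⟩)
        else if k = n then (p.1 (Fin.last n), 0) else (i₀, 0) := by
      refine measurable_pi_lambda _ fun k => ?_
      split_ifs <;> fun_prop
    exact (hψ.comp (comap_measurable fun ω =>
      ((fun k : Fin (n + 1) => ξ k ω), fun k : Fin n => S k ω))).comap_le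

lemma chainPast_eq_comap (X : ℕ → Ω → V) : chainPast X n =
    MeasurableSpace.comap (fun ω => stepRecord i₀ n fun k => X k ω) inferInstance := by
  apply le_antisymm
  · have hφ : Measurable fun (x : ℕ → V) (k : Fin (n + 1)) => x k := by fun_prop
    refine (congrArg (MeasurableSpace.comap · inferInstance) (funext₂ fun ω k => ?_)).trans_le
      (hφ.comp (comap_measurable fun ω => stepRecord i₀ n fun k => X k ω)).comap_le
    exact (stepRecord_apply i₀ (fun k => X k ω) (Nat.lt_succ_iff.1 k.2)).symm
  · have hψ : Measurable fun (p : Fin (n + 1) → V) (k : ℕ) =>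
        if h : k ≤ n then p ⟨k, Nat.lt_succ_of_le h⟩ else i₀ := by
      refine measurable_pi_lambda _ fun k => ?_
      split_ifs <;> fun_prop
    exact (hψ.comp (comap_measurable fun ω (k : Fin (n + 1)) => X k ω)).comap_le

end Past

/-! ### The vertex-reinforced jump process -/

lemma occupation_congr {V : Type*} {ξ ξ' : ℕ → V} {S S' : ℕ → ℝ} {n : ℕ}
    (hξ : ∀ k < n, ξ k = ξ' k) (hS : ∀ k < n, S k = S' k) (x : V) :
    occupation ξ S x n = occupation ξ' S' x n := by
  refine Finset.sum_congr rfl fun k hk => ?_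
  have hkn := Finset.mem_range.1 hk
  rw [hξ k hkn, hS k hkn]

section VertexReinforced

variable {V : Type*} [MeasurableSpace V] [DiscreteMeasurableSpace V]

lemma measurable_occupation (x : V) (n : ℕ) : Measurable fun z : ℕ → V × ℝ =>
    occupation (fun k => (z k).1) (fun k => (z k).2) x n := by
  refine Finset.measurable_sum _ fun k _ => ?_
  exact Measurable.ite (measurableSet_position_eq k x) (by fun_prop) measurable_const

variable [Countable V] {G : SimpleGraph V}

variable (G) in
/-- The rule of the vertex-reinforced jump process, which crosses the edge `{x, y}` from `x` at the
rate given by the weight of the edge times 1 plus the time spent at `y`. -/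
def vertexReinforced : ReinforcementRule G where
  rate n h e :=
    h.1 e * (1 + occupation (fun k => (h.2 k).1) (fun k => (h.2 k).2) (otherEnd (h.2 n).1 e) n)
  measurable_rate n e :=
    measurable_apply_of_countable (e := fun h : RaceHistory G => (h.2 n).1)
      (f := fun x h => h.1 e *
        (1 + occupation (fun k => (h.2 k).1) (fun k => (h.2 k).2) (otherEnd x e) n))
      (fun x => measurable_snd (measurableSet_position_eq n x)) fun x =>
      ((measurable_pi_apply e).comp measurable_fst).mul
        (((measurable_occupation (otherEnd x e) n).comp measurable_snd).const_add 1)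

section

variable [G.LocallyFinite] (hdeg : ∀ x, ∃ y, G.Adj x y) (i₀ : V) {w : G.edgeSet → ℝ}
  (hw : ∀ e, 0 < w e) {n : ℕ} {z : ℕ → V × ℝ} (hz : ∀ k < n, 0 < (z k).2)

include hw hz

lemma vertexReinforced_speed {e : G.edgeSet} {y : V} (he : (e : Sym2 V) = s((z n).1, y)) :
    ((vertexReinforced G).race hdeg).speed n (w, jumpRecord i₀ n z) e =
      w e * (1 + occupation (fun k => (z k).1) (fun k => (z k).2) y n) := by
  have hposition : (jumpRecord i₀ n z n).1 = (z n).1 := jumpRecord_apply_fst i₀ z le_rfl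
  have hrate : (vertexReinforced G).rate n (w, jumpRecord i₀ n z) e =
      w e * (1 + occupation (fun k => (z k).1) (fun k => (z k).2) y n) := by
    simp only [vertexReinforced, hposition, he, otherEnd_mk]
    rw [occupation_congr (fun k hk => congrArg Prod.fst (jumpRecord_apply_of_lt i₀ z hk))
      fun k hk => congrArg Prod.snd (jumpRecord_apply_of_lt i₀ z hk)]
  rw [← hrate]
  refine ReinforcementRule.race_speed_of_mem _ hdeg ?_ ?_
  · rw [hposition, he]
    exact Sym2.mem_mk_left _ _
  · rw [hrate]
    exact mul_pos (hw e) (one_add_occupation_pos hz)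

lemma vrjpRate_eq_pairWeight (j : V) :
    vrjpRate G w (fun k => (z k).1) (fun k => (z k).2) n j =
      pairWeight G (((vertexReinforced G).race hdeg).speed n (w, jumpRecord i₀ n z)) (z n).1 j := by
  rw [vrjpRate, localTime_jumpPath_jumpTime hz]
  by_cases hadj : G.Adj (z n).1 j
  · let e : G.edgeSet := ⟨s((z n).1, j), G.mem_edgeSet.2 hadj⟩
    rw [pairWeight_of_eq (e := e) rfl, pairWeight_of_eq (e := e) rfl,
      vertexReinforced_speed hdeg i₀ hw hz rfl]
  · rw [pairWeight_of_not_adj hadj, pairWeight_of_not_adj hadj, zero_mul]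

lemma vertexReinforced_jumpProb (j : V) (s : ℝ) :
    (vertexReinforced G).jumpProb hdeg n (w, jumpRecord i₀ n z) j s =
      vrjpRate G w (fun k => (z k).1) (fun k => (z k).2) n j /
          vrjpTotalRate G w (fun k => (z k).1) (fun k => (z k).2) n *
        Real.exp (-(vrjpTotalRate G w (fun k => (z k).1) (fun k => (z k).2) n * s)) := by
  rw [(vertexReinforced G).jumpProb_of_position_eq hdeg (jumpRecord_apply_fst i₀ z le_rfl),
    vrjpTotalRate, neg_mul]
  simp only [vrjpRate_eq_pairWeight hdeg i₀ hw hz]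

end

variable [G.LocallyFinite] (hdeg : ∀ x, ∃ y, G.Adj x y) {i₀ : V}

section

variable {w : G.edgeSet → ℝ} (hw : ∀ e, 0 < w e) {Q : Measure (ℕ → V × ℝ)} [IsProbabilityMeasure Q]

include hdeg hw

lemma vertexReinforced_condExp_jump_iff {n : ℕ} (hpos : ∀ᵐ z ∂Q, ∀ k < n, 0 < (z k).2) (j : V)
    (s : ℝ) :
    Q⟦{z | s < (z n).2 ∧ (z (n + 1)).1 = j} |
        jumpPast (fun n (z : ℕ → V × ℝ) => (z n).1) (fun n z => (z n).2) n⟧ =ᵐ[Q] (fun z =>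
      vrjpRate G w (fun k => (z k).1) (fun k => (z k).2) n j /
          vrjpTotalRate G w (fun k => (z k).1) (fun k => (z k).2) n *
        Real.exp (-(vrjpTotalRate G w (fun k => (z k).1) (fun k => (z k).2) n * s))) ↔
    (Q.restrict {z | s < (z n).2 ∧ (z (n + 1)).1 = j}).map (jumpRecord i₀ n) =
      (Q.map (jumpRecord i₀ n)).withDensity
        fun z => ENNReal.ofReal ((vertexReinforced G).jumpProb hdeg n (w, z) j s) := by
  have hprob := hpos.mono fun z hz => vertexReinforced_jumpProb hdeg i₀ hw hz j s
  have hmeas : Measurable fun z => (vertexReinforced G).jumpProb hdeg n (w, z) j s :=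
    ((vertexReinforced G).measurable_jumpProb hdeg n j s).comp measurable_prodMk_left
  rw [jumpPast_eq_comap i₀, ← condExp_comap_ae_eq_iff (measurable_jumpRecord i₀ n)
    (measurableSet_jump n j s) hmeas
    fun z => (vertexReinforced G).jumpProb_nonneg hdeg n (w, z) j s]
  exact ⟨fun h => h.trans (Filter.EventuallyEq.symm hprob), fun h => h.trans hprob⟩

lemma IsVRJP.ae_holding_pos (h : IsVRJP G w i₀ Q (fun n z => (z n).1) fun n z => (z n).2) :
    ∀ᵐ z ∂Q, ∀ n, 0 < (z n).2 := by
  refine ae_all_iff.2 fun n => ?_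
  induction n using Nat.strong_induction_on with
  | _ n ih =>
    have hpast : ∀ᵐ z ∂Q, ∀ k < n, 0 < (z k).2 := (Set.finite_lt_nat n).eventually_all.2 ih
    have hmeas (j : V) : Measurable fun z => (vertexReinforced G).jumpProb hdeg n (w, z) j 0 :=
      ((vertexReinforced G).measurable_jumpProb hdeg n j 0).comp measurable_prodMk_left
    have hdisjoint : Pairwise (Function.onFun Disjoint fun j : V =>
        {z : ℕ → V × ℝ | 0 < (z n).2 ∧ (z (n + 1)).1 = j}) := fun j j' hj =>
      Set.disjoint_left.2 fun z hz hz' => hj (hz.2.symm.trans hz'.2)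
    exact (ae_exists_mem_of_map_restrict_eq (measurable_jumpRecord i₀ n)
      (fun j => measurableSet_jump n j 0) hdisjoint (fun j => (hmeas j).ennreal_ofReal)
      (fun z => (vertexReinforced G).tsum_jumpProb hdeg n (w, z)) fun j =>
      (vertexReinforced_condExp_jump_iff hdeg hw hpast j 0).1 (h.jump n j 0 le_rfl)).mono
      fun z ⟨_, hz⟩ => hz.1

lemma IsVRJP.hasJumpLaw (h : IsVRJP G w i₀ Q (fun n z => (z n).1) fun n z => (z n).2) :
    HasJumpLaw i₀ (fun n z => (vertexReinforced G).jumpProb hdeg n (w, z)) Q :=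
  ⟨h.start, fun n j s hs => (vertexReinforced_condExp_jump_iff hdeg hw
    ((h.ae_holding_pos hdeg hw).mono fun _ hz k _ => hz k) j s).1 (h.jump n j s hs)⟩

end

variable [Nonempty G.edgeSet]

variable (i₀) in
lemma isVRJPKernel_vertexReinforced : IsVRJPKernel G i₀ ((vertexReinforced G).kernel hdeg i₀) := by
  refine ⟨inferInstance, fun w hw => ?_⟩
  have hlaw := (vertexReinforced G).hasJumpLaw_kernel hdeg i₀ w
  have hpos := (vertexReinforced G).ae_kernel_holding_pos hdeg i₀ w
  exact ⟨fun n => by fun_prop, fun n => by fun_prop, hlaw.start, fun n j s hs =>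
    (vertexReinforced_condExp_jump_iff hdeg hw (hpos.mono fun _ hz k _ => hz k) j s).2
      (hlaw.jump n j s hs)⟩

lemma IsVRJPKernel.apply_eq {κ : Kernel (G.edgeSet → ℝ) (ℕ → V × ℝ)} (hκ : IsVRJPKernel G i₀ κ)
    {w : G.edgeSet → ℝ} (hw : ∀ e, 0 < w e) :
    κ w = (vertexReinforced G).kernel hdeg i₀ w := by
  have hmarkov := hκ.1
  have hvrjp := hκ.2 w hw
  exact (hvrjp.hasJumpLaw hdeg hw).unique ((vertexReinforced G).hasJumpLaw_kernel hdeg i₀ w)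
    (hvrjp.ae_holding_pos hdeg hw) ((vertexReinforced G).ae_kernel_holding_pos hdeg i₀ w)

end VertexReinforced

/-! ### The edge-reinforced random walk -/

section StepProbability

variable {V : Type*} {G : SimpleGraph V}

lemma reinforcedWeight_eq_add_crossings (a : G.edgeSet → ℝ) (x : ℕ → V) (n : ℕ) (e : G.edgeSet) :
    reinforcedWeight G a x n e = a e + crossings x e n := by
  rw [reinforcedWeight, crossings]
  push_cast
  rfl

lemma reinforcedWeight_congr (a : G.edgeSet → ℝ) {x x' : ℕ → V} {n : ℕ}
    (h : ∀ k ≤ n, x k = x' k) : reinforcedWeight G a x n = reinforcedWeight G a x' n := by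
  funext e
  rw [reinforcedWeight_eq_add_crossings, reinforcedWeight_eq_add_crossings, crossings_congr h]

lemma reinforcedWeight_pos {a : G.edgeSet → ℝ} (ha : ∀ e, 0 < a e) (x : ℕ → V) (n : ℕ)
    (e : G.edgeSet) : 0 < reinforcedWeight G a x n e := by
  rw [reinforcedWeight_eq_add_crossings]
  exact add_pos_of_pos_of_nonneg (ha e) (Nat.cast_nonneg _)

lemma measurable_crossings [MeasurableSpace V] [DiscreteMeasurableSpace V] [Countable V]
    (e : Sym2 V) (n : ℕ) : Measurable fun x : ℕ → V => crossings x e n := by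
  refine Finset.measurable_sum _ fun k _ => ?_
  have hstep : Measurable fun x : ℕ → V => (x k, x (k + 1)) := by fun_prop
  have hcross : MeasurableSet {x : ℕ → V | s(x k, x (k + 1)) = e} :=
    hstep (MeasurableSet.of_discrete (s := {q : V × V | s(q.1, q.2) = e}))
  exact Measurable.ite hcross measurable_const measurable_const

lemma measurable_reinforcedWeight [MeasurableSpace V] [DiscreteMeasurableSpace V] [Countable V]
    (a : G.edgeSet → ℝ) (n : ℕ) (e : G.edgeSet) :
    Measurable fun x => reinforcedWeight G a x n e := by
  simp only [reinforcedWeight_eq_add_crossings]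
  exact (measurable_from_top.comp (measurable_crossings (e : Sym2 V) n)).const_add _

variable [G.LocallyFinite]

/-- The conditional probability that the edge-reinforced random walk with weights `a` and
trajectory `x` is at `j` at time `n + 1`, given its positions up to time `n`. -/
def stepProb (a : G.edgeSet → ℝ) (n : ℕ) (x : ℕ → V) (j : V) : ℝ :=
  pairWeight G (reinforcedWeight G a x n) (x n) j /
    ∑ k ∈ G.neighborFinset (x n), pairWeight G (reinforcedWeight G a x n) (x n) k

lemma stepProb_nonneg {a : G.edgeSet → ℝ} (ha : ∀ e, 0 < a e) (n : ℕ) (x : ℕ → V) (j : V) :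
    0 ≤ stepProb a n x j := by
  have hweight := pairWeight_nonneg (fun e => (reinforcedWeight_pos ha x n e).le) (x n)
  exact div_nonneg (hweight j) (Finset.sum_nonneg fun k _ => hweight k)

lemma stepProb_stepRecord (i₀ : V) (a : G.edgeSet → ℝ) (n : ℕ) (x : ℕ → V) (j : V) :
    stepProb a n (stepRecord i₀ n x) j = stepProb a n x j := by
  rw [stepProb, stepProb, reinforcedWeight_congr a fun k hk => stepRecord_apply i₀ x hk,
    stepRecord_apply i₀ x le_rfl]

variable [MeasurableSpace V] [DiscreteMeasurableSpace V] [Countable V]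

lemma measurable_stepProb (a : G.edgeSet → ℝ) (n : ℕ) (j : V) :
    Measurable fun x => stepProb a n x j := by
  have hweight (y k : V) : Measurable fun x => pairWeight G (reinforcedWeight G a x n) y k :=
    measurable_pairWeight (measurable_reinforcedWeight a n) y k
  exact measurable_apply_of_countable (e := fun x : ℕ → V => x n)
    (f := fun y x => pairWeight G (reinforcedWeight G a x n) y j /
      ∑ k ∈ G.neighborFinset y, pairWeight G (reinforcedWeight G a x n) y k)
    (measurableSet_apply_eq n) fun y =>
    (hweight y j).div (Finset.measurable_sum _ fun k _ => hweight y k)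

lemma IsERRW.hasStepLaw {a : G.edgeSet → ℝ} (ha : ∀ e, 0 < a e) {i₀ : V} {Ω : Type*}
    [MeasurableSpace Ω] {P : Measure Ω} [IsFiniteMeasure P] {X : ℕ → Ω → V}
    (h : IsERRW G a i₀ P X) : HasStepLaw i₀ (stepProb a) (P.map fun ω n => X n ω) := by
  have hX : Measurable fun ω n => X n ω := measurable_pi_lambda _ h.measurable
  refine ⟨(ae_map_iff hX.aemeasurable (measurableSet_apply_eq 0 i₀)).2 h.start, fun n j => ?_⟩
  have hrecord := measurable_stepRecord (V := V) i₀ n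
  have hstep := h.step n j
  rw [chainPast_eq_comap i₀] at hstep
  rw [Measure.restrict_map hX (measurableSet_apply_eq (n + 1) j), Measure.map_map hrecord hX,
    Measure.map_map hrecord hX]
  exact (condExp_comap_ae_eq_iff (hrecord.comp hX)
    (h.measurable (n + 1) (measurableSet_singleton j)) (measurable_stepProb a n j)
    fun x => stepProb_nonneg ha n x j).1 (hstep.trans (Filter.Eventually.of_forall fun ω =>
      (stepProb_stepRecord i₀ a n (fun k => X k ω) j).symm))

end StepProbability

section EdgeReinforced

variable {V : Type*} [MeasurableSpace V] [DiscreteMeasurableSpace V] [Countable V]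
  {G : SimpleGraph V}

variable (G) in
/-- The rule of the edge-reinforced random walk, which crosses an edge at the rate given by the
weight of the edge plus the number of previous crossings. -/
def edgeReinforced : ReinforcementRule G where
  rate n h e := reinforcedWeight G h.1 (fun k => (h.2 k).1) n e
  measurable_rate n e := by
    simp only [reinforcedWeight_eq_add_crossings]
    have hcrossings : Measurable fun h : RaceHistory G => crossings (fun k => (h.2 k).1) e n :=
      (measurable_crossings (e : Sym2 V) n).comp (by fun_prop)
    exact ((measurable_pi_apply e).comp measurable_fst).add (measurable_from_top.comp hcrossings)

variable [G.LocallyFinite] (hdeg : ∀ x, ∃ y, G.Adj x y) {a : G.edgeSet → ℝ} (ha : ∀ e, 0 < a e)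
  {n : ℕ}

include ha

lemma edgeReinforced_speed {z : ℕ → V × ℝ} {e : G.edgeSet} (he : (z n).1 ∈ (e : Sym2 V)) :
    ((edgeReinforced G).race hdeg).speed n (a, z) e =
      reinforcedWeight G a (fun k => (z k).1) n e :=
  (edgeReinforced G).race_speed_of_mem hdeg he (reinforcedWeight_pos ha _ n e)

lemma edgeReinforced_jumpProb (z : ℕ → V × ℝ) (j : V) :
    (edgeReinforced G).jumpProb hdeg n (a, z) j 0 = stepProb a n (fun k => (z k).1) j := by
  have hweight := pairWeight_congr fun e he =>
    edgeReinforced_speed hdeg ha (n := n) (z := z) (e := e) he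
  rw [(edgeReinforced G).jumpProb_of_position_eq hdeg rfl, mul_zero, Real.exp_zero, mul_one,
    stepProb]
  simp only [hweight]

variable [Nonempty G.edgeSet] (i₀ : V)

lemma hasStepLaw_edgeReinforced :
    HasStepLaw i₀ (stepProb a) (((edgeReinforced G).kernel hdeg i₀ a).map fun z n => (z n).1) :=
  ((edgeReinforced G).hasJumpLaw_kernel hdeg i₀ a).hasStepLaw
    ((edgeReinforced G).ae_kernel_holding_pos hdeg i₀ a) (measurable_stepProb a)
    fun _ z j => edgeReinforced_jumpProb hdeg ha z j

lemma IsERRW.map_eq {Ω : Type*} [MeasurableSpace Ω] {P : Measure Ω} [IsProbabilityMeasure P]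
    {X : ℕ → Ω → V} (h : IsERRW G a i₀ P X) : P.map (fun ω n => X n ω) =
      ((edgeReinforced G).kernel hdeg i₀ a).map fun z n => (z n).1 := by
  have hX : Measurable fun ω n => X n ω := measurable_pi_lambda _ h.measurable
  have hskeleton : Measurable fun (z : ℕ → V × ℝ) (n : ℕ) => (z n).1 := by fun_prop
  have := Measure.isProbabilityMeasure_map (μ := P) hX.aemeasurable
  have := Measure.isProbabilityMeasure_map (μ := (edgeReinforced G).kernel hdeg i₀ a)
    hskeleton.aemeasurable
  exact (h.hasStepLaw ha).unique (hasStepLaw_edgeReinforced hdeg ha i₀)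

lemma ae_isAlarmRace_edgeReinforced : ∀ᵐ σ ∂expField (G.edgeSet × ℕ),
    IsAlarmRace (fun e => alarmTime (a e) fun k => σ (e, k))
      (fun n => ((edgeReinforced G).walk hdeg i₀ (a, σ) n).1)
      fun n => ((edgeReinforced G).walk hdeg i₀ (a, σ) n).2 := by
  have hrace := (edgeReinforced G).ae_isEdgeRace_walk hdeg i₀ (Measure.dirac a)
  rw [Measure.dirac_prod] at hrace
  filter_upwards [ae_of_ae_map measurable_prodMk_left.aemeasurable hrace] with σ hσ
  refine hσ.isAlarmRace_of_crossings ha (fun n e he => ?_) fun n e he => ?_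
  · rw [← jumpRecord_apply_fst i₀ _ le_rfl] at he
    rw [edgeReinforced_speed hdeg ha he, reinforcedWeight_congr a fun k hk =>
      jumpRecord_apply_fst i₀ _ hk, reinforcedWeight_eq_add_crossings]
  · refine (edgeReinforced G).race_speed_of_notMem hdeg ?_
    rwa [jumpRecord_apply_fst i₀ _ le_rfl]

end EdgeReinforced

/-! ### The coupling -/

lemma strictMono_alarmTime {b : ℝ} (hb : 0 < b) {τ : ℕ → ℝ} (hτ : ∀ k, 0 < τ k) :
    StrictMono (alarmTime b τ) := by
  refine strictMono_nat_of_lt_succ fun k => ?_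
  have hτk := hτ k
  have hstep : 0 < 1 / (b + k) * τ k := by positivity
  rw [alarmTime, alarmTime, Finset.sum_range_succ]
  linarith

lemma FollowsAlarms.jumpPath_eq_timeChangedPath {V : Type*} [MeasurableSpace V]
    [DiscreteMeasurableSpace V] [Countable V] {G : SimpleGraph V}
    {a : G.edgeSet → ℝ} {τ : G.edgeSet → ℕ → ℝ} {ξ : ℕ → V} {S : ℕ → ℝ} {z : ℕ → V × ℝ}
    (h : FollowsAlarms G a τ ξ S) (ha : ∀ e, 0 < a e) (hτ : ∀ e k, 0 < τ e k)
    (hz : ∀ n, 0 < (z n).2) (hrace : IsAlarmRace (fun e => alarmTime (a e) (τ e))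
      (fun n => (z n).1) (logHolding (fun n => (z n).1) fun n => (z n).2))
    (h0 : ξ 0 = (z 0).1) : (fun t : ℝ≥0 => jumpPath ξ S t) = timeChangedPath z := by
  obtain ⟨rfl, rfl⟩ := h.eq_of_isAlarmRace hrace (fun e => strictMono_alarmTime (ha e) (hτ e)) h0
  exact funext fun t => (timeChange_jumpPath hz t.2).symm

section Coupling

variable {V : Type*} [MeasurableSpace V] {G : SimpleGraph V} (hdeg : ∀ x, ∃ y, G.Adj x y)
  {a : G.edgeSet → ℝ} {i₀ : V} {Ω : Type*} [MeasurableSpace Ω] {P : Measure Ω}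
  {τ : G.edgeSet → ℕ → Ω → ℝ} {ξ : ℕ → Ω → V} {S : ℕ → Ω → ℝ}

lemma IsContinuousTimeERRW.hasLaw_alarms (h : IsContinuousTimeERRW G a i₀ P τ ξ S) :
    HasLaw (fun ω (k : G.edgeSet × ℕ) => τ k.1 k.2 ω) (expField (G.edgeSet × ℕ)) P :=
  h.indep_alarm.hasLaw_infinitePi (fun k => h.law_alarm k.1 k.2)
    (measurable_pi_lambda _ fun k : G.edgeSet × ℕ => h.measurable_alarm k.1 k.2).aemeasurable

lemma IsContinuousTimeERRW.hasLaw_poissonClocks [Countable V]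
    (h : IsContinuousTimeERRW G a i₀ P τ ξ S) (ha : ∀ e, 0 < a e) :
    HasLaw (fun ω => poissonClocks a fun k => τ k.1 k.2 ω)
      ((gammaConductances a).prod (expField (G.edgeSet × ℕ))) P :=
  HasLaw.fun_comp ⟨(measurable_poissonClocks a).aemeasurable, map_poissonClocks ha⟩
    h.hasLaw_alarms

variable [DiscreteMeasurableSpace V] [Countable V] [G.LocallyFinite] [Nonempty G.edgeSet]

include hdeg in
lemma IsVRJPKernel.compProd_eq (ha : ∀ e, 0 < a e) {κ : Kernel (G.edgeSet → ℝ) (ℕ → V × ℝ)}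
    (hκ : IsVRJPKernel G i₀ κ) :
    gammaConductances a ⊗ₘ κ = gammaConductances a ⊗ₘ (vertexReinforced G).kernel hdeg i₀ := by
  have := isProbabilityMeasure_gammaConductances ha
  have := hκ.1
  refine Measure.compProd_congr ?_
  filter_upwards [ae_gammaConductances_pos ha] with w hw using hκ.apply_eq hdeg hw

variable (i₀)

lemma ae_isAlarmRace_vertexReinforced (ha : ∀ e, 0 < a e) :
    ∀ᵐ p ∂(gammaConductances a).prod (expField (G.edgeSet × ℕ)),
      (∀ n, 0 < ((vertexReinforced G).walk hdeg i₀ p n).2) ∧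
      IsAlarmRace (fun e => alarmTime (a e) fun k => logIncrements a p (e, k))
        (fun n => ((vertexReinforced G).walk hdeg i₀ p n).1)
        (logHolding (fun n => ((vertexReinforced G).walk hdeg i₀ p n).1)
          fun n => ((vertexReinforced G).walk hdeg i₀ p n).2) := by
  have := isProbabilityMeasure_gammaConductances ha
  filter_upwards [(vertexReinforced G).ae_isEdgeRace_walk hdeg i₀ (gammaConductances a),
    ae_poissonClocks_logIncrements ha] with p hrace ⟨hw, hσ, _⟩
  refine ⟨hrace.holding_pos, hrace.isAlarmRace_logHolding hw (fun n e y he => ?_)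
    (fun n e he => ?_) fun e k => ?_⟩
  · exact vertexReinforced_speed hdeg i₀ hw (fun k _ => hrace.holding_pos k) he
  · refine (vertexReinforced G).race_speed_of_notMem hdeg ?_
    rwa [jumpRecord_apply_fst i₀ _ le_rfl]
  · exact exp_alarmTime_logIncrement (ha e) (hw e) (fun l => hσ (e, l)) k

lemma map_skeleton_walk_vertexReinforced (ha : ∀ e, 0 < a e) :
    ((gammaConductances a).prod (expField (G.edgeSet × ℕ))).map
        (fun p n => ((vertexReinforced G).walk hdeg i₀ p n).1) =
      (expField (G.edgeSet × ℕ)).map fun σ n => ((edgeReinforced G).walk hdeg i₀ (a, σ) n).1 := by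
  have hwalk : Measurable fun (σ : G.edgeSet × ℕ → ℝ) (n : ℕ) =>
      ((edgeReinforced G).walk hdeg i₀ (a, σ) n).1 :=
    measurable_pi_lambda _ fun n => ((measurable_pi_apply n).comp
      ((edgeReinforced G).measurable_walk_mk hdeg i₀ a)).fst
  have halarm := ae_isAlarmRace_edgeReinforced hdeg ha i₀
  rw [← map_logIncrements ha] at halarm
  conv_rhs => rw [← map_logIncrements ha, Measure.map_map hwalk (measurable_logIncrements a)]
  refine Measure.map_congr ?_
  filter_upwards [ae_isAlarmRace_vertexReinforced hdeg i₀ ha,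
    ae_of_ae_map (measurable_logIncrements a).aemeasurable halarm] with p ⟨_, hvertex⟩ hedge
  exact (hvertex.unique hedge rfl).1

variable {i₀}

lemma IsVRJPKernel.map_skeleton (ha : ∀ e, 0 < a e) {κ : Kernel (G.edgeSet → ℝ) (ℕ → V × ℝ)}
    (hκ : IsVRJPKernel G i₀ κ) :
    ((gammaConductances a).bind κ).map (fun z n => (z n).1) =
      ((edgeReinforced G).kernel hdeg i₀ a).map fun z n => (z n).1 := by
  have := isProbabilityMeasure_gammaConductances ha
  have := hκ.1
  have hwalk := (vertexReinforced G).measurable_walk hdeg i₀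
  have hskel : Measurable fun (z : ℕ → V × ℝ) (n : ℕ) => (z n).1 :=
    measurable_pi_lambda _ fun n => by fun_prop
  rw [← Measure.snd_compProd, hκ.compProd_eq hdeg ha, ← (vertexReinforced G).map_walk hdeg i₀,
    Measure.snd, Measure.map_map measurable_snd (measurable_fst.prodMk hwalk),
    Measure.map_map hskel (measurable_snd.comp (measurable_fst.prodMk hwalk)),
    ReinforcementRule.kernel_apply,
    Measure.map_map hskel ((edgeReinforced G).measurable_walk_mk hdeg i₀ a)]
  exact map_skeleton_walk_vertexReinforced hdeg i₀ ha

lemma IsVRJPKernel.hasCondDistrib_walk (ha : ∀ e, 0 < a e)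
    {κ : Kernel (G.edgeSet → ℝ) (ℕ → V × ℝ)} (hκ : IsVRJPKernel G i₀ κ)
    {C : Ω → (G.edgeSet → ℝ) × (G.edgeSet × ℕ → ℝ)}
    (hC : HasLaw C ((gammaConductances a).prod (expField (G.edgeSet × ℕ))) P) :
    HasCondDistrib (fun ω => (vertexReinforced G).walk hdeg i₀ (C ω)) (fun ω => (C ω).1) κ P := by
  have := isProbabilityMeasure_gammaConductances ha
  have hfst : HasLaw (fun ω => (C ω).1) (gammaConductances a) P :=
    measurePreserving_fst.fun_comp_hasLaw hC
  have hpair : Measurable fun p => (p.1, (vertexReinforced G).walk hdeg i₀ p) :=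
    measurable_fst.prodMk ((vertexReinforced G).measurable_walk hdeg i₀)
  rw [HasCondDistrib, hfst.map_eq, hκ.compProd_eq hdeg ha, ← ReinforcementRule.map_walk]
  exact HasLaw.fun_comp ⟨hpair.aemeasurable, rfl⟩ hC

lemma IsContinuousTimeERRW.jumpPath_ae_eq (h : IsContinuousTimeERRW G a i₀ P τ ξ S)
    (ha : ∀ e, 0 < a e) :
    ∀ᵐ ω ∂P, (fun t : ℝ≥0 => jumpPath (fun n => ξ n ω) (fun n => S n ω) t) = timeChangedPath
      ((vertexReinforced G).walk hdeg i₀ (poissonClocks a fun k => τ k.1 k.2 ω)) := by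
  have hlaw := h.hasLaw_alarms
  have hclocks := h.hasLaw_poissonClocks ha
  have hinv := ae_logIncrements_poissonClocks ha
  have hpos := ae_expField_pos (ι := G.edgeSet × ℕ)
  have hrace := ae_isAlarmRace_vertexReinforced hdeg i₀ ha
  rw [← hlaw.map_eq] at hinv hpos
  rw [← hclocks.map_eq] at hrace
  filter_upwards [ae_of_ae_map hlaw.aemeasurable hinv, ae_of_ae_map hlaw.aemeasurable hpos,
    ae_of_ae_map hclocks.aemeasurable hrace, h.start, h.dynamics] with
    ω hinv hpos ⟨hholding, hrace⟩ hstart hfollows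
  rw [hinv] at hrace
  exact hfollows.jumpPath_eq_timeChangedPath ha (fun e k => hpos (e, k)) hholding hrace hstart

include hdeg in
lemma IsContinuousTimeERRW.exists_conductances [IsProbabilityMeasure P]
    (h : IsContinuousTimeERRW G a i₀ P τ ξ S) (ha : ∀ e, 0 < a e) :
    ∃ W : G.edgeSet → Ω → ℝ, (∀ e, Measurable (W e)) ∧ iIndepFun W P ∧
      (∀ e, HasLaw (W e) (gammaMeasure (a e) 1) P) ∧
      ∀ κ : Kernel (G.edgeSet → ℝ) (ℕ → V × ℝ), IsVRJPKernel G i₀ κ →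
        HasCondDistrib (fun ω (t : ℝ≥0) => jumpPath (fun n => ξ n ω) (fun n => S n ω) (t : ℝ))
          (fun ω e => W e ω) (κ.map timeChangedPath) P := by
  have := fun e => isProbabilityMeasure_gammaMeasure (ha e) one_pos
  have hclocks := h.hasLaw_poissonClocks ha
  have hW : HasLaw (fun ω => (poissonClocks a fun k => τ k.1 k.2 ω).1) (gammaConductances a) P :=
    measurePreserving_fst.fun_comp_hasLaw hclocks
  have hWm : Measurable fun ω => (poissonClocks a fun k => τ k.1 k.2 ω).1 :=
    ((measurable_poissonClocks a).comp
      (measurable_pi_lambda _ fun k => h.measurable_alarm k.1 k.2)).fst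
  have hWe : ∀ e, HasLaw (fun ω => (poissonClocks a fun k => τ k.1 k.2 ω).1 e)
      (gammaMeasure (a e) 1) P := fun e =>
    (measurePreserving_eval_infinitePi _ e).fun_comp_hasLaw hW
  refine ⟨fun e ω => (poissonClocks a fun k => τ k.1 k.2 ω).1 e,
    fun e => (measurable_pi_apply e).comp hWm,
    (iIndepFun_iff_hasLaw_Pi_infinitePi hWe hW.aemeasurable).2 hW, hWe, fun κ hκ => ?_⟩
  have := hκ.1
  have hcond := (hκ.hasCondDistrib_walk hdeg ha hclocks).comp_left measurable_timeChangedPath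
  exact HasLaw.congr hcond ((h.jumpPath_ae_eq hdeg ha).mono fun ω hω => Prod.ext rfl hω)

end Coupling

section Connected

variable {V : Type*} {G : SimpleGraph V} [G.LocallyFinite]

lemma countable_setOf_exists_walk (n : ℕ) (x : V) :
    {y | ∃ p : G.Walk x y, p.length = n}.Countable := by
  induction n generalizing x with
  | zero =>
    refine (Set.countable_singleton x).mono fun y ⟨p, hp⟩ => ?_
    exact (SimpleGraph.Walk.eq_of_length_eq_zero hp).symm
  | succ n ih =>
    have hunion := (G.neighborFinset x).countable_toSet.biUnion fun v _ => ih v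
    refine hunion.mono ?_
    rintro y ⟨_ | ⟨hadj, p⟩, hp⟩
    · exact absurd hp (by simp)
    · exact Set.mem_biUnion (by simpa using hadj) ⟨p, by simpa using hp⟩

lemma countable_of_connected (hG : G.Connected) : Countable V := by
  obtain ⟨x⟩ := hG.nonempty
  have hcover : (⋃ n, {y | ∃ p : G.Walk x y, p.length = n}) = Set.univ :=
    Set.eq_univ_of_forall fun y =>
      Set.mem_iUnion.2 ((hG.preconnected x y).elim fun p => ⟨_, p, rfl⟩)
  refine Set.countable_univ_iff.1 (hcover ▸ ?_)
  exact Set.countable_iUnion fun n => countable_setOf_exists_walk n x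

end Connected

end

theorem theorem1_general {V : Type*} [Countable V] [MeasurableSpace V] [DiscreteMeasurableSpace V]
    (G : SimpleGraph V) [G.LocallyFinite] (hdeg : ∀ x, ∃ y, G.Adj x y)
    (a : G.edgeSet → ℝ) (ha : ∀ e, 0 < a e) (i₀ : V) :
    (∃ κ : Kernel (G.edgeSet → ℝ) (ℕ → V × ℝ), IsVRJPKernel G i₀ κ) ∧
    Measurable (timeChangedPath : (ℕ → V × ℝ) → (ℝ≥0 → Option V)) ∧
    (∀ {Ω : Type*} [MeasurableSpace Ω] (P : Measure Ω) [IsProbabilityMeasure P]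
      (τ : G.edgeSet → ℕ → Ω → ℝ) (ξ : ℕ → Ω → V) (S : ℕ → Ω → ℝ),
      IsContinuousTimeERRW G a i₀ P τ ξ S →
      ∃ W : G.edgeSet → Ω → ℝ, (∀ e, Measurable (W e)) ∧ iIndepFun W P ∧
        (∀ e, HasLaw (W e) (gammaMeasure (a e) 1) P) ∧
        ∀ κ : Kernel (G.edgeSet → ℝ) (ℕ → V × ℝ), IsVRJPKernel G i₀ κ →
          HasCondDistrib
            (fun ω (t : ℝ≥0) => jumpPath (fun n => ξ n ω) (fun n => S n ω) (t : ℝ))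
            (fun ω e => W e ω)
            (κ.map timeChangedPath) P) ∧
    (∀ {Ω : Type*} [MeasurableSpace Ω] (P : Measure Ω) [IsProbabilityMeasure P] (X : ℕ → Ω → V),
      IsERRW G a i₀ P X →
      ∀ κ : Kernel (G.edgeSet → ℝ) (ℕ → V × ℝ), IsVRJPKernel G i₀ κ →
        P.map (fun ω n => X n ω) =
          ((gammaConductances a).bind κ).map (fun z n => (z n).1)) := by
  have : Nonempty G.edgeSet := by
    obtain ⟨y, hy⟩ := hdeg i₀
    exact ⟨⟨s(i₀, y), G.mem_edgeSet.2 hy⟩⟩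
  exact ⟨⟨_, isVRJPKernel_vertexReinforced hdeg i₀⟩, measurable_timeChangedPath,
    fun P _ τ ξ S h => h.exists_conductances hdeg ha,
    fun P _ X h κ hκ => (h.map_eq hdeg ha i₀).trans (hκ.map_skeleton hdeg ha).symm⟩

theorem theorem1 {V : Type*} [Nontrivial V] [MeasurableSpace V] [DiscreteMeasurableSpace V]
    (G : SimpleGraph V) [G.LocallyFinite] (hG : G.Connected)
    (a : G.edgeSet → ℝ) (ha : ∀ e, 0 < a e) (i₀ : V) :
    -- the law of the VRJP exists, as a measurable function of its weights
    (∃ κ : Kernel (G.edgeSet → ℝ) (ℕ → V × ℝ), IsVRJPKernel G i₀ κ) ∧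
    -- the time modification is a measurable function of the path
    Measurable (timeChangedPath : (ℕ → V × ℝ) → (ℝ≥0 → Option V)) ∧
    -- the continuous-time ERRW, conditionally on suitable independent Gamma variables
    (∀ {Ω : Type*} [MeasurableSpace Ω] (P : Measure Ω) [IsProbabilityMeasure P]
      (τ : G.edgeSet → ℕ → Ω → ℝ) (ξ : ℕ → Ω → V) (S : ℕ → Ω → ℝ),
      IsContinuousTimeERRW G a i₀ P τ ξ S →
      ∃ W : G.edgeSet → Ω → ℝ, (∀ e, Measurable (W e)) ∧ iIndepFun W P ∧
        (∀ e, HasLaw (W e) (gammaMeasure (a e) 1) P) ∧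
        ∀ κ : Kernel (G.edgeSet → ℝ) (ℕ → V × ℝ), IsVRJPKernel G i₀ κ →
          HasCondDistrib
            (fun ω (t : ℝ≥0) => jumpPath (fun n => ξ n ω) (fun n => S n ω) (t : ℝ))
            (fun ω e => W e ω)
            (κ.map timeChangedPath) P) ∧
    -- the discrete ERRW and the discrete skeleton of the VRJP in Gamma conductances
    (∀ {Ω : Type*} [MeasurableSpace Ω] (P : Measure Ω) [IsProbabilityMeasure P] (X : ℕ → Ω → V),
      IsERRW G a i₀ P X →
      ∀ κ : Kernel (G.edgeSet → ℝ) (ℕ → V × ℝ), IsVRJPKernel G i₀ κ →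
        P.map (fun ω n => X n ω) =
          ((gammaConductances a).bind κ).map (fun z n => (z n).1)) := by
  have := countable_of_connected hG
  exact theorem1_general G (fun x => hG.preconnected.exists_adj_of_nontrivial x) a ha i₀
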